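/- **Setting.** Let $k$ be an algebraically closed field and let $p$ be its characteristic exponent ($p=\operatorname{char} k$ if this is positive, $p=1$ if $\operatorname{char} k=0$). Let $R$ be the coordinate ring of a nonempty affine open subset of a nonsingular (irreducible) variety of dimension $d$ over $k$, i.e. a smooth $k$-algebra that is a domain, of Krull dimension $d$. Write $\mathfrak m\text{-Spec}\,R$ for the space of closed points of $\operatorname{Spec}R$, with the Zariski topology. An *idealistic filtration* over a ring $A$ is a subset $\mathbb I\subseteq A\times\mathbb R$ such that, with $\mathbb I_a=\{f\mid (f,a)\in\mathbb I\}$: each $\mathbb I_a$ is an ideal; $\mathbb I_0=A$; $\mathbb I_a\mathbb I_b\subseteq\mathbb I_{a+b}$; and $\mathbb I_a\subseteq\mathbb I_b$ whenever $b\le a$. For $A = R$, it is *$\mathfrak D$-saturated* if $(f,a)\in\mathbb I$ implies $(Df,a-t)\in\mathbb I$ for every $k$-linear differential operator $D$ of $R$ of degree $\le t$, $t\in\mathbb Z_{\ge0}$. It is of *r.f.g. type* if it is the smallest idealistic filtration containing some finite subset of $R\times\mathbb Q$. Let $\mathbb I$ be a $\mathfrak D$-saturated idealistic filtration over $R$.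 For a closed point $P$ let $\mathfrak m=\mathfrak m_P$ be the maximal ideal of $R_P$ and let $\mathbb I_P$ be the localization, $(\mathbb I_P)_a=\mathbb I_aR_P$. Put $$L_n=\{f \bmod \mathfrak m^{n+1}\mid f\in(\mathbb I_P)_n\cap\mathfrak m^n\}\subseteq\mathfrak m^n/\mathfrak m^{n+1},\qquad L^{\mathrm{pure}}_{p^e}=L_{p^e}\cap\{v^{p^e}\mid v\in\mathfrak m/\mathfrak m^2\}\quad(e\in\mathbb Z_{\ge0}),$$ $l^{\mathrm{pure}}_{p^e}(P)=\dim_kL^{\mathrm{pure}}_{p^e}$ and $\sigma(P)=(d-l^{\mathrm{pure}}_{p^e}(P))_{e\ge0}$. (In characteristic zero this is the constant sequence with value $d-l^{\mathrm{pure}}_{1}(P)$.) A *leading generator system* (LGS) of $\mathbb I_P$ consists of $(h_1,p^{e_1}),\dots,(h_N,p^{e_N})\in\mathbb I_P$ with $0\le e_1\le\cdots\le e_N$, $h_l\in\mathfrak m^{p^{e_l}}$ and $\overline{h_l}=(h_l \bmod \mathfrak m^{p^{e_l}+1})\in L^{\mathrm{pure}}_{p^{e_l}}$, such that for every $e\ge0$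 the elements $\overline{h_l}^{\,p^{e-e_l}}$ with $e_l\le e$ are distinct and form a $k$-basis of $L^{\mathrm{pure}}_{p^e}$. For $\mathcal H=\{h_1,\dots,h_N\}$ put $$\operatorname{ord}_{\mathcal H}(f)=\sup\{n\in\mathbb Z_{\ge0}\mid f\in\mathfrak m^n+(\mathcal H)\},\qquad \widetilde\mu(P)=\inf\Big\{\tfrac{\operatorname{ord}_{\mathcal H}(f)}a\;\Big|\;(f,a)\in\mathbb I_P,\ a>0\Big\}\in\mathbb R_{\ge0}\cup\{\infty\}.$$ Order $V=\big(\prod_{e\ge0}\mathbb Z_{\ge0}\big)\times(\mathbb R_{\ge0}\cup\{\infty\})$ lexicographically (sequences being ordered lexicographically too). **Proposition.** (0) The invariants are well defined: $l^{\mathrm{pure}}_{p^e}(P)\le d$ for all $P$ and $e$, and at every closed point $P$ an LGS of $\mathbb I_P$ exists and $\widetilde\mu(P)$ does not depend on its choice. (1) The function $(\sigma,\widetilde\mu):\mathfrak m\text{-Spec}\,R\to V$ is upper semi-continuous: for every $t\in V$ the set $\{P\mid(\sigma,\widetilde\mu)(P)\ge t\}$ is closed. (2) Assume moreover that $\mathbb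 I$ is of r.f.g. type. Then there is an integer $\delta>0$ such that $\widetilde\mu(P)\in\frac1\delta\mathbb Z_{\ge0}\cup\{\infty\}$ for all closed points $P$. The subset $T\subseteq V$ of the pairs whose first entry is a non-increasing sequence and whose second entry lies in $\frac1\delta\mathbb Z_{\ge0}\cup\{\infty\}$ is well-ordered. The function extends to $F=(\sigma,\widetilde\mu):\operatorname{Spec}R\to T$, where $$F(Q)=\min\{(\sigma,\widetilde\mu)(P)\mid P\in\mathfrak m\text{-Spec}\,R,\ P\in\overline{\{Q\}}\}$$ (the minimum exists). Equivalently, $F(Q)$ is the value at a general closed point of $\overline{\{Q\}}$: one has $F(Q)=v$ if and only if $(\sigma,\widetilde\mu)(P)=v$ for all closed points $P$ of some nonempty open subset of $\overline{\{Q\}}$. The function $F$ is upper semi-continuous: for every $t\in V$ the sets $\{F\ge t\}$ and $\{F>t\}$ are closed, and every $Q$ has an open neighbourhood on which $F\le F(Q)$. Finally, $F$ takes only finitely many values $t_0<\cdots<t_n$. Writing $X_{\ge t}=\{Q\in\operatorname{Spec}R\mid F(Q)\ge t\}$, the sets $\operatorname{Spec}R=X_{\ge t_0}\supsetneq\cdots\supsetneq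 X_{\ge t_n}\supsetneq\emptyset$ are closed and stratify $\operatorname{Spec}R$ into the level sets $\{F=t_i\}=X_{\ge t_i}\setminus X_{\ge t_{i+1}}$ (with $X_{\ge t_{n+1}}=\emptyset$). -/

import Mathlib

/-- An idealistic filtration over a commutative ring `R`, i.e. a subset `𝕀 ⊆ R × ℝ` such that
`(f, 0) ∈ 𝕀` and `(0, a) ∈ 𝕀` for all `f`, `a`; each level `𝕀_a = {f | (f, a) ∈ 𝕀}` is closed under
addition and under multiplication by elements of `R`; `(f, a), (g, b) ∈ 𝕀` implies
`(f g, a + b) ∈ 𝕀`; and `(f, a) ∈ 𝕀`, `b ≤ a` implies `(f, b) ∈ 𝕀`.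
It is recorded through its levels, which are ideals. -/
structure IdealisticFiltration (R : Type*) [CommRing R] where
  /-- `level a = 𝕀_a` is the ideal at level `a`, so `(f, a) ∈ 𝕀` reads `f ∈ 𝕀.level a`. -/
  level : ℝ → Ideal R
  level_zero : level 0 = ⊤
  mul_mem : ∀ {a b : ℝ} {f g : R}, f ∈ level a → g ∈ level b → f * g ∈ level (a + b)
  antitone : Antitone level

/-- `D` is a `k`-linear differential operator of degree at most `n` on `R`
(in the sense of Grothendieck). -/
def IsDiffOp (k : Type*) {R : Type*} [Field k] [CommRing R] [Algebra k R] :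
    ℕ → (R →ₗ[k] R) → Prop
  | 0, D => ∀ r f : R, D (r * f) = r * D f
  | n + 1, D => ∀ r : R,
      IsDiffOp k n (D ∘ₗ LinearMap.mulLeft k r - LinearMap.mulLeft k r ∘ₗ D)

namespace IdealisticFiltration

/-- `𝔇`-saturation: if `(f, a) ∈ 𝕀` and `D` is a differential operator of degree at most `t`,
then `(D f, a - t) ∈ 𝕀`. -/
def IsDSaturated (k : Type*) {R : Type*} [Field k] [CommRing R] [Algebra k R]
    (I : IdealisticFiltration R) : Prop :=
  ∀ (t : ℕ) (D : R →ₗ[k] R), IsDiffOp k t D →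
    ∀ (a : ℝ) (f : R), f ∈ I.level a → D f ∈ I.level (a - t)

/-- Rationally and finitely generated type: `I` is the smallest idealistic filtration
containing some finite subset of `R × ℚ`. -/
def IsRFG {R : Type*} [CommRing R] (I : IdealisticFiltration R) : Prop :=
  ∃ T : Finset (R × ℚ), (∀ x ∈ T, x.1 ∈ I.level (x.2 : ℝ)) ∧
    ∀ J : IdealisticFiltration R, (∀ x ∈ T, x.1 ∈ J.level (x.2 : ℝ)) →
      ∀ a : ℝ, I.level a ≤ J.level a

/-- The localization `𝕀_P` over `R_P`, with `(𝕀_P)_a = 𝕀_a R_P`. -/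
noncomputable def localize {R : Type*} [CommRing R] (I : IdealisticFiltration R)
    (P : Ideal R) [P.IsPrime] : IdealisticFiltration (Localization.AtPrime P) where
  level a := (I.level a).map (algebraMap R (Localization.AtPrime P))
  level_zero := by rw [I.level_zero, Ideal.map_top]
  mul_mem {a b f g} hf hg := by
    have h : I.level a * I.level b ≤ I.level (a + b) :=
      Ideal.mul_le.2 fun _ hr _ hs => I.mul_mem hr hs
    have h' := Ideal.map_mono (f := algebraMap R (Localization.AtPrime P)) h
    rw [Ideal.map_mul] at h'
    exact h' (Ideal.mul_mem_mul hf hg)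
  antitone := fun _ _ hab => Ideal.map_mono (I.antitone hab)

section LocalTheory

/-! Invariants of an idealistic filtration over a local `k`-algebra `A` with maximal ideal `𝔪`.
The degree `n` part `𝔪 ^ n / 𝔪 ^ (n + 1)` of the associated graded ring is regarded as a subspace
of `A / 𝔪 ^ (n + 1)`. The number `p` is the characteristic exponent of `k`. In characteristic zero
`p = 1`, so that the invariants below for `e > 0` merely repeat the ones for `e = 0`. -/

variable (k : Type*) {A : Type*} [Field k] [CommRing A] [IsLocalRing A] [Algebra k A]

/-- The quotient map `A → A / 𝔪 ^ (n + 1)`, as a `k`-linear map. -/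
noncomputable def toJet (A : Type*) [CommRing A] [IsLocalRing A] [Algebra k A] (n : ℕ) :
    A →ₗ[k] A ⧸ (IsLocalRing.maximalIdeal A ^ (n + 1)) :=
  (Ideal.Quotient.mkₐ k (IsLocalRing.maximalIdeal A ^ (n + 1))).toLinearMap

/-- The degree `n` part `L(J)_n ⊆ 𝔪 ^ n / 𝔪 ^ (n + 1)` of the leading algebra: the classes of
the `f ∈ 𝔪 ^ n` with `(f, n) ∈ J`. -/
noncomputable def leading (J : IdealisticFiltration A) (n : ℕ) :
    Submodule k (A ⧸ (IsLocalRing.maximalIdeal A ^ (n + 1))) :=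
  Submodule.map (toJet k A n)
    ((J.level (n : ℝ) ⊓ IsLocalRing.maximalIdeal A ^ n).restrictScalars k)

/-- The pure part `L(J)_{p^e}^pure`: the elements of `L(J)_{p^e}` which are `p ^ e`-th powers of
elements of `𝔪 / 𝔪 ^ 2`, i.e. classes of `x ^ (p ^ e)` with `x ∈ 𝔪`. -/
noncomputable def purePart [IsAlgClosed k] (p : ℕ) [ExpChar k p] (J : IdealisticFiltration A)
    (e : ℕ) : Submodule k (A ⧸ (IsLocalRing.maximalIdeal A ^ (p ^ e + 1))) where
  carrier := {y | y ∈ leading k J (p ^ e) ∧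
    ∃ x ∈ IsLocalRing.maximalIdeal A, toJet k A (p ^ e) (x ^ p ^ e) = y}
  zero_mem' := ⟨Submodule.zero_mem _, 0, Ideal.zero_mem _, by
    rw [zero_pow (pow_pos (expChar_pos k p) e).ne', map_zero]⟩
  add_mem' := by
    rintro _ _ ⟨h₁, x, hx, rfl⟩ ⟨h₂, y, hy, rfl⟩
    have : ExpChar A p := expChar_of_injective_algebraMap (algebraMap k A).injective p
    exact ⟨Submodule.add_mem _ h₁ h₂, x + y, Ideal.add_mem _ hx hy, by
      rw [add_pow_expChar_pow, map_add]⟩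
  smul_mem' := by
    rintro c _ ⟨h₁, x, hx, rfl⟩
    obtain ⟨b, hb⟩ := IsAlgClosed.exists_pow_nat_eq c (pow_pos (expChar_pos k p) e)
    exact ⟨Submodule.smul_mem _ c h₁, b • x, Submodule.smul_of_tower_mem _ b hx, by
      rw [smul_pow, hb, map_smul]⟩

/-- `(h_l, p ^ e_l)`, `l = 1, …, N`, with `e_1 ≤ ⋯ ≤ e_N`, is a leading generator system of `J`. -/
structure IsLGS [IsAlgClosed k] (p : ℕ) [ExpChar k p] (J : IdealisticFiltration A)
    {N : ℕ} (h : Fin N → A) (e : Fin N → ℕ) : Prop where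
  monotone : Monotone e
  mem_level : ∀ l, h l ∈ J.level ((p ^ e l : ℕ) : ℝ)
  mem_pow : ∀ l, h l ∈ IsLocalRing.maximalIdeal A ^ p ^ e l
  leadingTerm_mem : ∀ l, toJet k A (p ^ e l) (h l) ∈ purePart k p J (e l)
  linearIndependent : ∀ n : ℕ, LinearIndependent k
    fun l : {l : Fin N // e l ≤ n} => toJet k A (p ^ n) (h l ^ p ^ (n - e l))
  span_eq : ∀ n : ℕ, Submodule.span k
    (Set.range fun l : {l : Fin N // e l ≤ n} => toJet k A (p ^ n) (h l ^ p ^ (n - e l))) =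
      purePart k p J n

/-- `ord_ℋ(f) = sup {n | f ∈ 𝔪 ^ n + (ℋ)}`. -/
noncomputable def ordMod {N : ℕ} (h : Fin N → A) (f : A) : ℕ∞ :=
  ⨆ (n : ℕ) (_ : f ∈ IsLocalRing.maximalIdeal A ^ n ⊔ Ideal.span (Set.range h)), (n : ℕ∞)

/-- `μ_ℋ(J) = inf {ord_ℋ(f) / a | (f, a) ∈ J, a > 0}`, with values in `[0, ∞]`. -/
noncomputable def muMod (J : IdealisticFiltration A) {N : ℕ} (h : Fin N → A) : ENNReal :=
  ⨅ (a : ℝ) (_ : 0 < a) (f : A) (_ : f ∈ J.level a),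
    (ordMod h f : ENNReal) / ENNReal.ofReal a

end LocalTheory

section Invariants

variable (k : Type*) {R : Type*} [Field k] [IsAlgClosed k] (p : ℕ) [ExpChar k p]
  [CommRing R] [Algebra k R]

/-- The dimension `l_{p^e}^pure(P)` of the pure part in degree `p ^ e` at the closed point `P`. -/
noncomputable def lPure (I : IdealisticFiltration R) (P : MaximalSpectrum R) (e : ℕ) : ℕ :=
  Module.finrank k (purePart k p (I.localize P.asIdeal) e)

/-- The invariant `σ(P) = (d - l_{p^e}^pure(P))_e`, in the lexicographically ordered set of
sequences of nonnegative integers. -/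
noncomputable def sigma (d : ℕ) (I : IdealisticFiltration R) (P : MaximalSpectrum R) :
    Lex (ℕ → ℕ) :=
  toLex fun e => d - lPure k p I P e

open Classical in
/-- The invariant `μ̃(P) = μ_ℋ(𝕀_P)`, computed with some leading generator system of `𝕀_P`. -/
noncomputable def muTilde (I : IdealisticFiltration R) (P : MaximalSpectrum R) : ENNReal :=
  if H : ∃ x : (N : ℕ) × (Fin N → Localization.AtPrime P.asIdeal) × (Fin N → ℕ),
      IsLGS k p (I.localize P.asIdeal) x.2.1 x.2.2 then
    muMod (I.localize P.asIdeal) H.choose.2.1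
  else 0

/-- The pair `(σ, μ̃)`, in the lexicographic product. -/
noncomputable def sigmaMu (d : ℕ) (I : IdealisticFiltration R) (P : MaximalSpectrum R) :
    Lex (ℕ → ℕ) ×ₗ ENNReal :=
  toLex (sigma k p d I P, muTilde k p I P)

end Invariants

/-- The set of the pairs `(t, b)` with `t` a non-increasing sequence of nonnegative integers and
`b ∈ (1/δ) ℤ_{≥ 0} ∪ {∞}`. -/
def boundedDenominatorValues (δ : ℕ) : Set (Lex (ℕ → ℕ) ×ₗ ENNReal) :=
  {x | Antitone (ofLex (ofLex x).1) ∧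
    ((ofLex x).2 = ⊤ ∨ ∃ m : ℕ, (ofLex x).2 = (m : ENNReal) / (δ : ENNReal))}

end IdealisticFiltration

/-!
The proof replaces differential operators by Taylor homomorphisms and the invariants by colengths.

*Taylor homomorphisms.* Since `R` is smooth, derivations dual to local coordinates integrate to a
homomorphism `τ : R → R⟦T⟧` (`exists_taylor`). The coefficient of `T ^ J` in `τ f` is a differential
operator of order at most `|J|`, so a `𝔇`-saturated filtration loses at most `|J|` in level under
it, and on leading forms it acts as a divided derivative. This is all that is used of saturation;
`HasFrames` records it for the local rings at closed points (`exists_hasFrames`).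

*The invariant `σ`.* If a leading generator system has leading forms `x_i ^ q_i`, the leading forms
of a proper filtration are combinations of monomials `x ^ D` with `q_i ∣ D_i` for all `i`; otherwise
a divided derivative would produce a pure leading form which is not accounted for
(`coeff_mem_of_not_dvd`). Hence the dimension of `A / (J_m + 𝔪 ^ (m + 1))`, with `m = p ^ e`, is a
number of monomials given by the pure dimensions (`HasFrames.finrank_quotient_level`), and the first
place where two sequences of pure dimensions differ is visible in these colengths
(`ncard_goodExponents_lt`).

*The invariant `μ̃`.* For `ν > 1`, order at least `ν a` modulo the `h_i` in every level `a` forces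
`J` into the filtration generated by `𝔪` in level `1 / ν` and by the `h_i` in level `q_i`
(`level_le_weighted`): an operator of order `r` applied to a monomial in the coordinates costs only
`r / ν < r` in that filtration. The colengths of the latter depend on the `q_i` alone, so `μ ≥ ν`
says that the colengths of the filtration generated by `J` and `𝔪` in level `1 / ν` are as large as
possible for the given `σ` (`HasFrames.ofReal_le_muMod_iff`). In particular `μ̃` does not depend on
the leading generator system (`HasFrames.muMod_eq`).

*Semi-continuity.* The ideals above are, at all closed points at once, the fibres of an ideal of
`R ⊗ R` whose quotient is finite over the left factor, being a quotient of some algebra of principal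
parts. By Nakayama's lemma colengths are upper semi-continuous
(`exists_finrank_quotient_mixedIdeal_le`), which gives the semi-continuity of `σ`, and of `μ̃` where
`σ` is constant (`isClosed_le_sigmaMu`). The bound by `d` holds because coordinates are
algebraically independent (`finrank_kaehlerDifferential_le`).

*Filtrations of r.f.g. type.* Here `μ̃` is a minimum over the generators
(`muMod_localize_eq_iInf`), which bounds denominators, and non-increasing sequences of natural
numbers are lexicographically well-ordered (`isWF_antitone`). The extension to `Spec R` and its
properties hold for every upper semi-continuous function with well-ordered values on the closed
points of a Noetherian Jacobson spectrum (`IsMinExtension`).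
-/

namespace IdealisticFiltration

open Finset IsLocalRing

/-! ### Multiplicative filtrations and filtrations of power series rings -/

section Basic

variable {A : Type*} [CommRing A] (Φ : IdealisticFiltration A)

lemma level_of_nonpos {a : ℝ} (ha : a ≤ 0) : Φ.level a = ⊤ :=
  top_le_iff.1 (Φ.level_zero ▸ Φ.antitone ha)

lemma mem_level_of_le {a b : ℝ} (h : b ≤ a) {f : A} (hf : f ∈ Φ.level a) : f ∈ Φ.level b :=
  Φ.antitone h hf

lemma pow_mem_level {a : ℝ} {f : A} (hf : f ∈ Φ.level a) (n : ℕ) :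
    f ^ n ∈ Φ.level (n * a) := by
  induction n with
  | zero => simp [Φ.level_of_nonpos]
  | succ n ih =>
    rw [pow_succ]
    refine Φ.mem_level_of_le (le_of_eq ?_) (Φ.mul_mem ih hf)
    push_cast; ring

lemma level_pow_le (a : ℝ) (n : ℕ) : Φ.level a ^ n ≤ Φ.level (n * a) := by
  induction n with
  | zero => simp [Φ.level_of_nonpos]
  | succ n ih =>
    rw [pow_succ]
    refine Ideal.mul_le.2 fun f hf g hg => ?_
    refine Φ.mem_level_of_le (le_of_eq ?_) (Φ.mul_mem (ih hf) hg)
    push_cast; ring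

lemma prod_mem_level {ι : Type*} (s : Finset ι) (u : ι → A) (a : ι → ℝ)
    (hu : ∀ i ∈ s, u i ∈ Φ.level (a i)) : ∏ i ∈ s, u i ∈ Φ.level (∑ i ∈ s, a i) := by
  classical
  induction s using Finset.induction_on with
  | empty => simp [Φ.level_of_nonpos]
  | insert i s hi ih =>
    rw [prod_insert hi, sum_insert hi]
    exact Φ.mul_mem (hu i (mem_insert_self _ _)) (ih fun j hj => hu j (mem_insert_of_mem hj))

lemma prod_pow_mem_level {ι : Type*} [Fintype ι] (u : ι → A) (a : ι → ℝ)
    (hu : ∀ i, u i ∈ Φ.level (a i)) (C : ι →₀ ℕ) :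
    ∏ i, u i ^ C i ∈ Φ.level (∑ i, C i * a i) :=
  Φ.prod_mem_level _ _ _ fun i _ => Φ.pow_mem_level (hu i) _

/-- If `u ≡ v` up to a gain of `δ` in a product of factors of given levels, then the products
agree up to the same gain. -/
lemma prod_sub_prod_mem_level {ι : Type*} (s : Finset ι) (u v : ι → A) (a : ι → ℝ) (δ : ℝ)
    (hu : ∀ i ∈ s, u i ∈ Φ.level (a i)) (hv : ∀ i ∈ s, v i ∈ Φ.level (a i))
    (huv : ∀ i ∈ s, u i - v i ∈ Φ.level (a i + δ)) :
    ∏ i ∈ s, u i - ∏ i ∈ s, v i ∈ Φ.level (∑ i ∈ s, a i + δ) := by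
  classical
  induction s using Finset.induction_on with
  | empty => simp
  | insert i s hi ih =>
    rw [prod_insert hi, prod_insert hi, sum_insert hi]
    have h1 := Φ.mul_mem (huv i (mem_insert_self _ _))
      (Φ.prod_mem_level s u a fun j hj => hu j (mem_insert_of_mem hj))
    have h2 := Φ.mul_mem (hv i (mem_insert_self _ _))
      (ih (fun j hj => hu j (mem_insert_of_mem hj)) (fun j hj => hv j (mem_insert_of_mem hj))
        (fun j hj => huv j (mem_insert_of_mem hj)))
    have h1' := Φ.mem_level_of_le (b := a i + ∑ i ∈ s, a i + δ) (by linarith) h1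
    have h2' := Φ.mem_level_of_le (b := a i + ∑ i ∈ s, a i + δ) (by linarith) h2
    convert Ideal.add_mem _ h1' h2' using 1
    ring

lemma pow_sub_pow_mem_level (u v : A) (a δ : ℝ) (hu : u ∈ Φ.level a) (hv : v ∈ Φ.level a)
    (huv : u - v ∈ Φ.level (a + δ)) (n : ℕ) : u ^ n - v ^ n ∈ Φ.level (n * a + δ) := by
  simpa using Φ.prod_sub_prod_mem_level (range n) (fun _ => u) (fun _ => v) (fun _ => a) δ
    (fun _ _ => hu) (fun _ _ => hv) (fun _ _ => huv)

lemma prod_pow_sub_prod_pow_mem_level {ι : Type*} [Fintype ι] (u v : ι → A) (a : ι → ℝ) (δ : ℝ)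
    (C : ι →₀ ℕ)
    (hu : ∀ i, u i ∈ Φ.level (a i)) (hv : ∀ i, v i ∈ Φ.level (a i))
    (huv : ∀ i, u i - v i ∈ Φ.level (a i + δ)) :
    ∏ i, u i ^ C i - ∏ i, v i ^ C i ∈ Φ.level (∑ i, C i * a i + δ) :=
  Φ.prod_sub_prod_mem_level univ _ _ _ δ (fun i _ => Φ.pow_mem_level (hu i) _)
    (fun i _ => Φ.pow_mem_level (hv i) _)
    (fun i _ => Φ.pow_sub_pow_mem_level _ _ _ _ (hu i) (hv i) (huv i) _)

/-- The filtration of the power series ring in which a power series has level `a` when its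
coefficient of `T ^ J` has level `a - |J|`; thus the variables have level one. -/
def powerSeries (ι : Type*) : IdealisticFiltration (MvPowerSeries ι A) where
  level a :=
    { carrier := {F | ∀ J, MvPowerSeries.coeff J F ∈ Φ.level (a - J.degree)}
      zero_mem' := fun J => by simp
      add_mem' := fun {F G} hF hG J => by
        rw [map_add]; exact Ideal.add_mem _ (hF J) (hG J)
      smul_mem' := fun G F hF J => by
        classical
        rw [smul_eq_mul, MvPowerSeries.coeff_mul]
        refine Ideal.sum_mem _ fun y hy => Ideal.mul_mem_left _ _ ?_
        refine Φ.mem_level_of_le ?_ (hF y.2)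
        rw [← mem_antidiagonal.1 hy, map_add]
        push_cast
        linarith [(Nat.cast_nonneg y.1.degree : (0 : ℝ) ≤ _)] }
  level_zero := by
    rw [Ideal.eq_top_iff_one]
    intro J
    rw [Φ.level_of_nonpos (by simp)]
    trivial
  mul_mem := fun {a b F G} hF hG J => by
    classical
    rw [MvPowerSeries.coeff_mul]
    refine Ideal.sum_mem _ fun y hy => ?_
    refine Φ.mem_level_of_le (le_of_eq ?_) (Φ.mul_mem (hF y.1) (hG y.2))
    rw [← mem_antidiagonal.1 hy, map_add]
    push_cast
    ring
  antitone := fun a b hab F hF J => Φ.antitone (by linarith) (hF J)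

/-- The filtration by powers of an ideal, rescaled so that `𝔞` has level `1 / ν`. -/
noncomputable def adic (𝔞 : Ideal A) (ν : ℝ) (hν : 0 ≤ ν) : IdealisticFiltration A where
  level a := 𝔞 ^ ⌈ν * a⌉₊
  level_zero := by simp
  mul_mem := fun {a b f g} hf hg => by
    refine Ideal.pow_le_pow_right ?_ (pow_add 𝔞 _ _ ▸ Ideal.mul_mem_mul hf hg)
    rw [mul_add]
    exact Nat.ceil_add_le _ _
  antitone := fun a b hab => Ideal.pow_le_pow_right (Nat.ceil_mono (by gcongr))

lemma adic_level (𝔞 : Ideal A) (ν : ℝ) (hν : 0 ≤ ν) (a : ℝ) :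
    (adic 𝔞 ν hν).level a = 𝔞 ^ ⌈ν * a⌉₊ := rfl

lemma adic_one_level_natCast (𝔞 : Ideal A) (n : ℕ) :
    (adic 𝔞 1 zero_le_one).level n = 𝔞 ^ n := by
  simp [adic_level]

/-- The filtration obtained by adding a fixed ideal to every level. -/
def supConst (𝔟 : Ideal A) : IdealisticFiltration A where
  level a := Φ.level a ⊔ 𝔟
  level_zero := by simp [Φ.level_zero]
  mul_mem := fun {a b f g} hf hg => by
    obtain ⟨f₁, hf₁, f₂, hf₂, rfl⟩ := Submodule.mem_sup.1 hf
    obtain ⟨g₁, hg₁, g₂, hg₂, rfl⟩ := Submodule.mem_sup.1 hg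
    refine Submodule.mem_sup.2 ⟨f₁ * g₁, Φ.mul_mem hf₁ hg₁, f₁ * g₂ + f₂ * (g₁ + g₂),
      Ideal.add_mem _ (Ideal.mul_mem_left _ _ hg₂) (Ideal.mul_mem_right _ _ hf₂), by ring⟩
  antitone := fun a b hab => sup_le_sup_right (Φ.antitone hab) _

end Basic

/-! ### Taylor maps and frames of a local ring -/

section Frame

lemma exists_eq_single_of_degree_eq_one {ι : Type*} {J : ι →₀ ℕ} (h : J.degree = 1) :
    ∃ j, J = Finsupp.single j 1 := (Finsupp.sum_eq_one_iff _).1 h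

variable {k A ι : Type*} [Field k] [CommRing A] [Algebra k A]

/-- `Φ` is stable under the coefficients of `τ`: the coefficient of `T ^ J` in `τ f` loses at
most `|J|` in level. -/
def IsStable (Φ : IdealisticFiltration A) (τ : A →ₐ[k] MvPowerSeries ι A) : Prop :=
  ∀ a f, f ∈ Φ.level a → τ f ∈ (Φ.powerSeries ι).level a

/-- A frame of a local `k`-algebra with residue field `k`: generators `x` of the maximal ideal
together with a Taylor homomorphism `τ : A → A⟦T⟧`, `τ f = f + ⋯`, such that
`τ x_i ≡ x_i + T_i` up to terms which do not matter for leading forms. -/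
structure IsFrame [IsLocalRing A] [DecidableEq ι] (x : ι → A)
    (τ : A →ₐ[k] MvPowerSeries ι A) : Prop where
  residue : ∀ f : A, ∃ c : k, f - algebraMap k A c ∈ maximalIdeal A
  span_eq : Ideal.span (Set.range x) = maximalIdeal A
  coeff_zero : ∀ f, MvPowerSeries.coeff 0 (τ f) = f
  coeff_single : ∀ i j, MvPowerSeries.coeff (Finsupp.single j 1) (τ (x i)) -
    (if i = j then 1 else 0) ∈ maximalIdeal A

variable (x : ι → A) (τ : A →ₐ[k] MvPowerSeries ι A)

/-- Coefficient extraction for a product of binomials `(x_i + T_i) ^ (C_i)`. -/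
lemma coeff_prod_C_add_X_pow [Fintype ι] (C J : ι →₀ ℕ) :
    MvPowerSeries.coeff J (∏ i, (MvPowerSeries.C (x i) + MvPowerSeries.X i) ^ C i) =
      (∏ i, ((C i).choose (J i) : A)) * ∏ i, x i ^ (C i - J i) := by
  classical
  have h1 : ∀ i, (MvPowerSeries.C (x i) + MvPowerSeries.X i : MvPowerSeries ι A) ^ C i =
      ∑ m ∈ range (C i + 1), MvPowerSeries.monomial (Finsupp.single i m)
        (x i ^ (C i - m) * ((C i).choose m : A)) := by
    intro i
    rw [add_comm, add_pow]
    refine sum_congr rfl fun m _ => ?_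
    rw [MvPowerSeries.X_pow_eq, ← map_pow, ← MvPowerSeries.monomial_zero_eq_C_apply,
      ← map_natCast (MvPowerSeries.C (σ := ι) (R := A)),
      ← MvPowerSeries.monomial_zero_eq_C_apply, MvPowerSeries.monomial_mul_monomial,
      MvPowerSeries.monomial_mul_monomial]
    simp
  simp_rw [h1]
  rw [prod_univ_sum, map_sum]
  simp_rw [MvPowerSeries.prod_monomial, MvPowerSeries.coeff_monomial]
  have hsum : ∀ y : ι → ℕ, ∑ i, Finsupp.single i (y i) = Finsupp.equivFunOnFinite.symm y := by
    intro y
    ext j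
    simp [Finsupp.finsetSum_apply, Finsupp.single_apply]
  simp_rw [hsum]
  by_cases hJ : ∀ i, J i ≤ C i
  · rw [Finset.sum_eq_single (⇑J)]
    · rw [if_pos (by ext; simp), prod_mul_distrib, mul_comm]
    · intro y _ hy
      rw [if_neg]
      rintro rfl
      exact hy (by ext; simp)
    · intro h
      exact absurd (Fintype.mem_piFinset.2 fun i => by simpa using Nat.lt_succ_of_le (hJ i)) h
  · push Not at hJ
    obtain ⟨i, hi⟩ := hJ
    rw [Finset.sum_eq_zero]
    · rw [prod_eq_zero (mem_univ i) (by simp [Nat.choose_eq_zero_of_lt hi]), zero_mul]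
    · intro y hy
      rw [if_neg]
      rintro rfl
      have := Fintype.mem_piFinset.1 hy i
      simp at this hi
      omega

lemma algebraMap_mem_maximalIdeal_iff [IsLocalRing A] {c : k} :
    algebraMap k A c ∈ maximalIdeal A ↔ c = 0 := by
  refine ⟨fun h => ?_, fun h => by simp [h]⟩
  by_contra hc
  exact (maximalIdeal.isMaximal A).ne_top
    (Ideal.eq_top_of_isUnit_mem _ h ((IsUnit.mk0 c hc).map (algebraMap k A)))

namespace IsFrame

variable {x τ} [IsLocalRing A] [DecidableEq ι] (F : IsFrame x τ)
include F

lemma x_mem (i : ι) : x i ∈ maximalIdeal A := F.span_eq ▸ Ideal.subset_span ⟨i, rfl⟩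

/-- The `𝔪`-adic filtration is stable: `τ` sends `𝔪` into the elements of level one of `A⟦T⟧`. -/
lemma isStable_adic_one : (adic (maximalIdeal A) 1 zero_le_one).IsStable τ := by
  have h1 : ∀ f ∈ maximalIdeal A,
      τ f ∈ ((adic (maximalIdeal A) 1 zero_le_one).powerSeries ι).level 1 := by
    intro f hf J
    by_cases hJ : J = 0
    · subst hJ
      rw [F.coeff_zero]
      simpa [adic_level] using hf
    · rw [level_of_nonpos]
      · trivial
      · have : 1 ≤ J.degree := Nat.one_le_iff_ne_zero.2 (mt (Finsupp.degree_eq_zero_iff J).1 hJ)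
        have : (1 : ℝ) ≤ J.degree := by exact_mod_cast this
        linarith
  intro a f hf
  have h2 : Ideal.map τ.toRingHom (maximalIdeal A) ≤
      ((adic (maximalIdeal A) 1 zero_le_one).powerSeries ι).level 1 :=
    Ideal.map_le_iff_le_comap.2 h1
  have h3 := Ideal.mem_map_of_mem τ.toRingHom hf
  rw [adic_level, one_mul, Ideal.map_pow] at h3
  have h4 := level_pow_le _ _ _ (Ideal.pow_right_mono h2 _ h3)
  exact mem_level_of_le _ (by simpa using Nat.le_ceil a) h4

/-- Operators of order `|J|` lower the order of vanishing by at most `|J|`. -/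
lemma coeff_mem_pow {r : ℕ} {f : A} (hf : f ∈ maximalIdeal A ^ r) (J : ι →₀ ℕ) :
    MvPowerSeries.coeff J (τ f) ∈ maximalIdeal A ^ (r - J.degree) := by
  have := F.isStable_adic_one r f (by rwa [adic_one_level_natCast]) J
  rw [adic_level, one_mul] at this
  refine Ideal.pow_le_pow_right ?_ this
  by_cases h : J.degree ≤ r
  · rw [← Nat.cast_sub h, Nat.ceil_natCast]
  · rw [Nat.sub_eq_zero_of_le (not_le.1 h).le]; exact Nat.zero_le _

variable [Fintype ι]

/-- The leading behaviour of the operators on monomials is that of divided derivatives. -/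
lemma coeff_monomial_sub_mem (C J : ι →₀ ℕ) :
    MvPowerSeries.coeff J (τ (∏ i, x i ^ C i)) -
      (∏ i, ((C i).choose (J i) : A)) * ∏ i, x i ^ (C i - J i) ∈
        maximalIdeal A ^ (C.degree + 1 - J.degree) := by
  set Φ := adic (maximalIdeal A) 1 zero_le_one with hΦ
  have hone : ∀ i, τ (x i) ∈ (Φ.powerSeries ι).level 1 := fun i =>
    F.isStable_adic_one 1 _ (by simpa [adic_level] using F.x_mem i)
  have htwo : ∀ i, τ (x i) - (MvPowerSeries.C (x i) + MvPowerSeries.X i) ∈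
      (Φ.powerSeries ι).level (1 + 1) := by
    intro i J
    rcases Nat.lt_or_ge J.degree 2 with h | h
    · have : J.degree = 0 ∨ J.degree = 1 := by omega
      rcases this with h | h
      · obtain rfl : J = 0 := (Finsupp.degree_eq_zero_iff J).1 h
        simp only [map_sub, map_add, F.coeff_zero, MvPowerSeries.coeff_zero_C,
          MvPowerSeries.coeff_zero_X, add_zero, sub_self]
        exact Ideal.zero_mem _
      · obtain ⟨j, rfl⟩ := exists_eq_single_of_degree_eq_one h
        have := F.coeff_single i j
        rw [map_sub, map_add, MvPowerSeries.coeff_index_single_X,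
          MvPowerSeries.coeff_C_of_ne_zero (by simp), zero_add]
        simp only [hΦ, adic_level, one_mul, Finsupp.degree_single, Nat.cast_one]
        norm_num
        convert this using 2
        simp [eq_comm]
    · rw [level_of_nonpos]
      · trivial
      · have : (2 : ℝ) ≤ J.degree := by exact_mod_cast h
        linarith
  have hone' : ∀ i, (MvPowerSeries.C (x i) + MvPowerSeries.X i : MvPowerSeries ι A) ∈
      (Φ.powerSeries ι).level 1 := by
    intro i
    have := Ideal.sub_mem _ (hone i) (mem_level_of_le _ (b := 1) (by norm_num) (htwo i))
    simpa using this
  have key := (Φ.powerSeries ι).prod_pow_sub_prod_pow_mem_level (fun i => τ (x i)) _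
    (fun _ => 1) 1 C hone hone' htwo J
  rw [map_sub, coeff_prod_C_add_X_pow, hΦ, adic_level, one_mul] at key
  simp only [map_prod, map_pow]
  by_cases h : J.degree ≤ C.degree + 1
  · refine Ideal.pow_le_pow_right ?_ key
    rw [← Nat.cast_le (α := ℝ)]
    refine le_trans ?_ (Nat.le_ceil _)
    rw [Nat.cast_sub h, Finsupp.degree_eq_sum C]
    push_cast
    simp
  · rw [Nat.sub_eq_zero_of_le (by omega)]
    simp

end IsFrame

end Frame


/-! ### Families with monomial leading forms and colengths -/

section Triangular

variable {k A ι : Type*} [Field k] [CommRing A] [Algebra k A] [Fintype ι]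

/-- The monomial `x ^ C`. -/
def mon (x : ι → A) (C : ι →₀ ℕ) : A := ∏ i, x i ^ C i

lemma mon_add (x : ι → A) (C D : ι →₀ ℕ) : mon x (C + D) = mon x C * mon x D := by
  simp [mon, pow_add, prod_mul_distrib]

@[simp]
lemma mon_zero (x : ι → A) : mon x 0 = 1 := by simp [mon]

@[simp]
lemma mon_single [DecidableEq ι] (x : ι → A) (i : ι) (n : ℕ) :
    mon x (Finsupp.single i n) = x i ^ n := by
  rw [mon, prod_eq_single i] <;> simp +contextual [eq_comm]

lemma mon_mem_pow {x : ι → A} {𝔞 : Ideal A} (hx : ∀ i, x i ∈ 𝔞) (C : ι →₀ ℕ) :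
    mon x C ∈ 𝔞 ^ C.degree := by
  rw [mon, Finsupp.degree_eq_sum, ← prod_pow_eq_pow_sum]
  exact Ideal.prod_mem_prod fun i _ => Ideal.pow_mem_pow (hx i) _

variable [IsLocalRing A]

/-- A family `b` indexed by exponents is triangular if `b D` has leading form `x ^ D`. -/
def IsTriangular (x : ι → A) (b : (ι →₀ ℕ) → A) : Prop :=
  ∀ D, b D - mon x D ∈ maximalIdeal A ^ (D.degree + 1)

/-- The elements which are `k`-linear combinations of the `b D`, `D ∈ S`, modulo `𝔪 ^ M`. -/
def spanMod (k : Type*) [Field k] [Algebra k A] (b : (ι →₀ ℕ) → A) (S : Set (ι →₀ ℕ)) (M : ℕ) :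
    Submodule k A :=
  Submodule.span k (b '' S) ⊔ (maximalIdeal A ^ M).restrictScalars k

omit [Fintype ι] in
lemma mem_spanMod {b : (ι →₀ ℕ) → A} {S : Set (ι →₀ ℕ)} {M : ℕ} {f : A} :
    f ∈ spanMod k b S M ↔ ∃ c : (ι →₀ ℕ) →₀ k, (∀ D, c D ≠ 0 → D ∈ S) ∧
      f - Finsupp.linearCombination k b c ∈ maximalIdeal A ^ M := by
  rw [spanMod, Submodule.mem_sup]
  constructor
  · rintro ⟨y, hy, z, hz, rfl⟩
    obtain ⟨c, hc, rfl⟩ := (Finsupp.mem_span_image_iff_linearCombination k).1 hy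
    exact ⟨c, fun D hD => hc (Finsupp.mem_support_iff.2 hD), by simpa using hz⟩
  · rintro ⟨c, hc, h⟩
    exact ⟨_, (Finsupp.mem_span_image_iff_linearCombination k).2
      ⟨c, fun D hD => hc D (Finsupp.mem_support_iff.1 hD), rfl⟩, _, h, by simp⟩

omit [Fintype ι] in
lemma spanMod_mono {b : (ι →₀ ℕ) → A} {S T : Set (ι →₀ ℕ)} (h : S ⊆ T) (M : ℕ) :
    spanMod k b S M ≤ spanMod k b T M :=
  sup_le_sup_right (Submodule.span_mono (Set.image_mono h)) _

variable {x : ι → A} {b : (ι →₀ ℕ) → A}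

namespace IsTriangular

variable (hb : IsTriangular x b)
include hb

lemma mem_pow (hx : ∀ i, x i ∈ maximalIdeal A) (D : ι →₀ ℕ) :
    b D ∈ maximalIdeal A ^ D.degree := by
  have := Ideal.add_mem _ (Ideal.pow_le_pow_right (Nat.le_succ _) (hb D)) (mon_mem_pow hx D)
  simpa using this

variable [DecidableEq ι] {τ : A →ₐ[k] MvPowerSeries ι A} (F : IsFrame x τ)
include F

/-- For `|J| ≤ |D|` the operators of index `J` are dual to the elements `b D` modulo `𝔪`. -/
lemma coeff_sub_mem {D J : ι →₀ ℕ} (h : J.degree ≤ D.degree) :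
    MvPowerSeries.coeff J (τ (b D)) - (if D = J then 1 else 0) ∈ maximalIdeal A := by
  have h1 : MvPowerSeries.coeff J (τ (b D)) - MvPowerSeries.coeff J (τ (mon x D)) ∈
      maximalIdeal A := by
    rw [← map_sub, ← map_sub]
    have := F.coeff_mem_pow (hb D) J
    exact Ideal.pow_le_self (by omega) this
  have h2 := Ideal.pow_le_self (by omega) (F.coeff_monomial_sub_mem D J)
  have h3 : (∏ i, ((D i).choose (J i) : A)) * ∏ i, x i ^ (D i - J i) -
      (if D = J then 1 else 0) ∈ maximalIdeal A := by
    split_ifs with hDJ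
    · subst hDJ; simp
    · have : ∃ i, D i < J i ∨ J i < D i := by
        by_contra hc
        push Not at hc
        exact hDJ (Finsupp.ext fun i => le_antisymm (hc i).2 (hc i).1)
      by_cases hlt : ∃ i, D i < J i
      · obtain ⟨i, hi⟩ := hlt
        rw [prod_eq_zero (mem_univ i) (by simp [Nat.choose_eq_zero_of_lt hi])]
        simp
      · push Not at hlt
        obtain ⟨i, hi⟩ := this
        rw [sub_zero]
        refine Ideal.mul_mem_left _ _ (Ideal.mem_of_dvd _ (dvd_prod_of_mem _ (mem_univ i)) ?_)
        exact Ideal.pow_mem_of_mem _ (F.x_mem i) _ (by have := hlt i; omega)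
  convert Ideal.add_mem _ (Ideal.add_mem _ h1 h2) h3 using 1
  rw [mon]; ring

/-- Expansion of an element of `𝔪 ^ r` by one order. -/
lemma exists_expand_step {r : ℕ} {f : A} (hf : f ∈ maximalIdeal A ^ r) :
    ∃ c : (ι →₀ ℕ) →₀ k, (∀ D, c D ≠ 0 → D.degree = r) ∧
      f - Finsupp.linearCombination k b c ∈ maximalIdeal A ^ (r + 1) := by
  rw [← F.span_eq, Ideal.mem_span_pow_iff_exists_isHomogeneous] at hf
  obtain ⟨p, hp, rfl⟩ := hf
  choose c hc using F.residue
  refine ⟨Finsupp.onFinset p.support (fun D => if D ∈ p.support then c (p.coeff D) else 0)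
    (fun D hD => by by_contra h; simp [h] at hD), fun D hD => ?_, ?_⟩
  · have : D ∈ p.support := by by_contra h; simp [h] at hD
    simpa [Finsupp.weight_apply, Finsupp.degree_apply, Finsupp.sum] using
      hp (MvPolynomial.mem_support_iff.1 this)
  · rw [MvPolynomial.eval_eq', Finsupp.linearCombination_apply,
      Finsupp.onFinset_sum _ (fun _ => by simp), ← sum_sub_distrib]
    refine Ideal.sum_mem _ fun D hD => ?_
    have hdeg : D.degree = r := by
      simpa [Finsupp.weight_apply, Finsupp.degree_apply, Finsupp.sum] using
        hp (MvPolynomial.mem_support_iff.1 hD)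
    rw [if_pos hD, Algebra.smul_def]
    have h1 := hc (p.coeff D)
    have h2 := mon_mem_pow F.x_mem D
    have h3 := hb D
    rw [hdeg] at h2 h3
    have h4 : (p.coeff D - algebraMap k A (c (p.coeff D))) * mon x D ∈
        maximalIdeal A ^ (r + 1) := by
      rw [pow_succ']; exact Ideal.mul_mem_mul h1 h2
    have h5 := Ideal.mul_mem_left _ (algebraMap k A (c (p.coeff D))) h3
    convert Ideal.sub_mem _ h4 h5 using 1
    rw [mon]; ring

/-- Every element of `𝔪 ^ r` is, modulo `𝔪 ^ M`, a combination over `k` of the `b D` with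
`r ≤ |D| < M`. -/
lemma exists_expand (M : ℕ) {r : ℕ} {f : A} (hf : f ∈ maximalIdeal A ^ r) :
    f ∈ spanMod k b {D | r ≤ D.degree ∧ D.degree < M} M := by
  induction hn : M - r generalizing r f with
  | zero =>
    exact Submodule.mem_sup_right (Ideal.pow_le_pow_right (by omega) hf)
  | succ n ih =>
    obtain ⟨c, hc, h⟩ := hb.exists_expand_step F hf
    have h1 := spanMod_mono (k := k) (b := b) (S := {D | r + 1 ≤ D.degree ∧ D.degree < M})
      (T := {D | r ≤ D.degree ∧ D.degree < M}) (fun D hD => ⟨by have := hD.1; omega, hD.2⟩) M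
      (ih h (by omega))
    have h2 : Finsupp.linearCombination k b c ∈
        spanMod k b {D | r ≤ D.degree ∧ D.degree < M} M := by
      refine Submodule.mem_sup_left ((Finsupp.mem_span_image_iff_linearCombination k).2
        ⟨c, fun D hD => ?_, rfl⟩)
      have := hc D (Finsupp.mem_support_iff.1 hD)
      exact ⟨this.ge, by omega⟩
    simpa using Submodule.add_mem _ h1 h2

/-- The leading coefficients of a combination of the `b D` can be read off by the Taylor map. -/
lemma coeff_linearCombination_sub_mem (c : (ι →₀ ℕ) →₀ k) {J : ι →₀ ℕ}
    (hc : ∀ D, D.degree < J.degree → c D = 0) :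
    MvPowerSeries.coeff J (τ (Finsupp.linearCombination k b c)) - algebraMap k A (c J) ∈
      maximalIdeal A := by
  classical
  have hsum : algebraMap k A (c J) =
      c.sum fun D a => algebraMap k A a * (if D = J then 1 else 0) := by
    rw [Finsupp.sum, Finset.sum_eq_single J]
    · simp
    · intro D _ hD; simp [hD]
    · intro hJ; simp [Finsupp.notMem_support_iff.1 hJ]
  rw [hsum, Finsupp.linearCombination_apply, Finsupp.sum, map_sum, map_sum, Finsupp.sum,
    ← sum_sub_distrib]
  refine Ideal.sum_mem _ fun D hD => ?_
  have hDJ : J.degree ≤ D.degree := by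
    by_contra h
    exact Finsupp.mem_support_iff.1 hD (hc D (not_le.1 h))
  have : MvPowerSeries.coeff J (τ (c D • b D)) =
      algebraMap k A (c D) * MvPowerSeries.coeff J (τ (b D)) := by
    rw [map_smul, ← Algebra.smul_def]; rfl
  rw [this, ← mul_sub]
  exact Ideal.mul_mem_left _ _ (hb.coeff_sub_mem F hDJ)

/-- A combination of the `b D` of order at least `r` involves no `D` with `|D| < r`. -/
lemma eq_zero_of_linearCombination_mem {r : ℕ} {c : (ι →₀ ℕ) →₀ k}
    (h : Finsupp.linearCombination k b c ∈ maximalIdeal A ^ r) (D : ι →₀ ℕ)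
    (hD : D.degree < r) : c D = 0 := by
  induction hn : D.degree using Nat.strong_induction_on generalizing D with
  | _ n ih =>
    have h1 := hb.coeff_linearCombination_sub_mem F c (J := D)
      fun E hE => ih _ (hn ▸ hE) E (hE.trans hD) rfl
    have h2 := Ideal.pow_le_self (by omega) (F.coeff_mem_pow h D)
    have h3 := Ideal.sub_mem _ h2 h1
    rwa [sub_sub_cancel, algebraMap_mem_maximalIdeal_iff] at h3

/-- The order of vanishing is detected by the Taylor map. -/
lemma mem_pow_of_coeff_mem {r : ℕ} {f : A}
    (hf : ∀ J : ι →₀ ℕ, J.degree < r → MvPowerSeries.coeff J (τ f) ∈ maximalIdeal A) :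
    f ∈ maximalIdeal A ^ r := by
  induction r with
  | zero => simp
  | succ r ih =>
    have hfr := ih fun J hJ => hf J (by omega)
    obtain ⟨c, hc, h⟩ := hb.exists_expand_step F hfr
    suffices c = 0 by simpa [this] using h
    ext J
    by_contra hJ
    have hJr := hc J hJ
    have h1 := hb.coeff_linearCombination_sub_mem F c (J := J) fun E hE => by
      by_contra hE'
      have := hc E hE'
      omega
    have h2 := Ideal.pow_le_self (by omega) (F.coeff_mem_pow h J)
    rw [map_sub, map_sub] at h2
    have h3 := Ideal.sub_mem _ (hf J (by omega)) (Ideal.add_mem _ h2 h1)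
    rw [show ∀ u v w : A, u - (u - v + (v - w)) = w by intros; ring,
      algebraMap_mem_maximalIdeal_iff] at h3
    exact hJ h3

/-- An ideal which is spanned by the `b D`, `D ∉ S`, modulo a power of the maximal ideal has
colength `#S`. -/
theorem finrank_quotient {I : Ideal A} {M : ℕ} {S : Set (ι →₀ ℕ)} (hM : maximalIdeal A ^ M ≤ I)
    (hSM : ∀ D ∈ S, D.degree < M) (hSI : ∀ D, D ∉ S → b D ∈ I)
    (hI : ∀ f ∈ I, f ∈ spanMod k b Sᶜ M) :
    Module.Finite k (A ⧸ I) ∧ Module.finrank k (A ⧸ I) = S.ncard := by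
  have hfin : S.Finite := (Finsupp.finite_of_degree_le M).subset fun D hD => (hSM D hD).le
  set π := (Ideal.Quotient.mkₐ k I).toLinearMap with hπ
  have hπ0 : ∀ f, π f = 0 ↔ f ∈ I := fun f => Ideal.Quotient.eq_zero_iff_mem
  set v : S → A ⧸ I := fun D => π (b D) with hv
  have hli : LinearIndependent k v := by
    rw [linearIndependent_iff]
    intro c hc
    have h1 : Finsupp.linearCombination k v c =
        π (Finsupp.linearCombination k b (c.mapDomain Subtype.val)) := by
      rw [Finsupp.linearCombination_mapDomain, Finsupp.apply_linearCombination]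
      rfl
    rw [h1, hπ0] at hc
    obtain ⟨d, hd, hcd⟩ := mem_spanMod.1 (hI _ hc)
    rw [← map_sub] at hcd
    have hz := hb.eq_zero_of_linearCombination_mem F hcd
    ext D
    have h2 := hz D (hSM D D.2)
    rw [Finsupp.sub_apply, Finsupp.mapDomain_apply Subtype.val_injective] at h2
    have h3 : d D = 0 := by
      by_contra hne
      exact hd D hne D.2
    simpa [h3] using h2
  have hsp : ⊤ ≤ Submodule.span k (Set.range v) := by
    intro g _
    obtain ⟨f, rfl⟩ := Ideal.Quotient.mk_surjective g
    obtain ⟨c, hc, hfc⟩ := mem_spanMod.1 (hb.exists_expand F M (r := 0) (f := f) (by simp))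
    have h1 : π f = π (Finsupp.linearCombination k b c) := by
      rw [← sub_eq_zero, ← map_sub, hπ0]
      exact hM hfc
    change π f ∈ _
    rw [h1, Finsupp.linearCombination_apply, Finsupp.sum, map_sum]
    refine Submodule.sum_mem _ fun D hD => ?_
    rw [map_smul]
    refine Submodule.smul_mem _ _ ?_
    by_cases hDS : D ∈ S
    · exact Submodule.subset_span ⟨⟨D, hDS⟩, rfl⟩
    · rw [(hπ0 _).2 (hSI D hDS)]
      exact Submodule.zero_mem _
  have : Fintype S := hfin.fintype
  refine ⟨Module.Finite.of_basis (Module.Basis.mk hli hsp), ?_⟩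
  rw [Module.finrank_eq_card_basis (Module.Basis.mk hli hsp), Set.ncard_eq_toFinset_card',
    Set.toFinset_card]

end IsTriangular

lemma isTriangular_mon (x : ι → A) : IsTriangular x (mon x) := fun D => by simp

/-- The colength of a power of the maximal ideal is the number of monomials of lower degree. -/
lemma IsFrame.finrank_quotient_pow [DecidableEq ι] {τ : A →ₐ[k] MvPowerSeries ι A}
    (F : IsFrame x τ) (M : ℕ) :
    Module.Finite k (A ⧸ maximalIdeal A ^ M) ∧
      Module.finrank k (A ⧸ maximalIdeal A ^ M) = {D : ι →₀ ℕ | D.degree < M}.ncard :=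
  (isTriangular_mon x).finrank_quotient F le_rfl (fun _ hD => hD)
    (fun D hD => Ideal.pow_le_pow_right (not_lt.1 hD) (mon_mem_pow F.x_mem D))
    (fun _ hf => Submodule.mem_sup_right hf)

end Triangular


/-! ### Division of exponents and adapted systems -/

section Exponents

variable {ι : Type*} [Fintype ι] (q : ι → ℕ)

/-- The exponent `(q_i B_i)_i`. -/
noncomputable def scale (B : ι →₀ ℕ) : ι →₀ ℕ := Finsupp.equivFunOnFinite.symm fun i => q i * B i

/-- The remainders of the division of the exponents `D_i` by `q_i`; here `q_i = 0` stands for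
an infinite divisor, in accordance with `n % 0 = n`. -/
noncomputable def expRem (D : ι →₀ ℕ) : ι →₀ ℕ := Finsupp.equivFunOnFinite.symm fun i => D i % q i

/-- The quotients of the division of the exponents `D_i` by `q_i`, with `n / 0 = 0`. -/
noncomputable def expQuo (D : ι →₀ ℕ) : ι →₀ ℕ := Finsupp.equivFunOnFinite.symm fun i => D i / q i

/-- The weight of the exponent `D`, when `x_i` has weight `1 / ν` and `x_i ^ q_i` is traded for an
element of weight `q_i`. -/
noncomputable def weight (ν : ℝ) (D : ι →₀ ℕ) : ℝ :=
  (expRem q D).degree / ν + (scale q (expQuo q D)).degree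

@[simp] lemma scale_apply (B : ι →₀ ℕ) (i : ι) : scale q B i = q i * B i := rfl
@[simp] lemma expRem_apply (D : ι →₀ ℕ) (i : ι) : expRem q D i = D i % q i := rfl
@[simp] lemma expQuo_apply (D : ι →₀ ℕ) (i : ι) : expQuo q D i = D i / q i := rfl

@[simp] lemma scale_zero : scale q 0 = 0 := by ext; simp

lemma scale_add (B B' : ι →₀ ℕ) : scale q (B + B') = scale q B + scale q B' := by
  ext; simp [mul_add]

lemma scale_single [DecidableEq ι] (i : ι) (n : ℕ) :
    scale q (Finsupp.single i n) = Finsupp.single i (q i * n) := by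
  ext j
  by_cases h : i = j
  · subst h; simp
  · simp [h]

lemma expRem_add_scale_expQuo (D : ι →₀ ℕ) : expRem q D + scale q (expQuo q D) = D := by
  ext i; simp [Nat.mod_add_div]

lemma degree_eq_expRem_add (D : ι →₀ ℕ) :
    D.degree = (expRem q D).degree + (scale q (expQuo q D)).degree := by
  conv_lhs => rw [← expRem_add_scale_expQuo q D, map_add]

variable {q}

lemma expRem_add_scale {C B : ι →₀ ℕ} (hC : ∀ i, q i = 0 ∨ C i < q i) :
    expRem q (C + scale q B) = C := by
  ext i
  rcases hC i with h | h
  · simp [h]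
  · simp [Nat.mod_eq_of_lt h]

lemma expQuo_add_scale {C B : ι →₀ ℕ} (hC : ∀ i, q i = 0 ∨ C i < q i)
    (hB : ∀ i, q i = 0 → B i = 0) : expQuo q (C + scale q B) = B := by
  ext i
  rcases hC i with h | h
  · simp [h, hB i h]
  · have hq : 0 < q i := by omega
    simp [Nat.add_mul_div_left _ _ hq, Nat.div_eq_of_lt h]

lemma degree_le_weight {ν : ℝ} (hν : 1 ≤ ν) (D : ι →₀ ℕ) : D.degree / ν ≤ weight q ν D := by
  rw [weight, degree_eq_expRem_add q D]
  push_cast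
  rw [add_div]
  gcongr
  exact div_le_self (Nat.cast_nonneg _) hν

end Exponents

section Adapted

variable {k A ι : Type*} [Field k] [CommRing A] [Algebra k A] [Fintype ι] [IsLocalRing A]

/-- The elements `h_i` have leading forms `x_i ^ q_i`, for the indices `i` with `q_i ≠ 0`.
The other indices carry no condition on `x_i`, and there `h_i = 0`. -/
structure IsAdapted (x : ι → A) (q : ι → ℕ) (h : ι → A) : Prop where
  eq_zero : ∀ i, q i = 0 → h i = 0
  lead : ∀ i, q i ≠ 0 → h i - x i ^ q i ∈ maximalIdeal A ^ (q i + 1)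

/-- The element `x ^ C h ^ B`, where `D = C + q B` is the division of the exponents by `q`.
Its leading form is `x ^ D`. -/
noncomputable def adaptedElt (x : ι → A) (q : ι → ℕ) (h : ι → A) (D : ι →₀ ℕ) : A :=
  mon x (expRem q D) * mon h (expQuo q D)

namespace IsAdapted

variable {x : ι → A} {q : ι → ℕ} {h : ι → A} (H : IsAdapted x q h)
  (hx : ∀ i, x i ∈ maximalIdeal A)
include H hx

omit [Fintype ι] in
lemma h_mem (i : ι) : h i ∈ maximalIdeal A ^ q i := by
  by_cases hq : q i = 0
  · simp [hq]
  · have := Ideal.add_mem _ (Ideal.pow_le_pow_right (Nat.le_succ _) (H.lead i hq))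
      (Ideal.pow_mem_pow (hx i) (q i))
    simpa using this

lemma mon_h_mem (B : ι →₀ ℕ) : mon h B ∈ maximalIdeal A ^ (scale q B).degree := by
  have := prod_pow_mem_level (adic (maximalIdeal A) 1 zero_le_one) h (fun i => q i)
    (fun i => by rw [adic_one_level_natCast]; exact H.h_mem hx i) B
  rw [show ∑ i, (B i : ℝ) * q i = ((scale q B).degree : ℕ) by
    rw [Finsupp.degree_eq_sum]; push_cast; simp [mul_comm], adic_one_level_natCast] at this
  exact this

lemma mon_h_sub_mem {B : ι →₀ ℕ} (hB : ∀ i, q i = 0 → B i = 0) :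
    mon h B - mon x (scale q B) ∈ maximalIdeal A ^ ((scale q B).degree + 1) := by
  set Φ := adic (maximalIdeal A) 1 zero_le_one with hΦ
  have hl : ∀ n : ℕ, Φ.level n = maximalIdeal A ^ n := adic_one_level_natCast _
  have key := Φ.prod_sub_prod_mem_level univ (fun i => h i ^ B i)
    (fun i => x i ^ (q i * B i)) (fun i => ((q i * B i : ℕ) : ℝ)) (1 : ℕ)
    (fun i _ => by rw [hl, pow_mul]; exact Ideal.pow_mem_pow (H.h_mem hx i) _)
    (fun i _ => by rw [hl]; exact Ideal.pow_mem_pow (hx i) _)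
    (fun i _ => by
      by_cases hq : q i = 0
      · simp [hB i hq]
      · have hl' := Φ.pow_sub_pow_mem_level (h i) (x i ^ q i) (q i : ℕ) (1 : ℕ)
          (by rw [hl]; exact H.h_mem hx i) (by rw [hl]; exact Ideal.pow_mem_pow (hx i) _)
          (by rw [← Nat.cast_add, hl]; exact H.lead i hq) (B i)
        rw [pow_mul]
        convert hl' using 2
        push_cast; ring)
  rw [← Nat.cast_sum, ← Nat.cast_add, hl] at key
  rw [Finsupp.degree_eq_sum]
  exact key

lemma isTriangular : IsTriangular x (adaptedElt x q h) := by
  intro D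
  have h1 : mon x D = mon x (expRem q D) * mon x (scale q (expQuo q D)) := by
    rw [← mon_add, expRem_add_scale_expQuo]
  rw [adaptedElt, h1, ← mul_sub, degree_eq_expRem_add q D, add_assoc, pow_add]
  exact Ideal.mul_mem_mul (mon_mem_pow hx _)
    (H.mon_h_sub_mem hx fun i hi => by simp [hi])

omit hx in
lemma mon_h_eq_zero {B : ι →₀ ℕ} {i : ι} (hq : q i = 0) (hB : B i ≠ 0) : mon h B = 0 :=
  prod_eq_zero (mem_univ i) (by rw [H.eq_zero i hq, zero_pow hB])

omit hx in
variable [DecidableEq ι] {τ : A →ₐ[k] MvPowerSeries ι A} (F : IsFrame x τ) in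
include F in
/-- Rewriting by the relations `x_i ^ q_i = h_i + ⋯`: it decreases neither order nor weight. -/
lemma mul_mon_h_mem_spanMod {ν : ℝ} (hν : 1 ≤ ν) (w : ℝ) (β : Prop) (M : ℕ) {j : ℕ}
    {B : ι →₀ ℕ} {y : A} (hy : y ∈ maximalIdeal A ^ j)
    (hw : w ≤ j / ν + (scale q B).degree) (hβ : β → B ≠ 0) :
    y * mon h B ∈ spanMod k (adaptedElt x q h)
      {D | w ≤ weight q ν D ∧ (β → expQuo q D ≠ 0)} M := by
  have hx := F.x_mem
  have hν0 : 0 < ν := zero_lt_one.trans_le hν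
  -- Outer induction on the missing order, inner induction on `j`.
  induction hn : M - (j + (scale q B).degree) using Nat.strong_induction_on generalizing j B y with
  | _ n outer =>
  induction j using Nat.strong_induction_on generalizing B y with
  | _ j inner =>
  by_cases hB : ∀ i, q i = 0 → B i = 0
  swap
  · push Not at hB
    obtain ⟨i, hi, hBi⟩ := hB
    rw [H.mon_h_eq_zero hi hBi, mul_zero]
    exact Submodule.zero_mem _
  by_cases hM : M ≤ j + (scale q B).degree
  · refine Submodule.mem_sup_right (Ideal.pow_le_pow_right hM ?_)
    rw [pow_add]
    exact Ideal.mul_mem_mul hy (H.mon_h_mem hx B)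
  push Not at hM
  have step : ∀ z ∈ maximalIdeal A ^ (j + 1), z * mon h B ∈ spanMod k (adaptedElt x q h)
      {D | w ≤ weight q ν D ∧ (β → expQuo q D ≠ 0)} M := fun z hz =>
    outer (M - (j + 1 + (scale q B).degree)) (by omega) hz (hw.trans (by
      push_cast; gcongr; linarith)) hβ rfl
  obtain ⟨c, hc, hrest⟩ := (isTriangular_mon x).exists_expand_step F hy
  rw [← sub_add_cancel y (Finsupp.linearCombination k (mon x) c), add_mul]
  refine Submodule.add_mem _ (step _ hrest) ?_
  rw [Finsupp.linearCombination_apply, Finsupp.sum, sum_mul]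
  refine Submodule.sum_mem _ fun C hC => ?_
  rw [smul_mul_assoc]
  refine Submodule.smul_mem _ _ ?_
  have hCj := hc C (Finsupp.mem_support_iff.1 hC)
  by_cases hred : ∀ i, q i = 0 ∨ C i < q i
  · refine Submodule.mem_sup_left (Submodule.subset_span ⟨C + scale q B, ⟨?_, ?_⟩, ?_⟩)
    · rw [weight, expRem_add_scale hred, expQuo_add_scale hred hB, hCj]
      exact hw
    · rw [expQuo_add_scale hred hB]; exact hβ
    · rw [adaptedElt, expRem_add_scale hred, expQuo_add_scale hred hB]
  · push Not at hred
    obtain ⟨i, hq, hi⟩ := hred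
    obtain ⟨C', rfl⟩ : ∃ C', C = C' + Finsupp.single i (q i) :=
      ⟨C - Finsupp.single i (q i), (tsub_add_cancel_of_le (Finsupp.single_le_iff.2 hi)).symm⟩
    rw [map_add, Finsupp.degree_single] at hCj
    have hC' := mon_mem_pow hx C'
    have hsplit : mon x (C' + Finsupp.single i (q i)) * mon h B =
        mon x C' * mon h (B + Finsupp.single i 1) -
          (mon x C' * (h i - x i ^ q i)) * mon h B := by
      rw [mon_add, mon_add, mon_single, mon_single, pow_one]; ring
    have hscale : (scale q (B + Finsupp.single i 1)).degree = (scale q B).degree + q i := by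
      rw [scale_add, scale_single, map_add, Finsupp.degree_single, mul_one]
    rw [hsplit]
    refine Submodule.sub_mem _ ?_ (step _ ?_)
    · refine inner C'.degree (by omega) hC' ?_ ?_ (by rw [hscale]; omega)
      · refine hw.trans ?_
        rw [hscale, ← hCj]
        push_cast
        rw [add_div]
        have : (q i : ℝ) / ν ≤ q i := div_le_self (Nat.cast_nonneg _) hν
        linarith
      · intro _ h0
        have := DFunLike.congr_fun h0 i
        simp at this
    · rw [← hCj, add_assoc, pow_add]
      exact Ideal.mul_mem_mul hC' (H.lead i hq)

end IsAdapted

end Adapted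


/-! ### The weighted filtration of an adapted system and the coefficient theorem -/

section Weighted

variable {k A ι : Type*} [Field k] [CommRing A] [Algebra k A] [Fintype ι]

/-- The filtration whose levels are generated by a multiplicative system of generators. -/
def ofGenerators (S : ℝ → Set A) (one_mem : 1 ∈ S 0)
    (mul_mem : ∀ {a b f g}, f ∈ S a → g ∈ S b → f * g ∈ S (a + b)) (anti : Antitone S) :
    IdealisticFiltration A where
  level a := Ideal.span (S a)
  level_zero := (Ideal.eq_top_iff_one _).2 (Ideal.subset_span one_mem)
  mul_mem := fun {a b f g} hf hg => by
    have h := Ideal.mul_mem_mul hf hg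
    rw [Ideal.span_mul_span'] at h
    refine Ideal.span_mono ?_ h
    rintro _ ⟨u, hu, v, hv, rfl⟩
    exact mul_mem hu hv
  antitone := fun a b hab => Ideal.span_mono (anti hab)

variable [IsLocalRing A]

/-- The filtration generated by the maximal ideal in level `1 / ν` and by the `h_i` in
level `q_i`. -/
noncomputable def weighted (q : ι → ℕ) (h : ι → A) (ν : ℝ) : IdealisticFiltration A :=
  ofGenerators (fun a => {g | ∃ (j : ℕ) (B : ι →₀ ℕ), ∃ y ∈ maximalIdeal A ^ j,
      a ≤ j / ν + (scale q B).degree ∧ y * mon h B = g})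
    ⟨0, 0, 1, by simp, by simp, by simp⟩
    (by
      rintro a b _ _ ⟨j, B, y, hy, hle, rfl⟩ ⟨j', B', y', hy', hle', rfl⟩
      refine ⟨j + j', B + B', y * y', pow_add (maximalIdeal A) j j' ▸ Ideal.mul_mem_mul hy hy',
        ?_, by rw [mon_add]; ring⟩
      rw [scale_add, map_add]
      push_cast
      rw [add_div]
      linarith)
    (fun a b hab _ ⟨j, B, y, hy, hle, hg⟩ => ⟨j, B, y, hy, hab.trans hle, hg⟩)

/-- The filtration generated by `J` and by the maximal ideal in level `1 / ν`. -/
noncomputable def enlarge (J : IdealisticFiltration A) (ν : ℝ) : IdealisticFiltration A :=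
  ofGenerators (fun a => {g | ∃ (b : ℝ) (j : ℕ), ∃ f ∈ J.level b, ∃ y ∈ maximalIdeal A ^ j,
      a ≤ b + j / ν ∧ f * y = g})
    ⟨0, 0, 1, by simp [J.level_zero], 1, by simp, by simp, by simp⟩
    (by
      rintro a b _ _ ⟨c, j, f, hf, y, hy, hle, rfl⟩ ⟨c', j', f', hf', y', hy', hle', rfl⟩
      refine ⟨c + c', j + j', f * f', J.mul_mem hf hf', y * y',
        pow_add (maximalIdeal A) j j' ▸ Ideal.mul_mem_mul hy hy', ?_, by ring⟩
      push_cast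
      rw [add_div]
      linarith)
    (fun a b hab _ ⟨c, j, f, hf, y, hy, hle, hg⟩ => ⟨c, j, f, hf, y, hy, hab.trans hle, hg⟩)

lemma mul_mon_mem_weighted {q : ι → ℕ} {h : ι → A} {ν a : ℝ} {j : ℕ} {B : ι →₀ ℕ} {y : A}
    (hy : y ∈ maximalIdeal A ^ j) (hle : a ≤ j / ν + (scale q B).degree) :
    y * mon h B ∈ (weighted q h ν).level a :=
  Ideal.subset_span ⟨j, B, y, hy, hle, rfl⟩

lemma mul_mem_enlarge {J : IdealisticFiltration A} {ν a b : ℝ} {j : ℕ} {f y : A}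
    (hf : f ∈ J.level b) (hy : y ∈ maximalIdeal A ^ j) (hle : a ≤ b + j / ν) :
    f * y ∈ (J.enlarge ν).level a :=
  Ideal.subset_span ⟨b, j, f, hf, y, hy, hle, rfl⟩

lemma pow_le_weighted {q : ι → ℕ} {h : ι → A} {ν a : ℝ} {j : ℕ} (hle : a ≤ j / ν) :
    maximalIdeal A ^ j ≤ (weighted q h ν).level a := fun y hy => by
  simpa using mul_mon_mem_weighted (q := q) (h := h) (B := 0) hy (by simpa using hle)

lemma pow_le_enlarge {J : IdealisticFiltration A} {ν a : ℝ} {j : ℕ} (hle : a ≤ j / ν) :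
    maximalIdeal A ^ j ≤ (J.enlarge ν).level a := fun y hy => by
  simpa using mul_mem_enlarge (J := J) (f := 1) (b := 0) (by simp [J.level_zero]) hy
    (by simpa using hle)

lemma level_le_enlarge (J : IdealisticFiltration A) (ν a : ℝ) :
    J.level a ≤ (J.enlarge ν).level a := fun f hf => by
  simpa using mul_mem_enlarge (y := 1) (j := 0) hf (by simp) (by simp)

lemma adaptedElt_mem_weighted {x : ι → A} (hx : ∀ i, x i ∈ maximalIdeal A) {q : ι → ℕ}
    {h : ι → A} {ν : ℝ} (D : ι →₀ ℕ) :
    adaptedElt x q h D ∈ (weighted q h ν).level (weight q ν D) :=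
  mul_mon_mem_weighted (mon_mem_pow hx _) le_rfl

lemma weighted_le_enlarge {J : IdealisticFiltration A} {q : ι → ℕ} {h : ι → A}
    (hJ : ∀ i, h i ∈ J.level (q i)) (ν a : ℝ) :
    (weighted q h ν).level a ≤ (J.enlarge ν).level a := by
  refine Ideal.span_le.2 ?_
  rintro _ ⟨j, B, y, hy, hle, rfl⟩
  rw [mul_comm]
  refine mul_mem_enlarge (J.prod_pow_mem_level h _ hJ B) hy (hle.trans (le_of_eq ?_))
  rw [Finsupp.degree_eq_sum]
  push_cast
  rw [add_comm]
  simp [mul_comm]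

lemma enlarge_le_weighted {J : IdealisticFiltration A} {q : ι → ℕ} {h : ι → A} {ν : ℝ}
    (hJ : ∀ a, J.level a ≤ (weighted q h ν).level a) (a : ℝ) :
    (J.enlarge ν).level a ≤ (weighted q h ν).level a := by
  refine Ideal.span_le.2 ?_
  rintro _ ⟨b, j, f, hf, y, hy, hle, rfl⟩
  exact mem_level_of_le _ hle (mul_mem _ (hJ b hf) (pow_le_weighted le_rfl hy))

lemma weighted_level_le {q : ι → ℕ} {h : ι → A} {ν : ℝ} (hν : 1 ≤ ν) (a : ℝ) :
    (weighted q h ν).level a ≤ maximalIdeal A ^ ⌈ν * a⌉₊ ⊔ Ideal.span (Set.range h) := by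
  have hν0 : 0 < ν := zero_lt_one.trans_le hν
  refine Ideal.span_le.2 ?_
  rintro _ ⟨j, B, y, hy, hle, rfl⟩
  by_cases hB : B = 0
  · subst hB
    refine Ideal.mem_sup_left ?_
    rw [mon_zero, mul_one]
    refine Ideal.pow_le_pow_right (Nat.ceil_le.2 ?_) hy
    simp only [scale_zero, map_zero, Nat.cast_zero, add_zero] at hle
    rwa [le_div_iff₀ hν0, mul_comm] at hle
  · obtain ⟨i, hi⟩ := Finsupp.support_nonempty_iff.2 hB
    refine Ideal.mem_sup_right (Ideal.mul_mem_left _ _ (Ideal.mem_of_dvd _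
      (dvd_prod_of_mem _ (mem_univ i)) ?_))
    exact Ideal.pow_mem_of_mem _ (Ideal.subset_span (Set.mem_range_self i)) _
      (Nat.pos_of_ne_zero (Finsupp.mem_support_iff.1 hi))

end Weighted

section Coefficient

variable {k A ι : Type*} [Field k] [CommRing A] [Algebra k A] [Fintype ι] [IsLocalRing A]
  [DecidableEq ι] {x : ι → A} {τ : A →ₐ[k] MvPowerSeries ι A} (F : IsFrame x τ)
  {q : ι → ℕ} {h : ι → A} (H : IsAdapted x q h)
include F H

/-- Reduced monomials `x ^ C`, `C_i < q_i`, of degree `n` are linearly independent modulo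
`𝔪 ^ (n + 1)` and the ideal generated by the `h_i`. -/
lemma eq_zero_of_reduced_mem {n : ℕ} {c : (ι →₀ ℕ) →₀ k}
    (hc : Finsupp.linearCombination k (adaptedElt x q h) c ∈
      maximalIdeal A ^ (n + 1) ⊔ Ideal.span (Set.range h)) {C : ι →₀ ℕ}
    (hC : expQuo q C = 0) (hn : C.degree = n) : c C = 0 := by
  obtain ⟨z, hz, u, hu, hzu⟩ := Submodule.mem_sup.1 hc
  have hspan : u ∈ spanMod k (adaptedElt x q h) {D | (0 : ℝ) ≤ weight q 1 D ∧
      (True → expQuo q D ≠ 0)} (n + 1) := by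
    obtain ⟨g, rfl⟩ := Ideal.mem_span_range_iff_exists_fun.1 hu
    refine Submodule.sum_mem _ fun i _ => ?_
    have := H.mul_mon_h_mem_spanMod F le_rfl 0 True (n + 1) (j := 0)
      (B := Finsupp.single i 1) (y := g i) (by simp) (by positivity) (fun _ => by simp)
    simpa using this
  obtain ⟨d, hd, hud⟩ := mem_spanMod.1 hspan
  have hmem : Finsupp.linearCombination k (adaptedElt x q h) (c - d) ∈
      maximalIdeal A ^ (n + 1) := by
    rw [map_sub, ← hzu]
    convert Ideal.add_mem _ hz hud using 1
    ring
  have h0 := (H.isTriangular F.x_mem).eq_zero_of_linearCombination_mem F hmem C (by omega)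
  have hd0 : d C = 0 := by
    by_contra hne
    exact (hd C hne).2 trivial hC
  simpa [hd0] using h0

/-- The coefficient theorem in terms of expansions: if all elements of level `a` have order at
least `ν a` modulo the `h_i`, with `ν > 1`, then the expansion of an element of level `a` involves
only terms of weight at least `a`. -/
lemma le_weight_of_expansion {J : IdealisticFiltration A} (hst : J.IsStable τ)
    (hJ : ∀ i, h i ∈ J.level (q i)) {ν : ℝ} (hν : 1 < ν)
    (hM : ∀ a, J.level a ≤ maximalIdeal A ^ ⌈ν * a⌉₊ ⊔ Ideal.span (Set.range h))
    {a : ℝ} {f : A} (hf : f ∈ J.level a) {M : ℕ} {c : (ι →₀ ℕ) →₀ k}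
    (hcM : ∀ D, c D ≠ 0 → D.degree < M)
    (hfc : f - Finsupp.linearCombination k (adaptedElt x q h) c ∈ maximalIdeal A ^ M)
    (D : ι →₀ ℕ) (hD : c D ≠ 0) : a ≤ weight q ν D := by
  have hν0 : 0 < ν := zero_lt_one.trans hν
  have hx := F.x_mem
  by_contra! hlt
  -- A term of minimal weight `w < a`, and with maximal `h`-degree `t` among those.
  have hS : (c.support.filter fun D => weight q ν D < a).Nonempty :=
    ⟨D, by simp [hD, hlt]⟩
  obtain ⟨D₁, hD₁, hmin⟩ := exists_min_image _ (weight q ν) hS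
  have hS' : (c.support.filter fun D => weight q ν D = weight q ν D₁).Nonempty :=
    ⟨D₁, by simpa using (mem_filter.1 hD₁).1⟩
  obtain ⟨D₀, hD₀, hmax⟩ := exists_max_image _ (fun D => (scale q (expQuo q D)).degree) hS'
  obtain ⟨hD₀s, hD₀w⟩ := mem_filter.1 hD₀
  have hwa : weight q ν D₀ < a := hD₀w ▸ (mem_filter.1 hD₁).2
  have hwmin : ∀ D ∈ c.support, weight q ν D₀ ≤ weight q ν D := fun D hD => by
    rcases lt_or_ge (weight q ν D) a with h | h
    · rw [hD₀w]; exact hmin D (mem_filter.2 ⟨hD, h⟩)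
    · exact hwa.le.trans h
  replace hmax : ∀ D ∈ c.support, weight q ν D = weight q ν D₀ →
      (scale q (expQuo q D)).degree ≤ (scale q (expQuo q D₀)).degree := fun D hD h =>
    hmax D (mem_filter.2 ⟨hD, h.trans hD₀w⟩)
  clear hmin hS hS' hD₁ hD₀w hD₀ hD hlt
  set w := weight q ν D₀ with hw
  set B₀ := expQuo q D₀ with hB₀
  set t := (scale q B₀).degree with ht
  set n := (expRem q D₀).degree with hn
  have hwn : ν * (w - t) = n := by
    rw [hw, weight, ← ht]; field_simp; ring
  have hdeg : n + t = D₀.degree := by rw [degree_eq_expRem_add q D₀]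
  have hDM := hcM D₀ (Finsupp.mem_support_iff.1 hD₀s)
  set 𝔟 := maximalIdeal A ^ (n + 1) ⊔ Ideal.span (Set.range h) with h𝔟
  -- The filtration by order modulo the `h_i`.
  set Ψ := (adic (maximalIdeal A) ν hν0.le).supConst (Ideal.span (Set.range h)) with hΨ
  have hΨ𝔟 : ∀ s : ℝ, w - t < s → Ψ.level s ≤ 𝔟 := fun s hs => by
    refine sup_le_sup_right (Ideal.pow_le_pow_right ?_) _
    rw [Nat.succ_le_iff, Nat.lt_ceil, ← hwn]
    gcongr
  have hJΨ : ∀ s, J.level s ≤ Ψ.level s := hM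
  have hmΨ : ∀ j : ℕ, maximalIdeal A ^ j ≤ Ψ.level (j / ν) := fun j => by
    refine le_trans (le_of_eq ?_) le_sup_left
    rw [adic_level, mul_div_cancel₀ _ hν0.ne', Nat.ceil_natCast]
  have hτh : ∀ (B J' : ι →₀ ℕ), MvPowerSeries.coeff J' (τ (mon h B)) ∈
      Ψ.level ((scale q B).degree - J'.degree) := fun B J' => by
    have h1 := J.prod_pow_mem_level h _ hJ B
    have h2 := hst _ _ h1 J'
    refine hJΨ _ (J.mem_level_of_le (le_of_eq ?_) h2)
    rw [Finsupp.degree_eq_sum (scale q B)]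
    push_cast
    simp [mul_comm]
  have hτx : ∀ (C J' : ι →₀ ℕ), MvPowerSeries.coeff J' (τ (mon x C)) ∈
      Ψ.level ((C.degree - J'.degree) / ν) := fun C J' => by
    refine Ψ.mem_level_of_le ?_ (hmΨ _ (F.coeff_mem_pow (mon_mem_pow hx C) J'))
    gcongr
    rw [sub_le_iff_le_add]; exact_mod_cast le_tsub_add
  -- Modulo `𝔟` the operator of index `q B₀` only keeps the terms of minimal weight `w` with
  -- `h`-part `B₀`: by the Leibniz rule it may also act on the `x`-part, but there an operator of
  -- order `r` costs only `r / ν < r` in level, which is a strict gain because `ν > 1`.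
  have key : ∀ D ∈ c.support, MvPowerSeries.coeff (scale q B₀) (τ (adaptedElt x q h D)) -
      (if expQuo q D = B₀ ∧ weight q ν D = w then mon x (expRem q D) else 0) ∈ 𝔟 := by
    intro D hD
    set C := expRem q D with hC
    set B := expQuo q D with hB
    have hwD : weight q ν D = C.degree / ν + (scale q B).degree := rfl
    have hexp : MvPowerSeries.coeff (scale q B₀) (τ (adaptedElt x q h D)) =
        ∑ y ∈ antidiagonal (scale q B₀), MvPowerSeries.coeff y.1 (τ (mon x C)) *
          MvPowerSeries.coeff y.2 (τ (mon h B)) := by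
      rw [adaptedElt, map_mul, MvPowerSeries.coeff_mul]
    have hsplit : ∀ y ∈ antidiagonal (scale q B₀), (y.1.degree : ℝ) + y.2.degree = t := by
      intro y hy
      rw [ht, ← mem_antidiagonal.1 hy, map_add]; push_cast; rfl
    rcases (hwmin D hD).lt_or_eq with hlt | heq
    · rw [if_neg fun hh => hlt.ne' hh.2, sub_zero, hexp]
      refine Ideal.sum_mem _ fun y hy => hΨ𝔟 _ ?_ (Ψ.mul_mem (hτx C y.1) (hτh B y.2))
      have h1 := hsplit y hy
      have h2 : (y.1.degree : ℝ) / ν ≤ y.1.degree := div_le_self (Nat.cast_nonneg _) hν.le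
      rw [sub_div]
      rw [hwD] at hlt
      linarith
    · have hrest : ∀ y ∈ antidiagonal (scale q B₀), y ≠ (0, scale q B₀) →
          MvPowerSeries.coeff y.1 (τ (mon x C)) * MvPowerSeries.coeff y.2 (τ (mon h B)) ∈ 𝔟 := by
        intro y hy hne
        refine hΨ𝔟 _ ?_ (Ψ.mul_mem (hτx C y.1) (hτh B y.2))
        have h1 := hsplit y hy
        have hy1 : 0 < y.1.degree := by
          refine Nat.pos_of_ne_zero fun h0 => hne ?_
          have h0' := (Finsupp.degree_eq_zero_iff _).1 h0
          have := mem_antidiagonal.1 hy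
          rw [h0', zero_add] at this
          exact Prod.ext h0' this
        have hy1' : (0 : ℝ) < y.1.degree := by exact_mod_cast hy1
        have h2 : (y.1.degree : ℝ) / ν < y.1.degree := div_lt_self hy1' hν
        rw [sub_div]
        rw [hwD] at heq
        linarith
      have hmem0 : ((0, scale q B₀) : (ι →₀ ℕ) × (ι →₀ ℕ)) ∈ antidiagonal (scale q B₀) := by
        simp
      rw [hexp, ← add_sum_erase _ _ hmem0, F.coeff_zero, add_sub_right_comm]
      refine Ideal.add_mem _ ?_ (Ideal.sum_mem _ fun y hy =>
        hrest y (mem_of_mem_erase hy) (ne_of_mem_erase hy))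
      refine Ideal.mem_sup_left ?_
      rcases (hmax D hD heq.symm).lt_or_eq with htlt | hteq
      · rw [if_neg (by rintro ⟨hBB, -⟩; exact htlt.ne (by rw [ht, ← hBB])), sub_zero]
        refine Ideal.mul_mem_right _ _ (Ideal.pow_le_pow_right ?_ (mon_mem_pow hx C))
        have h1 : ((scale q B).degree : ℝ) < t := by exact_mod_cast htlt
        have h2 : (n : ℝ) < C.degree := by
          rw [← hwn, heq, hwD]
          have : ν * (C.degree / ν + (scale q B).degree - t) =
            C.degree - ν * (t - (scale q B).degree) := by field_simp; ring
          rw [this]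
          nlinarith
        exact_mod_cast h2
      · have hCn : C.degree = n := by
          have : (C.degree : ℝ) = n := by
            rw [← hwn, heq, hwD, hteq]; field_simp; ring
          exact_mod_cast this
        have hB0 : ∀ i, q i = 0 → B i = 0 := fun i hi => by simp [hB, hi]
        have hiff : B = B₀ ∧ weight q ν D = w ↔ scale q B = scale q B₀ := by
          constructor
          · rintro ⟨hh, -⟩; rw [hh]
          · intro hh
            refine ⟨Finsupp.ext fun i => ?_, heq.symm⟩
            by_cases hi : q i = 0
            · rw [hB0 i hi]; simp [hB₀, hi]
            · have := DFunLike.congr_fun hh i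
              simpa [hi] using this
        simp only [hiff]
        have h1 := F.coeff_mem_pow (H.mon_h_sub_mem hx hB0) (scale q B₀)
        rw [hteq, show t + 1 - (scale q B₀).degree = 1 by omega, pow_one, map_sub, map_sub] at h1
        have h2 := (isTriangular_mon x).coeff_sub_mem F (D := scale q B) (J := scale q B₀)
          hteq.ge
        have h3 := Ideal.add_mem _ h1 h2
        rw [sub_add_sub_cancel] at h3
        have h4 := Ideal.mul_mem_mul (mon_mem_pow hx C) h3
        rw [← pow_succ, hCn] at h4
        convert h4 using 1
        split_ifs <;> ring
  -- Apply the operator of index `q B₀` to the expansion.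
  have h1 : MvPowerSeries.coeff (scale q B₀) (τ f) ∈ 𝔟 := by
    refine hΨ𝔟 _ ?_ (hJΨ _ (hst a f hf (scale q B₀)))
    rw [← ht]
    linarith
  have h2 : MvPowerSeries.coeff (scale q B₀)
      (τ (Finsupp.linearCombination k (adaptedElt x q h) c)) ∈ 𝔟 := by
    have h3 := F.coeff_mem_pow hfc (scale q B₀)
    rw [map_sub, map_sub] at h3
    have h4 : maximalIdeal A ^ (M - (scale q B₀).degree) ≤ 𝔟 :=
      le_trans (Ideal.pow_le_pow_right (by omega)) le_sup_left
    have := Ideal.sub_mem _ h1 (h4 h3)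
    rwa [sub_sub_cancel] at this
  -- What remains is a combination of reduced monomials of degree `n`.
  set T := c.support.filter fun D => expQuo q D = B₀ ∧ weight q ν D = w with hT
  set c' : (ι →₀ ℕ) →₀ k := ∑ D ∈ T, Finsupp.single (expRem q D) (c D) with hc'
  have hbrem : ∀ D, adaptedElt x q h (expRem q D) = mon x (expRem q D) := fun D => by
    have h1 : expRem q (expRem q D) = expRem q D := by ext; simp
    have h2 : expQuo q (expRem q D) = 0 := by
      ext i
      rcases Nat.eq_zero_or_pos (q i) with hq | hq
      · simp [hq]
      · simp [Nat.div_eq_of_lt (Nat.mod_lt _ hq)]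
    rw [adaptedElt, h1, h2, mon_zero, mul_one]
  have h5 : Finsupp.linearCombination k (adaptedElt x q h) c' ∈ 𝔟 := by
    have h6 : Finsupp.linearCombination k (adaptedElt x q h) c' =
        ∑ D ∈ c.support, algebraMap k A (c D) *
          (if expQuo q D = B₀ ∧ weight q ν D = w then mon x (expRem q D) else 0) := by
      rw [hc', map_sum, hT, sum_filter]
      refine sum_congr rfl fun D _ => ?_
      split_ifs
      · rw [Finsupp.linearCombination_single, hbrem, Algebra.smul_def]
      · rw [mul_zero]
    have h7 : MvPowerSeries.coeff (scale q B₀)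
        (τ (Finsupp.linearCombination k (adaptedElt x q h) c)) =
        ∑ D ∈ c.support, algebraMap k A (c D) *
          MvPowerSeries.coeff (scale q B₀) (τ (adaptedElt x q h D)) := by
      rw [Finsupp.linearCombination_apply, Finsupp.sum, map_sum, map_sum]
      refine sum_congr rfl fun D _ => ?_
      rw [map_smul, ← Algebra.smul_def]; rfl
    have h8 : ∑ D ∈ c.support, algebraMap k A (c D) *
        (MvPowerSeries.coeff (scale q B₀) (τ (adaptedElt x q h D)) -
          (if expQuo q D = B₀ ∧ weight q ν D = w then mon x (expRem q D) else 0)) ∈ 𝔟 :=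
      Ideal.sum_mem _ fun D hD => Ideal.mul_mem_left _ _ (key D hD)
    simp only [mul_sub, sum_sub_distrib] at h8
    rw [← h6, ← h7] at h8
    have := Ideal.sub_mem _ h2 h8
    rwa [sub_sub_cancel] at this
  have hq0 : expQuo q (expRem q D₀) = 0 := by
    ext i
    rcases Nat.eq_zero_or_pos (q i) with hq | hq
    · simp [hq]
    · simp [Nat.div_eq_of_lt (Nat.mod_lt _ hq)]
  have h9 := eq_zero_of_reduced_mem F H h5 hq0 rfl
  have h10 : c' (expRem q D₀) = c D₀ := by
    rw [hc', Finsupp.finsetSum_apply, Finset.sum_eq_single D₀]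
    · simp
    · intro D hD hne
      refine Finsupp.single_eq_of_ne fun heq => hne ?_
      rw [← expRem_add_scale_expQuo q D, ← expRem_add_scale_expQuo q D₀, ← heq,
        (mem_filter.1 hD).2.1]
    · intro hh
      exact absurd (mem_filter.2 ⟨hD₀s, rfl, rfl⟩) hh
  exact Finsupp.mem_support_iff.1 hD₀s (h10 ▸ h9)

/-- The coefficient theorem: if all elements of level `a` have order at least `ν a` modulo
the `h_i`, with `ν > 1`, then the filtration is contained in the weighted one. -/
theorem level_le_weighted {J : IdealisticFiltration A} (hst : J.IsStable τ)
    (hJ : ∀ i, h i ∈ J.level (q i)) {ν : ℝ} (hν : 1 < ν)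
    (hM : ∀ a, J.level a ≤ maximalIdeal A ^ ⌈ν * a⌉₊ ⊔ Ideal.span (Set.range h)) (a : ℝ) :
    J.level a ≤ (weighted q h ν).level a := by
  intro f hf
  have hν0 : 0 < ν := zero_lt_one.trans hν
  set M := ⌈ν * a⌉₊ with hMdef
  have hMa : maximalIdeal A ^ M ≤ (weighted q h ν).level a := pow_le_weighted <| by
    rw [le_div_iff₀ hν0, mul_comm]; exact Nat.le_ceil _
  obtain ⟨c, hc, hfc⟩ := mem_spanMod.1 ((H.isTriangular F.x_mem).exists_expand F M
    (r := 0) (f := f) (by simp))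
  have hw := le_weight_of_expansion F H hst hJ hν hM hf (fun D hD => (hc D hD).2) hfc
  rw [← sub_add_cancel f (Finsupp.linearCombination k (adaptedElt x q h) c)]
  refine Ideal.add_mem _ (hMa hfc) ?_
  rw [Finsupp.linearCombination_apply, Finsupp.sum]
  refine Ideal.sum_mem _ fun D hD => ?_
  rw [Algebra.smul_def]
  exact Ideal.mul_mem_left _ _ (mem_level_of_le _ (hw D (Finsupp.mem_support_iff.1 hD))
    (adaptedElt_mem_weighted F.x_mem D))

/-- The colength of the weighted filtration only depends on the exponents `q_i`. -/
theorem finrank_quotient_weighted {ν : ℝ} (hν : 1 ≤ ν) (a : ℝ) :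
    Module.Finite k (A ⧸ (weighted q h ν).level a) ∧
    Module.finrank k (A ⧸ (weighted q h ν).level a) = {D : ι →₀ ℕ | weight q ν D < a}.ncard := by
  have hν0 : 0 < ν := zero_lt_one.trans_le hν
  refine (H.isTriangular F.x_mem).finrank_quotient F (M := ⌈ν * a⌉₊) (pow_le_weighted <| by
    rw [le_div_iff₀ hν0, mul_comm]; exact Nat.le_ceil _) (fun D hD => ?_) (fun D hD => ?_)
    (fun f hf => ?_)
  · have h1 := (degree_le_weight hν D).trans_lt hD
    rw [div_lt_iff₀ hν0, mul_comm] at h1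
    exact_mod_cast h1.trans_le (Nat.le_ceil _)
  · exact mem_level_of_le _ (not_lt.1 hD) (adaptedElt_mem_weighted F.x_mem D)
  · -- Elements of level `a` expand into terms of weight at least `a`.
    have hsub : ({D | a ≤ weight q ν D ∧ (False → expQuo q D ≠ 0)} : Set (ι →₀ ℕ)) ⊆
        {D | weight q ν D < a}ᶜ := fun D hD => not_lt.2 hD.1
    refine spanMod_mono hsub _ ?_
    suffices ∀ r : A, r * f ∈ spanMod k (adaptedElt x q h)
        {D | a ≤ weight q ν D ∧ (False → expQuo q D ≠ 0)} ⌈ν * a⌉₊ by simpa using this 1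
    refine Submodule.span_induction (p := fun f _ => ∀ r : A, r * f ∈
      spanMod k (adaptedElt x q h) {D | a ≤ weight q ν D ∧ (False → expQuo q D ≠ 0)} ⌈ν * a⌉₊)
      ?_ (fun r => by simp) (fun f g _ _ hf hg r => ?_) (fun s f _ hf r => ?_) hf
    · rintro _ ⟨j, B, y, hy, hle, rfl⟩ r
      rw [← mul_assoc]
      exact H.mul_mon_h_mem_spanMod F hν a False _ (Ideal.mul_mem_left _ r hy) hle False.elim
    · rw [mul_add]; exact Submodule.add_mem _ (hf r) (hg r)
    · rw [smul_eq_mul, ← mul_assoc]; exact hf _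

end Coefficient


/-! ### The invariant `μ` through colengths -/

section Mu

variable {A : Type*} [CommRing A] [IsLocalRing A]

/-- The supremum in the definition of the order is attained, since `𝔪 ^ n + (h)` decreases with
`n`. -/
lemma le_ordMod_iff {N : ℕ} (h : Fin N → A) (f : A) (n : ℕ) :
    (n : ℕ∞) ≤ ordMod h f ↔ f ∈ maximalIdeal A ^ n ⊔ Ideal.span (Set.range h) := by
  constructor
  · intro hle
    by_contra hf
    have h0 : n ≠ 0 := by rintro rfl; simp at hf
    have : ordMod h f ≤ (n - 1 : ℕ) := by
      refine iSup₂_le fun m hm => Nat.cast_le.2 ?_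
      by_contra! hlt
      have hle : maximalIdeal A ^ m ≤ maximalIdeal A ^ n := Ideal.pow_le_pow_right (by omega)
      exact hf ((sup_le_sup_right hle _ : _ ≤ _) hm)
    have := Nat.cast_le.1 (hle.trans this)
    omega
  · intro hf
    exact le_iSup₂_of_le n hf le_rfl

lemma ofReal_le_ordMod_div_iff {N : ℕ} (h : Fin N → A) {ν a : ℝ} (hν : 0 ≤ ν) (ha : 0 < a)
    (f : A) : ENNReal.ofReal ν ≤ (ordMod h f : ENNReal) / ENNReal.ofReal a ↔
      f ∈ maximalIdeal A ^ ⌈ν * a⌉₊ ⊔ Ideal.span (Set.range h) := by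
  rw [ENNReal.le_div_iff_mul_le (by simp [ha]) (by simp), ← ENNReal.ofReal_mul hν, ← le_ordMod_iff]
  induction hord : ordMod h f using ENat.recTopCoe with
  | top => simp
  | coe m => rw [ENat.toENNReal_coe, Nat.cast_le, Nat.ceil_le, ENNReal.ofReal_le_natCast]

/-- `μ ≥ ν` means that the elements of level `a` have order at least `ν a` modulo the `h_l`. -/
lemma ofReal_le_muMod_iff (J : IdealisticFiltration A) {N : ℕ} (h : Fin N → A) {ν : ℝ}
    (hν : 0 ≤ ν) :
    ENNReal.ofReal ν ≤ muMod J h ↔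
      ∀ a, J.level a ≤ maximalIdeal A ^ ⌈ν * a⌉₊ ⊔ Ideal.span (Set.range h) := by
  simp only [muMod, le_iInf_iff]
  constructor
  · intro H a f hf
    rcases le_or_gt a 0 with ha | ha
    · rw [Nat.ceil_eq_zero.2 (mul_nonpos_of_nonneg_of_nonpos hν ha)]
      simp
    · exact (ofReal_le_ordMod_div_iff h hν ha f).1 (H a ha f hf)
  · intro H a ha f hf
    exact (ofReal_le_ordMod_div_iff h hν ha f).2 (H a hf)

/-- A filtration is proper if its positive levels consist of non-units. -/
def IsProper (J : IdealisticFiltration A) : Prop := ∀ a, 0 < a → J.level a ≤ maximalIdeal A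

/-- The powers of a unit of positive level reach every level. -/
lemma level_eq_top_of_not_isProper {J : IdealisticFiltration A} (hJ : ¬ J.IsProper) (a : ℝ) :
    J.level a = ⊤ := by
  simp only [IsProper, not_forall] at hJ
  obtain ⟨b, hb, h⟩ := hJ
  obtain ⟨f, hf, hfm⟩ := SetLike.not_le_iff_exists.1 h
  have hu : IsUnit f := by
    by_contra hu; exact hfm ((mem_maximalIdeal _).2 hu)
  obtain ⟨n, hn⟩ := exists_nat_ge (a / b)
  refine Ideal.eq_top_of_isUnit_mem _ (J.mem_level_of_le ?_ (J.pow_mem_level hf n)) (hu.pow n)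
  rwa [div_le_iff₀ hb] at hn

lemma muMod_eq_zero_of_not_isProper {J : IdealisticFiltration A} (hJ : ¬ J.IsProper) {N : ℕ}
    {h : Fin N → A} (hh : ∀ l, h l ∈ maximalIdeal A) : muMod J h = 0 := by
  have h1 : ordMod h 1 = 0 := by
    by_contra hne
    have := (le_ordMod_iff h 1 1).1 (by simpa using Order.one_le_iff_ne_zero.2 hne)
    rw [pow_one] at this
    have hle : maximalIdeal A ⊔ Ideal.span (Set.range h) ≤ maximalIdeal A :=
      sup_le le_rfl (Ideal.span_le.2 (by rintro _ ⟨l, rfl⟩; exact hh l))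
    exact (Ideal.ne_top_iff_one _).1 (maximalIdeal.isMaximal A).ne_top (hle this)
  refine le_antisymm (iInf₂_le_of_le 1 one_pos (iInf₂_le_of_le 1 ?_ ?_)) zero_le
  · rw [level_eq_top_of_not_isProper hJ]; trivial
  · simp [h1]

end Mu

section Colength

variable {k A ι : Type*} [Field k] [CommRing A] [Algebra k A] [Fintype ι] [IsLocalRing A]
  [DecidableEq ι] {x : ι → A} {τ : A →ₐ[k] MvPowerSeries ι A} (F : IsFrame x τ)
include F

/-- In a proper stable filtration the elements of level `a` have order at least `a`. -/
lemma IsProper.level_le_pow {J : IdealisticFiltration A} (hJ : J.IsProper) (hst : J.IsStable τ)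
    (a : ℝ) : J.level a ≤ maximalIdeal A ^ ⌈a⌉₊ := fun f hf =>
  (isTriangular_mon x).mem_pow_of_coeff_mem F fun K hK =>
    hJ _ (by rw [Nat.lt_ceil] at hK; linarith) (hst a f hf K)

omit [Fintype ι] F [DecidableEq ι] [IsLocalRing A] in
lemma finrank_quotient_lt {I I' : Ideal A} (h : I < I') [Module.Finite k (A ⧸ I)] :
    Module.finrank k (A ⧸ I') < Module.finrank k (A ⧸ I) := by
  set φ := (Ideal.Quotient.factorₐ k h.le).toLinearMap with hφ
  have hsurj : Function.Surjective φ := Ideal.Quotient.factor_surjective h.le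
  have h1 := φ.finrank_range_add_finrank_ker
  rw [LinearMap.range_eq_top.2 hsurj, finrank_top] at h1
  suffices 0 < Module.finrank k (LinearMap.ker φ) by omega
  obtain ⟨f, hf', hf⟩ := SetLike.exists_of_lt h
  refine Module.finrank_pos_iff_exists_ne_zero.2
    ⟨⟨Ideal.Quotient.mk I f, ?_⟩, fun h0 => hf ?_⟩
  · exact Ideal.Quotient.eq_zero_iff_mem.2 hf'
  · exact Ideal.Quotient.eq_zero_iff_mem.1 (congrArg Subtype.val h0)

/-- For `ν > 1` the inequality `μ ≥ ν` is an intrinsic condition on colengths of the enlarged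
filtration, compared to numbers which only depend on the exponents. -/
theorem level_le_iff_ncard_le {q : ι → ℕ} {h : ι → A} (H : IsAdapted x q h)
    {J : IdealisticFiltration A} (hst : J.IsStable τ) (hJ : ∀ i, h i ∈ J.level (q i))
    {ν : ℝ} (hν : 1 < ν) :
    (∀ a, J.level a ≤ maximalIdeal A ^ ⌈ν * a⌉₊ ⊔ Ideal.span (Set.range h)) ↔
      ∀ a, {D : ι →₀ ℕ | weight q ν D < a}.ncard ≤
        Module.finrank k (A ⧸ (J.enlarge ν).level a) := by
  constructor
  · intro hM a
    have h1 := level_le_weighted F H hst hJ hν hM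
    rw [le_antisymm (enlarge_le_weighted h1 a) (weighted_le_enlarge hJ ν a)]
    exact (finrank_quotient_weighted F H hν.le a).2.ge
  · intro hc a
    have h1 := finrank_quotient_weighted F H hν.le a
    have := h1.1
    have h2 : (weighted q h ν).level a = (J.enlarge ν).level a := by
      by_contra hne
      have := finrank_quotient_lt (k := k) (lt_of_le_of_ne (weighted_le_enlarge hJ ν a) hne)
      have := hc a
      omega
    exact (level_le_enlarge J ν a).trans (h2 ▸ weighted_level_le hν.le a)

end Colength


/-! ### The structure of the leading algebra -/

section Binomial

/-- A case of Lucas' theorem. -/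
lemma choose_prime_pow_mul_modEq (p : ℕ) [Fact p.Prime] (i m : ℕ) :
    (p ^ i * m).choose (p ^ i) ≡ m [MOD p] := by
  induction i with
  | zero => simp [Nat.ModEq.refl]
  | succ i ih =>
    have hp : 0 < p := (Fact.out : p.Prime).pos
    have h := Choose.choose_modEq_choose_mod_mul_choose_div_nat (n := p ^ (i + 1) * m)
      (k := p ^ (i + 1)) (p := p)
    have h1 : p ^ (i + 1) * m = p * (p ^ i * m) := by ring
    have h2 : p ^ (i + 1) = p * p ^ i := by ring
    rw [h1, h2, Nat.mul_mod_right, Nat.mul_mod_right, Nat.mul_div_cancel_left _ hp,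
      Nat.mul_div_cancel_left _ hp, Nat.choose_self, one_mul] at h
    rw [h1, h2]
    exact h.trans ih

/-- An exponent which is not divisible by `q`, a power of `p` or zero, can be lowered to a power
of `p` with the same property by a divided derivative which is nonzero in `k`. -/
lemma exists_choose_pow_ne_zero (k : Type*) [Field k] (p : ℕ) [ExpChar k p] {c q : ℕ}
    (hq : q = 0 ∨ ∃ e, q = p ^ e) (hc : ¬ q ∣ c) :
    ∃ i, ¬ q ∣ p ^ i ∧ p ^ i ≤ c ∧ ((c.choose (p ^ i) : ℕ) : k) ≠ 0 := by
  have hc0 : c ≠ 0 := by rintro rfl; exact hc (dvd_zero _)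
  rcases ‹ExpChar k p› with _ | hp
  · refine ⟨0, ?_, ?_, ?_⟩
    · rcases hq with rfl | ⟨e, rfl⟩
      · simp
      · simp at hc
    · simpa using Nat.one_le_iff_ne_zero.2 hc0
    · simpa using hc0
  · have : Fact p.Prime := ⟨hp⟩
    obtain ⟨i, m, hm, rfl⟩ := Nat.exists_eq_pow_mul_and_not_dvd hc0 p hp.ne_one
    refine ⟨i, fun h => hc (h.mul_right m), Nat.le_mul_of_pos_right _ (Nat.pos_of_ne_zero ?_), ?_⟩
    · rintro rfl; simp at hm
    · rw [Ne, CharP.cast_eq_zero_iff k p, ← Nat.modEq_zero_iff_dvd]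
      intro h
      exact hm (Nat.modEq_zero_iff_dvd.1 ((choose_prime_pow_mul_modEq p i m).symm.trans h))

end Binomial

section Structure

variable {k A ι : Type*} [Field k] [CommRing A] [Algebra k A] [Fintype ι] [IsLocalRing A]
  [DecidableEq ι] {x : ι → A} {τ : A →ₐ[k] MvPowerSeries ι A} (F : IsFrame x τ)
include F

namespace IsFrame

/-- On leading forms the operators compose like divided derivatives. -/
lemma coeff_coeff_sub_mem {n : ℕ} {f : A} (hf : f ∈ maximalIdeal A ^ n) {E K : ι →₀ ℕ}
    (hEK : E.degree + K.degree = n) :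
    MvPowerSeries.coeff E (τ (MvPowerSeries.coeff K (τ f))) -
      (∏ i, ((E i + K i).choose (K i) : A)) * MvPowerSeries.coeff (E + K) (τ f) ∈
        maximalIdeal A := by
  have hb := isTriangular_mon x
  obtain ⟨c, hc, hr⟩ := hb.exists_expand_step F hf
  -- The statement is additive in `f`, and trivial for `f ∈ 𝔪 ^ (n + 1)`.
  set φ : A → A := fun f => MvPowerSeries.coeff E (τ (MvPowerSeries.coeff K (τ f))) -
      (∏ i, ((E i + K i).choose (K i) : A)) * MvPowerSeries.coeff (E + K) (τ f) with hφ
  have hadd : ∀ f g, φ (f + g) = φ f + φ g := fun f g => by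
    simp only [hφ, map_add]; ring
  have hsm : ∀ (a : k) f, φ (a • f) = a • φ f := fun a f => by
    have h1 : ∀ (J : ι →₀ ℕ) (g : MvPowerSeries ι A),
        MvPowerSeries.coeff J (a • g) = a • MvPowerSeries.coeff J g := fun J g => rfl
    simp only [hφ, map_smul, h1, smul_sub, mul_smul_comm]
  have hhigh : ∀ g ∈ maximalIdeal A ^ (n + 1), φ g ∈ maximalIdeal A := fun g hg => by
    refine Ideal.sub_mem _ ?_ (Ideal.mul_mem_left _ _ ?_)
    · exact Ideal.pow_le_self (by omega) (F.coeff_mem_pow (F.coeff_mem_pow hg K) E)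
    · exact Ideal.pow_le_self (by rw [map_add]; omega) (F.coeff_mem_pow hg (E + K))
  have hmon : ∀ C : ι →₀ ℕ, C.degree = n → φ (mon x C) ∈ maximalIdeal A := fun C hC => by
    have h1 := F.coeff_mem_pow (F.coeff_monomial_sub_mem C K) E
    have h1' := Ideal.pow_le_self (by omega) h1
    rw [map_sub, map_sub] at h1'
    have h2 := hb.coeff_sub_mem F (D := C) (J := E + K) (by rw [map_add]; omega)
    -- It remains to treat the exact divided derivative of the monomial.
    have h3 : MvPowerSeries.coeff E (τ ((∏ i, ((C i).choose (K i) : A)) *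
        ∏ i, x i ^ (C i - K i))) -
        (∏ i, ((E i + K i).choose (K i) : A)) * (if C = E + K then 1 else 0) ∈
          maximalIdeal A := by
      have hcast : (∏ i, ((C i).choose (K i) : A)) =
          ((∏ i, (C i).choose (K i) : ℕ) : A) := by push_cast; rfl
      rw [hcast, map_mul, map_natCast, ← map_natCast (MvPowerSeries.C (σ := ι) (R := A)),
        MvPowerSeries.coeff_C_mul]
      by_cases hKC : K ≤ C
      · have h4 := hb.coeff_sub_mem F (D := C - K) (J := E) (by
          have := congrArg Finsupp.degree (tsub_add_cancel_of_le hKC)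
          rw [map_add] at this
          omega)
        have hiff : C - K = E ↔ C = E + K := by
          constructor
          · rintro rfl; exact (tsub_add_cancel_of_le hKC).symm
          · rintro rfl; simp
        rw [show mon x (C - K) = ∏ i, x i ^ (C i - K i) from rfl] at h4
        simp only [hiff] at h4
        split_ifs at h4 ⊢ with hh
        · have := Ideal.mul_mem_left _ ((∏ i, (C i).choose (K i) : ℕ) : A) h4
          subst hh
          rw [mul_sub] at this
          convert this using 2
          push_cast
          simp
        · simpa using Ideal.mul_mem_left _ ((∏ i, (C i).choose (K i) : ℕ) : A) h4
      · obtain ⟨i, hi⟩ : ∃ i, C i < K i := by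
          by_contra! hh; exact hKC hh
        rw [prod_eq_zero (mem_univ i) (Nat.choose_eq_zero_of_lt hi), if_neg]
        · simp
        · rintro rfl
          simp at hi
    have h5 := Ideal.mul_mem_left _ (∏ i, ((E i + K i).choose (K i) : A)) h2
    convert Ideal.sub_mem _ (Ideal.add_mem _ h1' h3) h5 using 1
    simp only [hφ, mon]
    ring
  have hlin : φ (Finsupp.linearCombination k (mon x) c) ∈ maximalIdeal A := by
    rw [Finsupp.linearCombination_apply, Finsupp.sum]
    refine Finset.sum_induction _ (fun g => φ g ∈ maximalIdeal A)
      (fun f g hf hg => by rw [hadd]; exact Ideal.add_mem _ hf hg)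
      (by simp [hφ]) fun D hD => ?_
    rw [hsm, Algebra.smul_def]
    exact Ideal.mul_mem_left _ _ (hmon D (hc D (Finsupp.mem_support_iff.1 hD)))
  have := Ideal.add_mem _ (hhigh _ hr) hlin
  rwa [← hadd, sub_add_cancel] at this

end IsFrame

/-- The first order operators compute the coefficients of a linear form modulo `𝔪`. -/
lemma coeff_sum_smul_sub_mem (a : ι → k) (i : ι) :
    MvPowerSeries.coeff (Finsupp.single i 1) (τ (∑ j, a j • x j)) - algebraMap k A (a i) ∈
      maximalIdeal A := by
  have h1 : ∑ j, a j • x j = Finsupp.linearCombination k (mon x)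
      (∑ j, Finsupp.single (Finsupp.single j 1) (a j)) := by
    simp [map_sum]
  rw [h1]
  convert (isTriangular_mon x).coeff_linearCombination_sub_mem F
    (∑ j, Finsupp.single (Finsupp.single j 1) (a j)) (J := Finsupp.single i 1) ?_ using 3
  · rw [Finsupp.finsetSum_apply, Finset.sum_eq_single i]
    · simp
    · intro j _ hj
      refine Finsupp.single_eq_of_ne fun h => hj ?_
      exact (Finsupp.single_left_injective one_ne_zero h).symm
    · simp
  · intro D hD
    rw [Finsupp.degree_single] at hD
    rw [Finsupp.finsetSum_apply]
    refine sum_eq_zero fun j _ => Finsupp.single_eq_of_ne ?_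
    rintro rfl
    simp at hD

variable [IsAlgClosed k] (p : ℕ) [ExpChar k p]

/-- The leading forms of a proper stable filtration are combinations of the monomials whose
exponents are divisible by the `q_i`: otherwise a divided derivative would produce a new pure
leading form. -/
theorem coeff_mem_of_not_dvd {q : ι → ℕ} {h : ι → A} (H : IsAdapted x q h)
    (hq : ∀ i, q i = 0 ∨ ∃ e, q i = p ^ e)
    {J : IdealisticFiltration A} (hst : J.IsStable τ) (hprop : J.IsProper)
    (hJ : ∀ i, h i ∈ J.level (q i))
    (hpure : ∀ (e : ℕ) (u f : A), u ∈ maximalIdeal A → f ∈ J.level ((p ^ e : ℕ) : ℝ) →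
      f - u ^ p ^ e ∈ maximalIdeal A ^ (p ^ e + 1) → ∀ i, ¬ q i ∣ p ^ e →
        MvPowerSeries.coeff (Finsupp.single i 1) (τ u) ∈ maximalIdeal A)
    (n : ℕ) {f : A} (hf : f ∈ J.level n) {D : ι →₀ ℕ} (hD : D.degree = n)
    (hbad : ∃ i, ¬ q i ∣ D i) : MvPowerSeries.coeff D (τ f) ∈ maximalIdeal A := by
  have : ExpChar A p := expChar_of_injective_algebraMap (algebraMap k A).injective p
  have hx := F.x_mem
  have hb := H.isTriangular hx
  induction n using Nat.strong_induction_on generalizing f D with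
  | _ n ih =>
  have hfn : f ∈ maximalIdeal A ^ n := by
    simpa using hprop.level_le_pow F hst n hf
  -- A bad exponent occurring in the leading form is concentrated in one index.
  have hconc : ∀ D : ι →₀ ℕ, D.degree = n → (∃ i, ¬ q i ∣ D i) →
      MvPowerSeries.coeff D (τ f) ∉ maximalIdeal A →
        ∃ i j, D = Finsupp.single i n ∧ n = p ^ j ∧ ¬ q i ∣ n := by
    rintro D hD ⟨i, hi⟩ hmem
    obtain ⟨j, hqj, hle, hchoose⟩ := exists_choose_pow_ne_zero k p (hq i) hi
    obtain ⟨K, rfl⟩ : ∃ K, D = Finsupp.single i (p ^ j) + K :=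
      ⟨D - Finsupp.single i (p ^ j), (add_tsub_cancel_of_le (Finsupp.single_le_iff.2 hle)).symm⟩
    by_cases hK : K = 0
    · subst hK
      rw [add_zero, Finsupp.degree_single] at hD
      exact ⟨i, j, by rw [add_zero, hD], hD.symm, hD ▸ hqj⟩
    exfalso
    have hKpos : 0 < K.degree := Nat.pos_of_ne_zero (mt (Finsupp.degree_eq_zero_iff K).1 hK)
    rw [map_add, Finsupp.degree_single] at hD
    have h1 := hst _ _ hf K
    have h2 : (n : ℝ) - K.degree = (p ^ j : ℕ) := by
      rw [← hD]; push_cast; ring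
    rw [h2] at h1
    have h3 := ih (p ^ j) (by omega) h1 (D := Finsupp.single i (p ^ j)) (by simp)
      ⟨i, by simpa using hqj⟩
    have h4 := F.coeff_coeff_sub_mem hfn (E := Finsupp.single i (p ^ j)) (K := K)
      (by simpa using hD)
    have h5 := Ideal.sub_mem _ h3 h4
    rw [sub_sub_cancel] at h5
    refine ((maximalIdeal.isMaximal A).isPrime.mem_or_mem h5).elim (fun h6 => ?_) hmem
    have h7 : (∏ l, ((Finsupp.single i (p ^ j) l + K l).choose (K l) : A)) =
        algebraMap k A (((Finsupp.single i (p ^ j) + K) i).choose (p ^ j) : ℕ) := by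
      rw [prod_eq_single i]
      · rw [map_natCast, Finsupp.add_apply, Finsupp.single_eq_same, Nat.choose_symm_add]
      · intro l _ hl
        rw [Finsupp.single_eq_of_ne hl]; simp
      · simp
    rw [h7, algebraMap_mem_maximalIdeal_iff] at h6
    exact hchoose h6
  by_contra hmem
  obtain ⟨i₀, j, rfl, rfl, hi₀⟩ := hconc D hD hbad hmem
  obtain ⟨c, hc, hr⟩ := hb.exists_expand_step F hfn
  have hcoeff : ∀ E : ι →₀ ℕ, E.degree = p ^ j →
      MvPowerSeries.coeff E (τ f) - algebraMap k A (c E) ∈ maximalIdeal A := fun E hE => by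
    have h1 := hb.coeff_linearCombination_sub_mem F c (J := E) fun D' hD' => by
      by_contra hne; have := hc D' hne; omega
    have h2 := Ideal.pow_le_self (by omega) (F.coeff_mem_pow hr E)
    rw [map_sub, map_sub] at h2
    simpa using Ideal.add_mem _ h2 h1
  -- Split off the good part, which lies in the filtration.
  set good := c.support.filter fun E => ∀ i, q i ∣ E i with hgood
  set g := ∑ E ∈ good, c E • adaptedElt x q h E with hg
  have hgJ : g ∈ J.level ((p ^ j : ℕ) : ℝ) := by
    refine Ideal.sum_mem _ fun E hE => ?_
    obtain ⟨hE1, hE2⟩ := mem_filter.1 hE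
    have hrem : expRem q E = 0 := by
      ext i; simpa using Nat.mod_eq_zero_of_dvd (hE2 i)
    rw [Algebra.smul_def]
    refine Ideal.mul_mem_left _ _ (Ideal.mul_mem_left _ _ ?_)
    refine J.mem_level_of_le (le_of_eq ?_) (J.prod_pow_mem_level h _ hJ (expQuo q E))
    have h1 := hc E (Finsupp.mem_support_iff.1 hE1)
    rw [degree_eq_expRem_add q E, hrem, map_zero, zero_add] at h1
    rw [← h1, Finsupp.degree_eq_sum]
    push_cast
    simp [mul_comm]
  -- The rest of the leading form is a combination of the `x_i ^ p ^ j`. As `k` is perfect, it is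
  -- the `p ^ j`-th power of a linear form `u`, and thus a pure leading form.
  choose root hroot using fun a : k =>
    IsAlgClosed.exists_pow_nat_eq a (pow_pos (expChar_pos k p) j)
  have hpos : 0 < p ^ j := pow_pos (expChar_pos k p) j
  set a : ι → k := fun i => if q i ∣ p ^ j then 0 else root (c (Finsupp.single i (p ^ j)))
    with ha
  set u := ∑ i, a i • x i with hu
  have hum : u ∈ maximalIdeal A :=
    Ideal.sum_mem _ fun i _ => Submodule.smul_of_tower_mem _ _ (hx i)
  have hupow : u ^ p ^ j = ∑ i, (if q i ∣ p ^ j then 0 else c (Finsupp.single i (p ^ j))) •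
      x i ^ p ^ j := by
    rw [hu, sum_pow_char_pow]
    refine sum_congr rfl fun i _ => ?_
    rw [smul_pow, ha]
    split_ifs with hdvd
    · simp only [hdvd, if_true, zero_pow hpos.ne']
    · simp only [hdvd, if_false, hroot]
  have hsub : f - g - u ^ p ^ j ∈ maximalIdeal A ^ (p ^ j + 1) := by
    set bad := c.support.filter fun E => ¬ ∀ i, q i ∣ E i with hbad'
    have h1 : Finsupp.linearCombination k (adaptedElt x q h) c =
        g + ∑ E ∈ bad, c E • adaptedElt x q h E := by
      rw [Finsupp.linearCombination_apply, Finsupp.sum, hg, hgood, hbad',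
        sum_filter_add_sum_filter_not]
    have h2 : ∑ E ∈ bad, c E • adaptedElt x q h E - ∑ E ∈ bad, c E • mon x E ∈
        maximalIdeal A ^ (p ^ j + 1) := by
      rw [← sum_sub_distrib]
      refine Ideal.sum_mem _ fun E hE => ?_
      rw [← smul_sub]
      have := hb E
      rw [hc E (Finsupp.mem_support_iff.1 (mem_filter.1 hE).1)] at this
      exact Submodule.smul_of_tower_mem _ _ this
    have h3 : ∑ E ∈ bad, c E • mon x E = u ^ p ^ j := by
      rw [hupow]
      have h4 : ∀ i, (if q i ∣ p ^ j then 0 else c (Finsupp.single i (p ^ j))) • x i ^ p ^ j =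
          (if q i ∣ p ^ j then 0 else
            c (Finsupp.single i (p ^ j)) • mon x (Finsupp.single i (p ^ j))) := fun i => by
        rw [mon_single]; split_ifs <;> simp
      simp_rw [h4]
      have h5 : bad ⊆ univ.image fun i => Finsupp.single i (p ^ j) := by
        intro E hE
        obtain ⟨hE1, hE2⟩ := mem_filter.1 hE
        have hE3 := hc E (Finsupp.mem_support_iff.1 hE1)
        push Not at hE2
        have hE4 : MvPowerSeries.coeff E (τ f) ∉ maximalIdeal A := fun hmem' => by
          have := Ideal.sub_mem _ hmem' (hcoeff E hE3)
          rw [sub_sub_cancel, algebraMap_mem_maximalIdeal_iff] at this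
          exact Finsupp.mem_support_iff.1 hE1 this
        obtain ⟨i, _, hE5, -⟩ := hconc E hE3 hE2 hE4
        exact mem_image.2 ⟨i, mem_univ _, hE5.symm⟩
      have h6 : ∑ E ∈ bad, c E • mon x E = ∑ E ∈ univ.image fun i => Finsupp.single i (p ^ j),
          (if ∀ i, q i ∣ E i then 0 else c E • mon x E) := by
        rw [← sum_subset h5]
        · refine sum_congr rfl fun E hE => ?_
          rw [if_neg (mem_filter.1 hE).2]
        · intro E _ hE
          split_ifs with hE2
          · rfl
          · have : c E = 0 := by
              by_contra hne
              exact hE (mem_filter.2 ⟨Finsupp.mem_support_iff.2 hne, hE2⟩)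
            rw [this, zero_smul]
      rw [h6, sum_image fun i _ j' _ hij => Finsupp.single_left_injective hpos.ne' hij]
      refine sum_congr rfl fun i _ => ?_
      have hiff : (∀ i', q i' ∣ Finsupp.single i (p ^ j) i') ↔ q i ∣ p ^ j := by
        constructor
        · intro hh; simpa using hh i
        · intro hh i'
          by_cases hii : i = i'
          · subst hii; simpa using hh
          · simp [hii]
      simp only [hiff]
    have := Ideal.add_mem _ hr h2
    rw [h1, h3] at this
    convert this using 1
    ring
  have h8 := hpure j u (f - g) hum (Ideal.sub_mem _ hf hgJ) hsub i₀ hi₀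
  have h9 := Ideal.sub_mem _ h8 (coeff_sum_smul_sub_mem F a i₀)
  rw [sub_sub_cancel, algebraMap_mem_maximalIdeal_iff] at h9
  have h10 : c (Finsupp.single i₀ (p ^ j)) = 0 := by
    rw [← hroot (c (Finsupp.single i₀ (p ^ j)))]
    simp only [ha, if_neg hi₀] at h9
    rw [h9, zero_pow hpos.ne']
  have h11 := hcoeff (Finsupp.single i₀ (p ^ j)) (by simp)
  rw [h10, map_zero, sub_zero] at h11
  exact hmem h11

end Structure


/-! ### Flags of subspaces and sequences of exponents -/

section Flag

variable {k E : Type*} [Field k] [AddCommGroup E] [Module k E] [FiniteDimensional k E]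

/-- The first `M + 1` members of a flag of subspaces have an adapted basis. -/
lemma exists_basis_of_flag_le (V : ℕ → Submodule k E) (hV : Monotone V) (M : ℕ) :
    ∃ (N : ℕ) (e : Fin N → ℕ) (v : Fin N → E), Monotone e ∧ (∀ l, e l ≤ M) ∧
      LinearIndependent k v ∧ ∀ m ≤ M, Submodule.span k (v '' {l | e l ≤ m}) = V m := by
  induction M with
  | zero =>
    set b := Module.finBasis k (V 0)
    refine ⟨_, fun _ => 0, fun i => b i, fun _ _ _ => le_rfl, fun _ => le_rfl,
      b.linearIndependent.map' (V 0).subtype (Submodule.ker_subtype _), fun m hm => ?_⟩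
    obtain rfl : m = 0 := by omega
    have h1 : (fun i => (b i : E)) '' {l | 0 ≤ 0} = (V 0).subtype '' Set.range b := by
      ext; simp
    rw [h1, Submodule.span_image, b.span_eq, Submodule.map_top, Submodule.range_subtype]
  | succ M ih =>
    obtain ⟨N, e, v, he, heM, hv, hspan⟩ := ih
    obtain ⟨X, hX⟩ := Submodule.exists_isCompl (V M)
    set W := X ⊓ V (M + 1) with hW
    have hVW : V M ⊔ W = V (M + 1) := by
      rw [hW, ← sup_inf_assoc_of_le _ (hV (Nat.le_succ M)), hX.sup_eq_top, top_inf_eq]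
    have hdis : Disjoint (V M) W := hX.disjoint.mono_right inf_le_left
    set b := Module.finBasis k W
    set r := Module.finrank k W
    have hw : LinearIndependent k fun i => (b i : E) :=
      b.linearIndependent.map' W.subtype (Submodule.ker_subtype _)
    have hwspan : Submodule.span k (Set.range fun i => (b i : E)) = W := by
      have h1 : (Set.range fun i => (b i : E)) = W.subtype '' Set.range b := by
        ext; simp
      rw [h1, Submodule.span_image, b.span_eq, Submodule.map_top, Submodule.range_subtype]
    have hall : Submodule.span k (Set.range v) = V M := by
      rw [← hspan M le_rfl]; congr 1; ext; simp [heM]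
    have hsum : LinearIndependent k (Sum.elim v fun i => (b i : E)) :=
      hv.sum_type hw (by rw [hall, hwspan]; exact hdis)
    refine ⟨N + r, Fin.append e fun _ => M + 1, Fin.append v fun i => b i, ?_, ?_, ?_, ?_⟩
    · intro i j hij
      induction i using Fin.addCases <;> induction j using Fin.addCases
      · simp only [Fin.append_left]; exact he ((Fin.castAddOrderEmb r).le_iff_le.1 hij)
      · simp only [Fin.append_left, Fin.append_right]; exact (heM _).trans (Nat.le_succ _)
      · rename_i i j
        exfalso
        have := Fin.le_def.1 hij
        simp at this
        omega
      · simp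
    · intro i
      induction i using Fin.addCases
      · simp only [Fin.append_left]; exact (heM _).trans (Nat.le_succ _)
      · simp
    · rw [← linearIndependent_equiv finSumFinEquiv]
      convert hsum using 1
      ext i
      rcases i with i | i <;> simp
    · intro m hm
      rcases Nat.le_succ_iff.1 hm with hm | rfl
      · rw [← hspan m hm]
        congr 1
        ext y
        constructor
        · rintro ⟨i, hi, rfl⟩
          induction i using Fin.addCases
          · rename_i i
            exact ⟨i, by simpa using hi, by simp⟩
          · simp at hi; omega
        · rintro ⟨i, hi, rfl⟩
          exact ⟨Fin.castAdd r i, by simpa using hi, by simp⟩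
      · refine Eq.trans ?_ ((Submodule.span_union _ _).trans
          ((congrArg₂ (· ⊔ ·) hall hwspan).trans hVW))
        congr 1
        ext y
        constructor
        · rintro ⟨i, hi, rfl⟩
          induction i using Fin.addCases
          · left; simp
          · right; simp
        · rintro (⟨i, rfl⟩ | ⟨i, rfl⟩)
          · exact ⟨Fin.castAdd r i, by simpa using (heM i).trans (Nat.le_succ _), by simp⟩
          · exact ⟨Fin.natAdd N i, by simp, by simp⟩

/-- A flag of subspaces has an adapted basis. -/
lemma exists_basis_of_flag (V : ℕ → Submodule k E) (hV : Monotone V) :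
    ∃ (N : ℕ) (e : Fin N → ℕ) (v : Fin N → E), Monotone e ∧
      LinearIndependent k v ∧ ∀ m, Submodule.span k (v '' {l | e l ≤ m}) = V m := by
  obtain ⟨M, hM⟩ := monotone_stabilizes_iff_noetherian.2 (inferInstance : IsNoetherian k E) ⟨V, hV⟩
  obtain ⟨N, e, v, he, heM, hv, hspan⟩ := exists_basis_of_flag_le V hV M
  refine ⟨N, e, v, he, hv, fun m => ?_⟩
  rcases le_total m M with h | h
  · exact hspan m h
  · have h1 : V M = V m := hM m h
    rw [← h1, ← hspan M le_rfl]
    congr 1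
    ext
    simp [heM, fun l => (heM l).trans h]

/-- Linearly independent vectors extend to a basis indexed by an initial segment. -/
lemma exists_basis_extending {n N : ℕ} (hn : Module.finrank k E = n) {v : Fin N → E}
    (hv : LinearIndependent k v) :
    ∃ (hN : N ≤ n) (b : Module.Basis (Fin n) k E), ∀ l, b (Fin.castLE hN l) = v l := by
  obtain ⟨X, hX⟩ := Submodule.exists_isCompl (Submodule.span k (Set.range v))
  set r := Module.finrank k X
  set w := Module.finBasis k X
  have hwspan : Submodule.span k (Set.range fun i => (w i : E)) = X := by
    have h1 : (Set.range fun i => (w i : E)) = X.subtype '' Set.range w := by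
      ext; simp
    rw [h1, Submodule.span_image, w.span_eq, Submodule.map_top, Submodule.range_subtype]
  have hsum : LinearIndependent k (Sum.elim v fun i => (w i : E)) :=
    hv.sum_type (w.linearIndependent.map' X.subtype (Submodule.ker_subtype _))
      (by rw [hwspan]; exact hX.disjoint)
  set b := (Module.Basis.mk hsum (by
    rw [Set.Sum.elim_range, Submodule.span_union, hwspan, hX.sup_eq_top])).reindex
      finSumFinEquiv with hb
  have hb' : Module.finrank k E = N + r := by
    rw [Module.finrank_eq_card_basis b, Fintype.card_fin]
  obtain rfl : n = N + r := hn.symm.trans hb'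
  refine ⟨Nat.le_add_right _ _, b, fun l => ?_⟩
  have h1 : Fin.castLE (Nat.le_add_right N r) l = finSumFinEquiv (Sum.inl l) := by
    simp; rfl
  rw [h1, hb, Module.Basis.reindex_apply, Equiv.symm_apply_apply, Module.Basis.mk_apply,
    Sum.elim_inl]

end Flag

section Exponent

open Classical in
/-- The exponent `q_i` attached to the index `i` when exactly the first `c e` indices belong to
exponents `≤ p ^ e`; it is zero for the indices which never occur. -/
noncomputable def expo (p : ℕ) (c : ℕ → ℕ) (i : ℕ) : ℕ :=
  if h : ∃ m, i < c m then p ^ Nat.find h else 0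

lemma expo_eq_zero_or (p : ℕ) (c : ℕ → ℕ) (i : ℕ) : expo p c i = 0 ∨ ∃ e, expo p c i = p ^ e := by
  rw [expo]; split_ifs
  · exact Or.inr ⟨_, rfl⟩
  · exact Or.inl rfl

lemma expo_dvd {p : ℕ} {c : ℕ → ℕ} {i m : ℕ} (h : i < c m) : expo p c i ∣ p ^ m := by
  classical
  rw [expo, dif_pos ⟨m, h⟩]
  exact pow_dvd_pow _ (Nat.find_min' _ h)

lemma lt_of_expo_le {p : ℕ} {c : ℕ → ℕ} (hp : 1 < p) (hc : Monotone c) {i m : ℕ}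
    (h0 : expo p c i ≠ 0) (h : expo p c i ≤ p ^ m) : i < c m := by
  classical
  have hex : ∃ m, i < c m := by
    by_contra hne; exact h0 (by rw [expo, dif_neg hne])
  rw [expo, dif_pos hex] at h
  exact (Nat.find_spec hex).trans_le (hc ((Nat.pow_le_pow_iff_right hp).1 h))

lemma expo_of_forall {p : ℕ} {c : ℕ → ℕ} {i e : ℕ} (h : ∀ m, i < c m ↔ e ≤ m) :
    expo p c i = p ^ e := by
  classical
  have hex : ∃ m, i < c m := ⟨e, (h e).2 le_rfl⟩
  rw [expo, dif_pos hex, (Nat.find_eq_iff hex).2 ⟨(h e).2 le_rfl, fun m hm => by rw [h]; omega⟩]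

lemma lt_card_filter_iff {N : ℕ} {e : Fin N → ℕ} (he : Monotone e) (l : Fin N) (m : ℕ) :
    (l : ℕ) < Fintype.card {l : Fin N // e l ≤ m} ↔ e l ≤ m := by
  rw [Fintype.card_subtype]
  constructor
  · intro h
    by_contra! hlt
    have : (univ.filter fun l => e l ≤ m) ⊆ Finset.Iio l := fun j hj => by
      rw [Finset.mem_Iio]
      by_contra! hle
      have := he hle
      simp at hj
      omega
    have := card_le_card this
    rw [Fin.card_Iio] at this
    omega
  · intro h
    have : Finset.Iic l ⊆ univ.filter fun l => e l ≤ m := fun j hj => by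
      simpa using (he (Finset.mem_Iic.1 hj)).trans h
    have := card_le_card this
    rw [Fin.card_Iic] at this
    omega

/-- The monomials of degree `m` in the leading algebra with exponents `q`. -/
def goodExponents {ι : Type*} (q : ι → ℕ) (m : ℕ) : Set (ι →₀ ℕ) :=
  {D | D.degree = m ∧ ∀ i, q i ∣ D i}

lemma goodExponents_finite {ι : Type*} [Finite ι] (q : ι → ℕ) (m : ℕ) :
    (goodExponents q m).Finite :=
  (Finsupp.finite_of_degree_le m).subset fun _ hD => hD.1.le

/-- If two sequences of dimensions agree below `E` and the first one is larger at `E`, then it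
has more monomials in degree `p ^ E`. -/
lemma ncard_goodExponents_lt {p n E : ℕ} (hp : 0 < p) {c c' : ℕ → ℕ} (hc' : Monotone c')
    (hcp : p = 1 → ∀ m, c' m = c' 0) (hn : ∀ m, c m ≤ n) (hlt : ∀ j < E, c j = c' j)
    (hE : c' E < c E) :
    (goodExponents (fun i : Fin n => expo p c' i) (p ^ E)).ncard <
      (goodExponents (fun i : Fin n => expo p c i) (p ^ E)).ncard := by
  classical
  -- An exponent `≤ p ^ E` occurs at level `E` at the latest; for `p = 1` the sequence is constant.
  have key : ∀ i, expo p c' i ≠ 0 → expo p c' i ≤ p ^ E → i < c' E := by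
    intro i h0 hle
    rcases Nat.lt_or_ge 1 p with h | h
    · exact lt_of_expo_le h hc' h0 hle
    · have hex : ∃ m, i < c' m := by
        by_contra hne; exact h0 (by rw [expo, dif_neg hne])
      obtain ⟨m, hm⟩ := hex
      rw [hcp (by omega)] at hm ⊢
      exact hm
  refine Set.ncard_lt_ncard ⟨fun D hD => ⟨hD.1, fun i => ?_⟩, fun hsub => ?_⟩
    (goodExponents_finite _ _)
  · have hdvd := hD.2 i
    by_cases hDi : D i = 0
    · rw [hDi]; exact dvd_zero _
    have h0 : expo p c' i ≠ 0 := fun h => hDi (by simpa [h] using hdvd)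
    have hle : expo p c' i ≤ p ^ E := (Nat.le_of_dvd (Nat.pos_of_ne_zero hDi) hdvd).trans
      ((Finsupp.le_degree i D).trans hD.1.le)
    refine dvd_trans ?_ hdvd
    have hex : ∃ m, (i : ℕ) < c' m := ⟨E, key i h0 hle⟩
    have hfind : Nat.find hex ≤ E := Nat.find_min' _ (key i h0 hle)
    change expo p c i ∣ expo p c' i
    rw [show expo p c' i = p ^ Nat.find hex by rw [expo, dif_pos hex]]
    refine expo_dvd ?_
    rcases hfind.lt_or_eq with h | h
    · rw [hlt _ h]; exact Nat.find_spec hex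
    · have := Nat.find_spec hex
      rw [h] at this ⊢
      exact this.trans hE
  · -- The `p ^ E`-th power of the coordinate of index `c' E` is the additional monomial.
    set i : Fin n := ⟨c' E, hE.trans_le (hn E)⟩ with hi
    have hmem : Finsupp.single i (p ^ E) ∈ goodExponents (fun i : Fin n => expo p c i) (p ^ E) := by
      refine ⟨by simp, fun j => ?_⟩
      by_cases hj : i = j
      · subst hj; simpa using expo_dvd hE
      · simp [hj]
    have h1 := (hsub hmem).2 i
    rw [Finsupp.single_eq_same] at h1
    have hpos : 0 < p ^ E := pow_pos hp E
    have h0 : expo p c' i ≠ 0 := fun h => hpos.ne' (by simpa [h] using h1)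
    exact lt_irrefl _ (key i h0 (Nat.le_of_dvd hpos h1))

end Exponent


/-! ### Leading generator systems -/

section PureForms

variable {k A ι : Type*} [Field k] [CommRing A] [Algebra k A] [Fintype ι] [IsLocalRing A]

lemma toJet_eq_iff {n : ℕ} {f g : A} :
    toJet k A n f = toJet k A n g ↔ f - g ∈ maximalIdeal A ^ (n + 1) :=
  Ideal.Quotient.eq

lemma pow_sub_pow_mem {n m : ℕ} {u v : A} (hu : u ∈ maximalIdeal A ^ n)
    (huv : u - v ∈ maximalIdeal A ^ (n + 1)) :
    u ^ m - v ^ m ∈ maximalIdeal A ^ (m * n + 1) := by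
  have hl := adic_one_level_natCast (maximalIdeal A)
  have hv : v ∈ maximalIdeal A ^ n := by
    have := Ideal.sub_mem _ hu (Ideal.pow_le_pow_right (Nat.le_succ n) huv)
    rwa [sub_sub_cancel] at this
  have := (adic (maximalIdeal A) 1 zero_le_one).pow_sub_pow_mem_level u v n (1 : ℕ)
    (by rwa [hl]) (by rwa [hl]) (by exact_mod_cast (hl (n + 1)).symm ▸ huv) m
  rw [← hl]
  exact_mod_cast this

variable [DecidableEq ι] {s : ι → A} {τ : A →ₐ[k] MvPowerSeries ι A} (F : IsFrame s τ)
include F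

/-- Modulo `𝔪 ^ 2` the elements of `𝔪` are linear forms in the coordinates. -/
lemma IsFrame.exists_sub_linear_mem {u : A} (hu : u ∈ maximalIdeal A) :
    ∃ v : ι → k, u - Fintype.linearCombination k s v ∈ maximalIdeal A ^ 2 := by
  rw [← F.span_eq] at hu
  obtain ⟨c, rfl⟩ := Ideal.mem_span_range_iff_exists_fun.1 hu
  choose v hv using fun i => F.residue (c i)
  refine ⟨v, ?_⟩
  rw [Fintype.linearCombination_apply, ← sum_sub_distrib]
  refine Ideal.sum_mem _ fun i _ => ?_
  rw [Algebra.smul_def, ← sub_mul, pow_two]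
  exact Ideal.mul_mem_mul (hv i) (F.x_mem i)

lemma IsFrame.linear_mem (v : ι → k) : Fintype.linearCombination k s v ∈ maximalIdeal A := by
  rw [Fintype.linearCombination_apply]
  exact Ideal.sum_mem _ fun i _ => Submodule.smul_of_tower_mem _ _ (F.x_mem i)

variable (p : ℕ) [ExpChar k p]

omit F [IsLocalRing A] [DecidableEq ι] in
/-- Additivity of the Frobenius on linear forms. -/
lemma linear_sum_pow {κ : Type*} [Fintype κ] [Nontrivial A] (a : κ → k) (v : κ → ι → k) (e : ℕ) :
    Fintype.linearCombination k s (∑ l, a l • v l) ^ p ^ e =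
      ∑ l, a l ^ p ^ e • Fintype.linearCombination k s (v l) ^ p ^ e := by
  have : ExpChar A p := expChar_of_injective_algebraMap (algebraMap k A).injective p
  rw [map_sum, sum_pow_char_pow]
  exact sum_congr rfl fun l _ => by rw [map_smul, smul_pow]

/-- The `p ^ e`-th power of a nonzero linear form has order exactly `p ^ e`. -/
lemma IsFrame.eq_zero_of_linear_pow_mem {v : ι → k} {e : ℕ}
    (h : Fintype.linearCombination k s v ^ p ^ e ∈ maximalIdeal A ^ (p ^ e + 1)) : v = 0 := by
  have hpos : 0 < p ^ e := pow_pos (expChar_pos k p) e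
  have h1 : Fintype.linearCombination k s v ^ p ^ e = Finsupp.linearCombination k (mon s)
      (∑ i, Finsupp.single (Finsupp.single i (p ^ e)) (v i ^ p ^ e)) := by
    have h2 : v = ∑ l, v l • Pi.single l (1 : k) := by
      ext i; simp [Finset.sum_apply, Pi.single_apply]
    conv_lhs => rw [h2]
    rw [linear_sum_pow p]
    simp [map_sum]
  rw [h1] at h
  ext i
  have h3 := (isTriangular_mon s).eq_zero_of_linearCombination_mem F h (Finsupp.single i (p ^ e))
    (by simp)
  rw [Finsupp.finsetSum_apply, Finset.sum_eq_single i] at h3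
  · exact (pow_eq_zero_iff hpos.ne').1 (by simpa only [Finsupp.single_eq_same] using h3)
  · intro j _ hj
    refine Finsupp.single_eq_of_ne fun h => hj ?_
    exact (Finsupp.single_left_injective hpos.ne' h).symm
  · simp

variable [IsAlgClosed k]

/-- The `p ^ e`-th powers of linear forms are independent exactly when the linear forms are: the
coefficients of a relation have `p ^ e`-th roots. -/
lemma IsFrame.linearIndependent_pow {κ : Type*} [Fintype κ] {v : κ → ι → k} {e : ℕ} :
    LinearIndependent k (fun l => toJet k A (p ^ e) (Fintype.linearCombination k s (v l) ^ p ^ e)) ↔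
      LinearIndependent k v := by
  have hpos : 0 < p ^ e := pow_pos (expChar_pos k p) e
  have key : ∀ a : κ → k, ∑ l, a l ^ p ^ e •
      toJet k A (p ^ e) (Fintype.linearCombination k s (v l) ^ p ^ e) = 0 ↔
        ∑ l, a l • v l = 0 := by
    intro a
    simp_rw [← map_smul, ← map_sum]
    rw [← linear_sum_pow p, ← map_zero (toJet k A (p ^ e)), toJet_eq_iff, sub_zero]
    exact ⟨F.eq_zero_of_linear_pow_mem p, fun h => by
      rw [h, map_zero, zero_pow hpos.ne']; exact Ideal.zero_mem _⟩
  rw [Fintype.linearIndependent_iff, Fintype.linearIndependent_iff]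
  constructor
  · intro h a ha i
    have := h (fun l => a l ^ p ^ e) ((key a).2 ha) i
    exact pow_eq_zero_iff hpos.ne' |>.1 this
  · intro h a ha i
    choose root hroot using fun a : k => IsAlgClosed.exists_pow_nat_eq a hpos
    have h1 : a = fun l => root (a l) ^ p ^ e := by ext l; rw [hroot]
    rw [h1] at ha ⊢
    have := h _ ((key fun l => root (a l)).1 ha) i
    simp only [this, zero_pow hpos.ne']

omit F [DecidableEq ι] in
/-- The span of the `p ^ e`-th powers of linear forms consists of the `p ^ e`-th powers of the
elements of their span, because `k` is perfect. -/
lemma mem_span_range_pow_iff {κ : Type*} [Fintype κ] {v : κ → ι → k} {e : ℕ}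
    {y : A ⧸ (maximalIdeal A ^ (p ^ e + 1))} :
    y ∈ Submodule.span k (Set.range fun l =>
      toJet k A (p ^ e) (Fintype.linearCombination k s (v l) ^ p ^ e)) ↔
      ∃ w ∈ Submodule.span k (Set.range v),
        toJet k A (p ^ e) (Fintype.linearCombination k s w ^ p ^ e) = y := by
  have hpos : 0 < p ^ e := pow_pos (expChar_pos k p) e
  have key : ∀ a : κ → k, ∑ l, a l ^ p ^ e •
      toJet k A (p ^ e) (Fintype.linearCombination k s (v l) ^ p ^ e) =
        toJet k A (p ^ e) (Fintype.linearCombination k s (∑ l, a l • v l) ^ p ^ e) := by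
    intro a
    simp_rw [← map_smul, ← map_sum]
    rw [← linear_sum_pow p]
  simp only [Submodule.mem_span_range_iff_exists_fun]
  constructor
  · rintro ⟨a, rfl⟩
    choose root hroot using fun a : k => IsAlgClosed.exists_pow_nat_eq a hpos
    refine ⟨_, ⟨fun l => root (a l), rfl⟩, ?_⟩
    rw [← key]
    simp_rw [hroot]
  · rintro ⟨_, ⟨a, rfl⟩, rfl⟩
    exact ⟨_, key a⟩

variable (J : IdealisticFiltration A)

omit F [DecidableEq ι] in
variable (s k) in
/-- The space of the linear forms whose `p ^ e`-th powers are leading forms of level `p ^ e`. -/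
def pureForms (e : ℕ) : Submodule k (ι → k) where
  carrier := {v | ∃ f ∈ J.level ((p ^ e : ℕ) : ℝ),
    f - Fintype.linearCombination k s v ^ p ^ e ∈ maximalIdeal A ^ (p ^ e + 1)}
  zero_mem' := ⟨0, Ideal.zero_mem _, by simp [(expChar_pos k p).ne']⟩
  add_mem' := by
    rintro v w ⟨f, hf, hfv⟩ ⟨g, hg, hgw⟩
    have : ExpChar A p := expChar_of_injective_algebraMap (algebraMap k A).injective p
    refine ⟨f + g, Ideal.add_mem _ hf hg, ?_⟩
    rw [map_add, add_pow_expChar_pow, add_sub_add_comm]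
    exact Ideal.add_mem _ hfv hgw
  smul_mem' := by
    rintro c v ⟨f, hf, hfv⟩
    refine ⟨c ^ p ^ e • f, Submodule.smul_of_tower_mem _ _ hf, ?_⟩
    rw [map_smul, smul_pow, ← smul_sub]
    exact Submodule.smul_of_tower_mem _ _ hfv

omit [IsAlgClosed k] F [DecidableEq ι] in
/-- Raising to the `p`-th power takes pure forms of exponent `e` to exponent `e + 1`. -/
lemma pureForms_mono (hs : ∀ i, s i ∈ maximalIdeal A) : Monotone (pureForms k s p J) := by
  refine monotone_nat_of_le_succ fun e => ?_
  rintro v ⟨f, hf, hfv⟩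
  have hv : Fintype.linearCombination k s v ∈ maximalIdeal A := by
    rw [Fintype.linearCombination_apply]
    exact Ideal.sum_mem _ fun i _ => Submodule.smul_of_tower_mem _ _ (hs i)
  refine ⟨f ^ p, ?_, ?_⟩
  · refine J.mem_level_of_le (le_of_eq ?_) (J.pow_mem_level hf p)
    push_cast; ring
  · have hfm : f ∈ maximalIdeal A ^ p ^ e := by
      have := Ideal.add_mem _ (Ideal.pow_le_pow_right (Nat.le_succ _) hfv)
        (Ideal.pow_mem_pow hv (p ^ e))
      rwa [sub_add_cancel] at this
    have := pow_sub_pow_mem (m := p) hfm hfv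
    rwa [← pow_mul, ← pow_succ, ← pow_succ'] at this

omit F [DecidableEq ι] [IsAlgClosed k] in
/-- In characteristic zero the spaces of pure forms coincide. -/
lemma pureForms_eq_of_eq_one (hp : p = 1) (e : ℕ) : pureForms k s p J e = pureForms k s p J 0 := by
  have h : p ^ e = p ^ 0 := by simp [hp]
  ext v
  change (∃ f ∈ J.level ((p ^ e : ℕ) : ℝ),
    f - Fintype.linearCombination k s v ^ p ^ e ∈ maximalIdeal A ^ (p ^ e + 1)) ↔ _
  rw [h]
  rfl

/-- The pure part of degree `p ^ e` consists of the `p ^ e`-th powers of the pure forms. -/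
lemma IsFrame.mem_purePart_iff {e : ℕ} {y : A ⧸ (maximalIdeal A ^ (p ^ e + 1))} :
    y ∈ purePart k p J e ↔ ∃ w ∈ pureForms k s p J e,
      toJet k A (p ^ e) (Fintype.linearCombination k s w ^ p ^ e) = y := by
  have hpos : 0 < p ^ e := pow_pos (expChar_pos k p) e
  constructor
  · rintro ⟨⟨f, ⟨hf, hfm⟩, rfl⟩, u, hu, huf⟩
    obtain ⟨v, hv⟩ := F.exists_sub_linear_mem hu
    have h1 := pow_sub_pow_mem (n := 1) (m := p ^ e) (by simpa using hu) hv
    rw [mul_one] at h1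
    refine ⟨v, ⟨f, hf, ?_⟩, ?_⟩
    · have := Ideal.sub_mem _ h1 (toJet_eq_iff.1 huf)
      convert this using 1; ring
    · rw [← huf, eq_comm]; exact toJet_eq_iff.2 h1
  · rintro ⟨w, ⟨f, hf, hfw⟩, rfl⟩
    refine ⟨⟨f, ⟨hf, ?_⟩, toJet_eq_iff.2 hfw⟩, _, F.linear_mem w, rfl⟩
    have := Ideal.add_mem _ (Ideal.pow_le_pow_right (Nat.le_succ _) hfw)
      (Ideal.pow_mem_pow (F.linear_mem w) (p ^ e))
    rwa [sub_add_cancel] at this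

/-- The pure part has a basis of powers of a basis of the pure forms. -/
lemma IsFrame.purePart_eq_span {κ : Type*} [Fintype κ] {v : κ → ι → k} {e : ℕ}
    (hv : Submodule.span k (Set.range v) = pureForms k s p J e) :
    Submodule.span k (Set.range fun l =>
      toJet k A (p ^ e) (Fintype.linearCombination k s (v l) ^ p ^ e)) = purePart k p J e := by
  ext y
  rw [mem_span_range_pow_iff, F.mem_purePart_iff p J, hv]

/-- Although `v ↦ v ^ p ^ e` is only semilinear, it preserves dimensions. -/
lemma IsFrame.finrank_purePart (e : ℕ) :
    Module.finrank k (purePart k p J e) = Module.finrank k (pureForms k s p J e) := by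
  set b := Module.finBasis k (pureForms k s p J e)
  have hspan : Submodule.span k (Set.range fun i => (b i : ι → k)) = pureForms k s p J e := by
    have h1 : (Set.range fun i => (b i : ι → k)) =
        (pureForms k s p J e).subtype '' Set.range b := by
      ext; simp
    rw [h1, Submodule.span_image, b.span_eq, Submodule.map_top, Submodule.range_subtype]
  have hli : LinearIndependent k fun i => (b i : ι → k) :=
    b.linearIndependent.map' (Submodule.subtype _) (Submodule.ker_subtype _)
  rw [← F.purePart_eq_span p J hspan,
    finrank_span_eq_card ((F.linearIndependent_pow p).2 hli), Fintype.card_fin]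

end PureForms

section LGS

variable {k A : Type*} [Field k] [CommRing A] [Algebra k A] [IsLocalRing A]

/-- Coordinates `s` of a local ring such that every linear change of coordinates has a Taylor
homomorphism under which the filtration `J` is stable. -/
structure HasFrames (k : Type*) {A : Type*} [Field k] [CommRing A] [Algebra k A] [IsLocalRing A]
    (J : IdealisticFiltration A) {n : ℕ} (s : Fin n → A) : Prop where
  exists_taylor : ∀ b : Module.Basis (Fin n) k (Fin n → k), ∃ τ : A →ₐ[k] MvPowerSeries (Fin n) A,
    IsFrame (fun i => Fintype.linearCombination k s (b i)) τ ∧ J.IsStable τ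

variable {n : ℕ} {s : Fin n → A} {J : IdealisticFiltration A} (HF : HasFrames k J s)
include HF

lemma HasFrames.exists_frame :
    ∃ τ : A →ₐ[k] MvPowerSeries (Fin n) A, IsFrame s τ ∧ J.IsStable τ := by
  obtain ⟨τ, h1, h2⟩ := HF.exists_taylor (Pi.basisFun k (Fin n))
  refine ⟨τ, ?_, h2⟩
  convert h1 using 1
  ext i
  simp

/-- A proper stable filtration has `J_a ⊆ 𝔪 ^ ⌈a⌉`, since an element of smaller order would have a
unit among its coefficients of positive level. -/
lemma HasFrames.one_le_muMod (hprop : J.IsProper) {N : ℕ} (h : Fin N → A) :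
    1 ≤ muMod J h := by
  obtain ⟨τ, F, hst⟩ := HF.exists_frame
  rw [← ENNReal.ofReal_one, ofReal_le_muMod_iff J h zero_le_one]
  intro a
  rw [one_mul]
  exact (hprop.level_le_pow F hst a).trans le_sup_left

variable (p : ℕ) [ExpChar k p] [IsAlgClosed k]

lemma HasFrames.finrank_purePart (e : ℕ) :
    Module.finrank k (purePart k p J e) = Module.finrank k (pureForms k s p J e) := by
  obtain ⟨τ, F, -⟩ := HF.exists_frame
  exact F.finrank_purePart p J e

lemma HasFrames.finrank_purePart_le (e : ℕ) : Module.finrank k (purePart k p J e) ≤ n := by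
  rw [HF.finrank_purePart]
  exact (Submodule.finrank_le _).trans (by simp)

lemma HasFrames.finrank_purePart_mono :
    Monotone fun e => Module.finrank k (purePart k p J e) := by
  obtain ⟨τ, F, -⟩ := HF.exists_frame
  intro e e' h
  simp only [HF.finrank_purePart]
  exact Submodule.finrank_mono (pureForms_mono p J F.x_mem h)

lemma HasFrames.finrank_purePart_eq (hp : p = 1) (e : ℕ) :
    Module.finrank k (purePart k p J e) = Module.finrank k (purePart k p J 0) := by
  rw [HF.finrank_purePart, HF.finrank_purePart, pureForms_eq_of_eq_one p J hp]

/-- If some positive level contains a unit, then every linear form is pure. -/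
lemma HasFrames.finrank_purePart_of_not_isProper (hJ : ¬ J.IsProper) (e : ℕ) :
    Module.finrank k (purePart k p J e) = n := by
  rw [HF.finrank_purePart]
  have : pureForms k s p J e = ⊤ := by
    refine Submodule.eq_top_iff'.2 fun v => ⟨Fintype.linearCombination k s v ^ p ^ e, ?_, ?_⟩
    · rw [level_eq_top_of_not_isProper hJ]; trivial
    · simp
  rw [this, finrank_top]
  simp

/-- A basis adapted to the flag of pure forms lifts to a leading generator system. -/
theorem HasFrames.exists_isLGS :
    ∃ (N : ℕ) (h : Fin N → A) (e : Fin N → ℕ), IsLGS k p J h e := by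
  obtain ⟨τ, F, -⟩ := HF.exists_frame
  obtain ⟨N, e, v, he, hv, hspan⟩ :=
    exists_basis_of_flag (pureForms k s p J) (pureForms_mono p J F.x_mem)
  have hmem : ∀ l, v l ∈ pureForms k s p J (e l) := fun l => by
    rw [← hspan]; exact Submodule.subset_span ⟨l, le_refl (e l), rfl⟩
  choose h hJ hh using hmem
  have hm : ∀ l, h l ∈ maximalIdeal A ^ p ^ e l := fun l => by
    have := Ideal.add_mem _ (Ideal.pow_le_pow_right (Nat.le_succ _) (hh l))
      (Ideal.pow_mem_pow (F.linear_mem (v l)) (p ^ e l))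
    rwa [sub_add_cancel] at this
  have hpow : ∀ (m : ℕ) (l : {l // e l ≤ m}), toJet k A (p ^ m) (h l ^ p ^ (m - e l)) =
      toJet k A (p ^ m) (Fintype.linearCombination k s (v l) ^ p ^ m) := by
    intro m l
    have h1 : p ^ m = p ^ (m - e l) * p ^ e l := by rw [← pow_add, Nat.sub_add_cancel l.2]
    have h2 := pow_sub_pow_mem (m := p ^ (m - e l)) (hm l) (hh l)
    rw [← pow_mul, mul_comm (p ^ e l), ← h1] at h2
    exact toJet_eq_iff.2 h2
  refine ⟨N, h, e, he, hJ, hm, fun l => ?_, fun m => ?_, fun m => ?_⟩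
  · exact (F.mem_purePart_iff p J).2
      ⟨v l, ⟨h l, hJ l, hh l⟩, (toJet_eq_iff.2 (hh l)).symm⟩
  · simp_rw [hpow]
    exact (F.linearIndependent_pow p (v := fun l : {l // e l ≤ m} => v l)).2
      (hv.comp _ Subtype.val_injective)
  · simp_rw [hpow]
    refine F.purePart_eq_span p J (v := fun l : {l // e l ≤ m} => v l) ?_
    rw [← hspan]
    congr 1
    ext; simp

variable {p} {N : ℕ} {h : Fin N → A} {e : Fin N → ℕ} (L : IsLGS k p J h e)
include L

omit HF in
lemma IsLGS.finrank_purePart (m : ℕ) :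
    Module.finrank k (purePart k p J m) = Fintype.card {l : Fin N // e l ≤ m} := by
  rw [← L.span_eq m, finrank_span_eq_card (L.linearIndependent m)]

/-- A leading generator system is adapted to suitable coordinates; moreover the pure forms only
involve the coordinates of small exponent. -/
lemma HasFrames.exists_adapted :
    ∃ (x h' : Fin n → A) (τ : A →ₐ[k] MvPowerSeries (Fin n) A),
      IsFrame x τ ∧ J.IsStable τ ∧
      IsAdapted x (fun i : Fin n => expo p (fun m => Module.finrank k (purePart k p J m)) i) h' ∧
      (∀ i : Fin n, h' i ∈
        J.level (expo p (fun m => Module.finrank k (purePart k p J m)) i : ℕ)) ∧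
      Ideal.span (Set.range h') = Ideal.span (Set.range h) ∧
      ∀ (m : ℕ) (u f : A), u ∈ maximalIdeal A → f ∈ J.level ((p ^ m : ℕ) : ℝ) →
        f - u ^ p ^ m ∈ maximalIdeal A ^ (p ^ m + 1) → ∀ i : Fin n,
          ¬ expo p (fun m => Module.finrank k (purePart k p J m)) i ∣ p ^ m →
            MvPowerSeries.coeff (Finsupp.single i 1) (τ u) ∈ maximalIdeal A := by
  -- The leading form of `h_l` is the `p ^ e_l`-th power of a linear form `v_l`; the `v_l` are
  -- independent and extend to a basis `b`, which gives the new coordinates.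
  obtain ⟨τ₀, F₀, -⟩ := HF.exists_frame
  choose v hvV hv using fun l => (F₀.mem_purePart_iff p J).1 (L.leadingTerm_mem l)
  have hh : ∀ l, h l - Fintype.linearCombination k s (v l) ^ p ^ e l ∈
      maximalIdeal A ^ (p ^ e l + 1) := fun l => toJet_eq_iff.1 (hv l).symm
  have hpow : ∀ (m : ℕ) (l : {l // e l ≤ m}), toJet k A (p ^ m) (h l ^ p ^ (m - e l)) =
      toJet k A (p ^ m) (Fintype.linearCombination k s (v l) ^ p ^ m) := by
    intro m l
    have h1 : p ^ m = p ^ (m - e l) * p ^ e l := by rw [← pow_add, Nat.sub_add_cancel l.2]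
    have h2 := pow_sub_pow_mem (m := p ^ (m - e l)) (L.mem_pow l) (hh l)
    rw [← pow_mul, mul_comm (p ^ e l), ← h1] at h2
    exact toJet_eq_iff.2 h2
  have hvli : LinearIndependent k v := by
    set m := ∑ l, e l
    have h1 := L.linearIndependent m
    simp_rw [hpow] at h1
    have h2 := (F₀.linearIndependent_pow p (v := fun l : {l // e l ≤ m} => v l)).1 h1
    exact h2.comp (fun l => ⟨l, single_le_sum (f := e) (fun _ _ => Nat.zero_le _) (mem_univ l)⟩)
      fun a b hab => congrArg Subtype.val hab
  obtain ⟨hN, b, hb⟩ := exists_basis_extending (n := n) (by simp) hvli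
  obtain ⟨τ, F, hst⟩ := HF.exists_taylor b
  set c : ℕ → ℕ := fun m => Module.finrank k (purePart k p J m) with hc
  have hcl : ∀ l : Fin N, expo p c l = p ^ e l := fun l => expo_of_forall fun m => by
    rw [hc]
    simp only [L.finrank_purePart]
    exact lt_card_filter_iff L.monotone l m
  have hcN : ∀ i, N ≤ i → expo p c i = 0 := fun i hi => by
    rw [expo, dif_neg]
    rintro ⟨m, hm⟩
    rw [hc] at hm
    simp only [L.finrank_purePart] at hm
    have := Fintype.card_subtype_le fun l : Fin N => e l ≤ m
    rw [Fintype.card_fin] at this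
    omega
  -- The coordinates beyond the first `N` have exponent zero, and `h` is padded by zero there.
  set h' : Fin n → A := fun i => if hi : (i : ℕ) < N then h ⟨i, hi⟩ else 0 with hh'
  have hcase : ∀ i : Fin n, (∃ l : Fin N, i = Fin.castLE hN l) ∨ N ≤ (i : ℕ) := fun i => by
    rcases lt_or_ge (i : ℕ) N with hi | hi
    · exact Or.inl ⟨⟨i, hi⟩, rfl⟩
    · exact Or.inr hi
  have hhl : ∀ l : Fin N, h' (Fin.castLE hN l) = h l := fun l => by simp [hh']
  have hhN : ∀ i : Fin n, N ≤ (i : ℕ) → h' i = 0 := fun i hi => by simp [hh', not_lt.2 hi]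
  refine ⟨_, h', τ, F, hst, ⟨fun i hi => ?_, fun i hi => ?_⟩, fun i => ?_, ?_, ?_⟩
  · rcases hcase i with ⟨l, rfl⟩ | hi'
    · rw [Fin.val_castLE, hcl] at hi
      exact absurd hi (pow_pos (expChar_pos k p) _).ne'
    · exact hhN i hi'
  · rcases hcase i with ⟨l, rfl⟩ | hi'
    · rw [Fin.val_castLE, hcl, hhl, hb]
      exact hh l
    · exact absurd (hcN _ hi') hi
  · rcases hcase i with ⟨l, rfl⟩ | hi'
    · rw [Fin.val_castLE, hcl, hhl]
      exact L.mem_level l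
    · rw [hhN i hi']; exact Ideal.zero_mem _
  · refine le_antisymm (Ideal.span_le.2 ?_) (Ideal.span_le.2 ?_)
    · rintro _ ⟨i, rfl⟩
      rcases hcase i with ⟨l, rfl⟩ | hi'
      · rw [hhl]; exact Ideal.subset_span ⟨l, rfl⟩
      · rw [hhN i hi']; exact Ideal.zero_mem _
    · rintro _ ⟨l, rfl⟩
      rw [← hhl]; exact Ideal.subset_span ⟨_, rfl⟩
  · -- The linear part `w` of `u` is a pure form, hence lies in the span of the `v_l`, `e_l ≤ m`.
    intro m u f hu hf hfu i hi
    obtain ⟨w, hw⟩ := F₀.exists_sub_linear_mem hu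
    have h1 := pow_sub_pow_mem (n := 1) (m := p ^ m) (by simpa using hu) hw
    rw [mul_one] at h1
    have h2 : toJet k A (p ^ m) (Fintype.linearCombination k s w ^ p ^ m) ∈ purePart k p J m :=
      (F₀.mem_purePart_iff p J).2 ⟨w, ⟨f, hf, by
        have := Ideal.add_mem _ hfu h1
        rwa [sub_add_sub_cancel] at this⟩, rfl⟩
    rw [← L.span_eq m] at h2
    simp_rw [hpow] at h2
    obtain ⟨w', hw', hww⟩ := (mem_span_range_pow_iff p
      (v := fun l : {l // e l ≤ m} => v l)).1 h2
    have h3 : w' - w = 0 := by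
      have : ExpChar A p := expChar_of_injective_algebraMap (algebraMap k A).injective p
      refine F₀.eq_zero_of_linear_pow_mem p (e := m) ?_
      rw [map_sub, sub_pow_expChar_pow]
      exact toJet_eq_iff.1 hww
    obtain rfl : w' = w := sub_eq_zero.1 h3
    have h4 : (b.repr w') i = 0 := by
      have h5 : w' ∈ Submodule.span k (b '' {i | expo p c i ∣ p ^ m}) := by
        refine Submodule.span_mono ?_ hw'
        rintro _ ⟨l, rfl⟩
        refine ⟨Fin.castLE hN l, ?_, hb l⟩
        change expo p c _ ∣ _
        rw [Fin.val_castLE, hcl]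
        exact pow_dvd_pow p l.2
      by_contra hne
      exact hi (b.mem_span_image.1 h5 (Finsupp.mem_support_iff.2 hne))
    have h6 := coeff_sum_smul_sub_mem F (b.repr w') i
    rw [h4, map_zero, sub_zero] at h6
    have h7 : ∑ j, b.repr w' j • Fintype.linearCombination k s (b j) =
        Fintype.linearCombination k s w' := by
      conv_rhs => rw [← b.sum_repr w', map_sum]
      simp_rw [map_smul]
    rw [h7] at h6
    have h8 := Ideal.pow_le_self (by simp) (F.coeff_mem_pow hw (Finsupp.single i 1))
    rw [map_sub, map_sub] at h8
    simpa using Ideal.add_mem _ h8 h6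

/-- The colengths of the levels modulo the next power of `𝔪` count the missing monomials. -/
theorem HasFrames.finrank_quotient_level (hprop : J.IsProper) (m : ℕ) :
    Module.Finite k (A ⧸ (J.level m ⊔ maximalIdeal A ^ (m + 1))) ∧
    Module.finrank k (A ⧸ (J.level m ⊔ maximalIdeal A ^ (m + 1))) =
      {D : Fin n →₀ ℕ | D.degree ≤ m ∧ D ∉ goodExponents
        (fun i : Fin n => expo p (fun m => Module.finrank k (purePart k p J m)) i) m}.ncard := by
  obtain ⟨x, h', τ, F, hst, H, hJ, -, hpure⟩ := HF.exists_adapted L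
  set q : Fin n → ℕ := fun i => expo p (fun m => Module.finrank k (purePart k p J m)) i
  have hb := H.isTriangular F.x_mem
  refine hb.finrank_quotient F (M := m + 1) le_sup_right (fun D hD => Nat.lt_succ_of_le hD.1)
    (fun D hD => ?_) fun f hf => ?_
  · rcases Nat.lt_or_ge m D.degree with hm | hm
    · exact Ideal.mem_sup_right (Ideal.pow_le_pow_right hm (hb.mem_pow F.x_mem D))
    · have hgood : D ∈ goodExponents q m := by
        by_contra hne; exact hD ⟨hm, hne⟩
      refine Ideal.mem_sup_left (Ideal.mul_mem_left _ _ ?_)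
      refine J.mem_level_of_le (le_of_eq ?_) (J.prod_pow_mem_level h' _ hJ (expQuo q D))
      have hrem : expRem q D = 0 := by
        ext i; simpa using Nat.mod_eq_zero_of_dvd (hgood.2 i)
      have h1 := hgood.1
      rw [degree_eq_expRem_add q D, hrem, map_zero, zero_add] at h1
      rw [← h1, Finsupp.degree_eq_sum]
      push_cast
      simp [mul_comm, q]
  · obtain ⟨g, hg, r, hr, rfl⟩ := Submodule.mem_sup.1 hf
    have hgm : g ∈ maximalIdeal A ^ m := by simpa using hprop.level_le_pow F hst m hg
    obtain ⟨c, hc, hgc⟩ := hb.exists_expand_step F hgm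
    refine mem_spanMod.2 ⟨c, fun D hD => ?_, ?_⟩
    · rintro ⟨-, hbad⟩
      have hdeg := hc D hD
      have h1 : ∃ i, ¬ q i ∣ D i := by
        by_contra! hall; exact hbad ⟨hdeg, hall⟩
      have h2 := coeff_mem_of_not_dvd F p H (fun i => expo_eq_zero_or _ _ _) hst hprop hJ hpure m
        hg hdeg h1
      have h3 := Ideal.pow_le_self (by omega) (F.coeff_mem_pow hgc D)
      have h4 := hb.coeff_linearCombination_sub_mem F c (J := D) fun D' hD' => by
        by_contra hne; have := hc D' hne; omega
      rw [map_sub, map_sub] at h3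
      have h5 := Ideal.sub_mem _ h2 (Ideal.add_mem _ h3 h4)
      rw [sub_add_sub_cancel, sub_sub_cancel, algebraMap_mem_maximalIdeal_iff] at h5
      exact hD h5
    · rw [add_sub_right_comm]
      exact Ideal.add_mem _ hgc hr

omit HF in
/-- If some positive level contains a unit, then `μ = 0`, as the `h_l` are non-units. -/
lemma IsLGS.muMod_eq_zero (hJ : ¬ J.IsProper) : muMod J h = 0 :=
  muMod_eq_zero_of_not_isProper hJ fun l =>
    Ideal.pow_le_self (pow_pos (expChar_pos k p) _).ne' (L.mem_pow l)

/-- For `ν > 1` the inequality `μ ≥ ν` is a condition on colengths which does not involve the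
leading generator system. -/
theorem HasFrames.ofReal_le_muMod_iff {ν : ℝ} (hν : 1 < ν) :
    ENNReal.ofReal ν ≤ muMod J h ↔ ∀ a,
      {D : Fin n →₀ ℕ | weight
        (fun i : Fin n => expo p (fun m => Module.finrank k (purePart k p J m)) i) ν D < a}.ncard ≤
        Module.finrank k (A ⧸ (J.enlarge ν).level a) := by
  obtain ⟨x, h', τ, F, hst, H, hJ, hspan, -⟩ := HF.exists_adapted L
  rw [IdealisticFiltration.ofReal_le_muMod_iff J h (zero_le_one.trans hν.le), ← hspan]
  exact level_le_iff_ncard_le F H hst hJ hν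

/-- The invariant `μ` does not depend on the leading generator system. -/
theorem HasFrames.muMod_eq {N' : ℕ} {h' : Fin N' → A} {e' : Fin N' → ℕ}
    (L' : IsLGS k p J h' e') : muMod J h = muMod J h' := by
  by_cases hprop : J.IsProper
  · -- Both values are at least one, and they exceed the same real numbers `ν > 1`.
    have key : ∀ ν : ℝ, 1 ≤ ν → (ENNReal.ofReal ν ≤ muMod J h ↔ ENNReal.ofReal ν ≤ muMod J h') := by
      intro ν hν
      rcases hν.eq_or_lt with rfl | hν
      · simp [HF.one_le_muMod hprop h, HF.one_le_muMod hprop h']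
      · rw [HF.ofReal_le_muMod_iff L hν, HF.ofReal_le_muMod_iff L' hν]
    have aux : ∀ x y : ENNReal, 1 ≤ x → (∀ ν : ℝ, 1 ≤ ν →
        (ENNReal.ofReal ν ≤ x → ENNReal.ofReal ν ≤ y)) → x ≤ y := by
      intro x y hx hxy
      refine ENNReal.le_of_forall_nnreal_lt fun r hr => ?_
      have hmax : ENNReal.ofReal (max 1 (r : ℝ)) = max 1 (r : ENNReal) := by
        rw [ENNReal.ofReal_mono.map_max, ENNReal.ofReal_one, ENNReal.ofReal_coe_nnreal]
      have h1 := hxy (max 1 r) (le_max_left _ _) (by rw [hmax]; exact max_le hx hr.le)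
      rw [hmax] at h1
      exact (le_max_right _ _).trans h1
    exact le_antisymm (aux _ _ (HF.one_le_muMod hprop h) fun ν hν => (key ν hν).1)
      (aux _ _ (HF.one_le_muMod hprop h') fun ν hν => (key ν hν).2)
  · rw [L.muMod_eq_zero hprop, L'.muMod_eq_zero hprop]

end LGS


/-! ### Semicontinuity of colengths -/

section MixedIdeal

open TensorProduct

variable {k R S S' : Type*} [Field k] [CommRing R] [CommRing S] [CommRing S'] [Algebra k R]

/-- The ideal `∑ (f) 𝔞 ^ j`, the sum over the pairs `(f, j)` in a finite set. -/
def mixedIdeal (G : Finset (R × ℕ)) (u : R →+* S) (𝔞 : Ideal S) : Ideal S :=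
  ⨆ x ∈ G, Ideal.span {u x.1} * 𝔞 ^ x.2

lemma map_mixedIdeal (G : Finset (R × ℕ)) (u : R →+* S) (v : S →+* S') (𝔞 : Ideal S) :
    (mixedIdeal G u 𝔞).map v = mixedIdeal G (v.comp u) (𝔞.map v) := by
  simp [mixedIdeal, Ideal.map_iSup, Ideal.map_mul, Ideal.map_pow, Ideal.map_span]

lemma pow_le_mixedIdeal {G : Finset (R × ℕ)} {M : ℕ} (hM : (1, M) ∈ G) (u : R →+* S)
    (𝔞 : Ideal S) : 𝔞 ^ M ≤ mixedIdeal G u 𝔞 := by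
  refine le_trans ?_ (le_iSup₂_of_le (1, M) hM le_rfl)
  simp

/-- The residue field at a closed point of a variety over an algebraically closed field. -/
lemma exists_algHom_ker_eq [IsAlgClosed k] [Algebra.FiniteType k R] (P : Ideal R) [P.IsMaximal] :
    ∃ χ : R →ₐ[k] k, RingHom.ker χ = P := by
  let _ := Ideal.Quotient.field P
  have : Module.Finite k (R ⧸ P) := finite_of_finite_type_of_isJacobsonRing k (R ⧸ P)
  set φ : k ≃ₐ[k] R ⧸ P := AlgEquiv.ofBijective (Algebra.ofId k (R ⧸ P))
    IsAlgClosed.algebraMap_bijective_of_isIntegral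
  refine ⟨φ.symm.toAlgHom.comp (Ideal.Quotient.mkₐ k P), ?_⟩
  ext f
  rw [RingHom.mem_ker]
  simp [Ideal.Quotient.eq_zero_iff_mem]

/-- Evaluation of the first factor of `R ⊗ R` at a closed point. -/
noncomputable def evalLeft (χ : R →ₐ[k] k) : R ⊗[k] R →ₐ[k] R :=
  Algebra.TensorProduct.lift ((Algebra.ofId k R).comp χ) (AlgHom.id k R) fun _ _ => Commute.all _ _

@[simp]
lemma evalLeft_tmul (χ : R →ₐ[k] k) (a b : R) : evalLeft χ (a ⊗ₜ b) = χ a • b := by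
  simp [evalLeft, Algebra.ofId_apply, Algebra.smul_def]

/-- At a closed point the ideal of the diagonal specializes to the maximal ideal. -/
lemma map_evalLeft_ideal (χ : R →ₐ[k] k) :
    (KaehlerDifferential.ideal k R).map (evalLeft χ).toRingHom = RingHom.ker χ := by
  rw [← KaehlerDifferential.span_range_eq_ideal, Ideal.map_span]
  refine le_antisymm (Ideal.span_le.2 ?_) fun f hf => ?_
  · rintro _ ⟨_, ⟨f, rfl⟩, rfl⟩
    simp [RingHom.mem_ker, Algebra.smul_def]
  · refine Ideal.subset_span ⟨_, ⟨f, rfl⟩, ?_⟩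
    rw [RingHom.mem_ker] at hf
    simp [show χ f = 0 from hf]

/-- The kernel of evaluation at a closed point is generated by its maximal ideal. -/
lemma sub_evalLeft_mem (χ : R →ₐ[k] k) (z : R ⊗[k] R) :
    z - 1 ⊗ₜ evalLeft χ z ∈ RingHom.ker χ • (⊤ : Submodule R (R ⊗[k] R)) := by
  induction z with
  | zero => simp
  | tmul a b =>
    have h : a ⊗ₜ[k] b - 1 ⊗ₜ evalLeft χ (a ⊗ₜ b) =
        (a - algebraMap k R (χ a)) • ((1 : R) ⊗ₜ[k] b) := by
      rw [evalLeft_tmul, sub_smul, TensorProduct.smul_tmul', TensorProduct.smul_tmul',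
        TensorProduct.tmul_smul, TensorProduct.smul_tmul']
      simp [Algebra.smul_def]
    rw [h]
    exact Submodule.smul_mem_smul (by simp [RingHom.mem_ker]) trivial
  | add x y hx hy =>
    rw [map_add, TensorProduct.tmul_add, add_sub_add_comm]
    exact Submodule.add_mem _ hx hy

variable [Algebra.FiniteType k R]

/-- The algebra of principal parts is finite over the left factor: it is an extension of `R` by a
finitely generated nilpotent ideal. -/
lemma finite_quotient_ideal_pow (M : ℕ) :
    Module.Finite R ((R ⊗[k] R) ⧸ KaehlerDifferential.ideal k R ^ M) := by
  have : Algebra.FiniteType k (R ⊗[k] R) :=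
    Algebra.FiniteType.trans (S := R) inferInstance inferInstance
  have : IsNoetherianRing (R ⊗[k] R) := Algebra.FiniteType.isNoetherianRing k _
  set Δ := KaehlerDifferential.ideal k R with hΔ
  rcases Nat.eq_zero_or_pos M with rfl | hM
  · have : Subsingleton ((R ⊗[k] R) ⧸ Δ ^ 0) := by
      rw [pow_zero]; exact Ideal.Quotient.subsingleton_iff.2 Ideal.one_eq_top
    infer_instance
  set μ : R ⊗[k] R →ₐ[R] R := Algebra.TensorProduct.lmul'' k (S := R)
  have hker : ∀ z, z ∈ Δ ↔ μ z = 0 := fun z => Iff.rfl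
  set f : ((R ⊗[k] R) ⧸ Δ ^ M) →ₐ[R] R := Ideal.Quotient.liftₐ (Δ ^ M) μ fun z hz =>
    (hker z).1 (Ideal.pow_le_self hM.ne' hz)
  have hf : ∀ z, f (Ideal.Quotient.mk _ z) = μ z := fun z => rfl
  refine Module.finite_of_surjective_of_ker_le_nilradical f (fun r => ?_) ?_
    (IsNoetherian.noetherian _)
  · exact ⟨algebraMap R _ r, by simp⟩
  · intro z hz
    obtain ⟨z, rfl⟩ := Ideal.Quotient.mk_surjective z
    rw [RingHom.mem_ker] at hz
    have hz' : z ∈ Δ := (hker z).2 (by rw [← hf]; exact hz)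
    refine ⟨M, ?_⟩
    rw [← map_pow]
    exact Ideal.Quotient.eq_zero_iff_mem.2 (Ideal.pow_mem_pow hz' M)

/-- Upper semicontinuity of the colength of an ideal depending on a closed point: the ideals at
all closed points are the fibres of one module which is finite over the left factor of `R ⊗ R`. -/
theorem exists_finrank_quotient_mixedIdeal_le [IsAlgClosed k] {G : Finset (R × ℕ)} {M : ℕ}
    (hM : (1, M) ∈ G) (P : Ideal R) [P.IsMaximal]
    (hfin : Module.Finite k (R ⧸ mixedIdeal G (RingHom.id R) P)) :
    ∃ g ∉ P, ∀ (Q : Ideal R) [Q.IsMaximal], g ∉ Q →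
      Module.Finite k (R ⧸ mixedIdeal G (RingHom.id R) Q) ∧
      Module.finrank k (R ⧸ mixedIdeal G (RingHom.id R) Q) ≤
        Module.finrank k (R ⧸ mixedIdeal G (RingHom.id R) P) := by
  set Δ := KaehlerDifferential.ideal k R with hΔ
  set K : Ideal (R ⊗[k] R) := mixedIdeal G
    (Algebra.TensorProduct.includeRight (R := k) (A := R) (B := R)).toRingHom Δ with hK
  have hmap : ∀ χ : R →ₐ[k] k, K.map (evalLeft χ).toRingHom =
      mixedIdeal G (RingHom.id R) (RingHom.ker χ) := by
    intro χ
    rw [hK, map_mixedIdeal, map_evalLeft_ideal]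
    congr 1
    ext r
    simp
  have hsurj : ∀ χ : R →ₐ[k] k, Function.Surjective (evalLeft χ).toRingHom := fun χ f =>
    ⟨1 ⊗ₜ f, by simp⟩
  obtain ⟨χ, rfl⟩ := exists_algHom_ker_eq (k := k) P
  set c := Module.finrank k (R ⧸ mixedIdeal G (RingHom.id R) (RingHom.ker χ)) with hc
  set b := Module.finBasis k (R ⧸ mixedIdeal G (RingHom.id R) (RingHom.ker χ))
  choose β hβ using fun i => Ideal.Quotient.mk_surjective (b i)
  -- Lifts of a basis of the fibre generate the module near the point by Nakayama's lemma.
  set B : Submodule R (R ⊗[k] R) :=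
    Submodule.span R (Set.range fun i => (1 : R) ⊗ₜ[k] β i) ⊔ K.restrictScalars R with hB
  have hfinB : Module.Finite R ((R ⊗[k] R) ⧸ B) := by
    have : Module.Finite R ((R ⊗[k] R) ⧸ (Δ ^ M).restrictScalars R) :=
      finite_quotient_ideal_pow (k := k) (R := R) M
    have hle : (Δ ^ M).restrictScalars R ≤ B :=
      (show (Δ ^ M).restrictScalars R ≤ K.restrictScalars R from
        pow_le_mixedIdeal hM _ _).trans le_sup_right
    exact Module.Finite.of_surjective (Submodule.factor hle) (Submodule.factor_surjective hle)
  have htop : (⊤ : Submodule R ((R ⊗[k] R) ⧸ B)) ≤ RingHom.ker χ • ⊤ := by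
    have h1 : B ⊔ RingHom.ker χ • (⊤ : Submodule R (R ⊗[k] R)) = ⊤ := by
      refine Submodule.eq_top_iff'.2 fun z => ?_
      have h2 := b.sum_repr (Ideal.Quotient.mk _ (evalLeft χ z))
      set r := b.repr (Ideal.Quotient.mk _ (evalLeft χ z)) with hr
      have h3 : evalLeft χ z - ∑ i, r i • β i ∈
          mixedIdeal G (RingHom.id R) (RingHom.ker χ) := by
        rw [← Ideal.Quotient.eq, ← h2, map_sum]
        refine sum_congr rfl fun i _ => ?_
        rw [← hβ, Algebra.smul_def, Algebra.smul_def, map_mul]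
        rfl
      obtain ⟨κ, hκ, hκe⟩ := (Ideal.mem_map_iff_of_surjective _ (hsurj χ)).1 ((hmap χ).ge h3)
      have h4 := sub_evalLeft_mem χ (z - κ)
      have h5 : evalLeft χ (z - κ) = ∑ i, r i • β i := by
        rw [map_sub, sub_eq_iff_eq_add', ← sub_eq_iff_eq_add]
        exact hκe.symm
      rw [h5] at h4
      have h6 : (1 : R) ⊗ₜ[k] (∑ i, r i • β i) ∈ B := by
        rw [TensorProduct.tmul_sum]
        refine Submodule.sum_mem _ fun i _ => Submodule.mem_sup_left ?_
        rw [TensorProduct.tmul_smul]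
        exact Submodule.smul_of_tower_mem _ _ (Submodule.subset_span ⟨i, rfl⟩)
      have h7 : z = (κ + (1 : R) ⊗ₜ[k] (∑ i, r i • β i)) +
          (z - κ - (1 : R) ⊗ₜ[k] (∑ i, r i • β i)) := by ring
      rw [h7]
      exact Submodule.add_mem_sup (B.add_mem (Submodule.mem_sup_right hκ) h6) h4
    have h2 := congrArg (Submodule.map B.mkQ) h1
    rw [Submodule.map_sup, Submodule.map_smul'', Submodule.map_top, Submodule.range_mkQ,
      Submodule.mkQ_map_self, bot_sup_eq] at h2
    exact h2.ge
  obtain ⟨g, hg1, hg⟩ := Submodule.exists_sub_one_mem_and_smul_eq_zero_of_fg_of_le_smul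
    (RingHom.ker χ) ⊤ Module.Finite.fg_top htop
  refine ⟨g, fun hgP => ?_, fun Q _ hgQ => ?_⟩
  · have h1 : (1 : R) ∈ RingHom.ker χ := by
      have := Ideal.sub_mem _ hgP hg1
      rwa [sub_sub_cancel] at this
    simp [RingHom.mem_ker] at h1
  obtain ⟨ψ, rfl⟩ := exists_algHom_ker_eq (k := k) Q
  have hψ : ψ g ≠ 0 := hgQ
  have hspan : ⊤ ≤ Submodule.span k (Set.range fun i : Fin c =>
      (Ideal.Quotient.mk (mixedIdeal G (RingHom.id R) (RingHom.ker ψ)) (β i))) := by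
    intro y _
    obtain ⟨f, rfl⟩ := Ideal.Quotient.mk_surjective y
    have h1 : g • ((1 : R) ⊗ₜ[k] f) ∈ B := by
      rw [← Submodule.Quotient.mk_eq_zero, Submodule.Quotient.mk_smul]
      exact hg _ trivial
    obtain ⟨s, hs, κ, hκ, hsκ⟩ := Submodule.mem_sup.1 h1
    obtain ⟨a, rfl⟩ := (Submodule.mem_span_range_iff_exists_fun R).1 hs
    have h2 := congrArg (evalLeft ψ) hsκ
    rw [TensorProduct.smul_tmul', smul_eq_mul, mul_one, evalLeft_tmul, map_add, map_sum] at h2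
    simp_rw [TensorProduct.smul_tmul', smul_eq_mul, mul_one, evalLeft_tmul] at h2
    have h3 : evalLeft ψ κ ∈ mixedIdeal G (RingHom.id R) (RingHom.ker ψ) := by
      rw [← hmap]; exact Ideal.mem_map_of_mem _ hκ
    have h4 : Ideal.Quotient.mk (mixedIdeal G (RingHom.id R) (RingHom.ker ψ)) (ψ g • f) =
        ∑ i, ψ (a i) • Ideal.Quotient.mk _ (β i) := by
      rw [← h2, map_add, Ideal.Quotient.eq_zero_iff_mem.2 h3, add_zero, map_sum]
      rfl
    have h5 : Ideal.Quotient.mk (mixedIdeal G (RingHom.id R) (RingHom.ker ψ)) f =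
        (ψ g)⁻¹ • Ideal.Quotient.mk _ (ψ g • f) := by
      change _ = Ideal.Quotient.mk _ ((ψ g)⁻¹ • ψ g • f)
      rw [inv_smul_smul₀ hψ]
    rw [h5, h4]
    exact Submodule.smul_mem _ _ (Submodule.sum_mem _ fun i _ =>
      Submodule.smul_mem _ _ (Submodule.subset_span ⟨i, rfl⟩))
  have hspan' := top_le_iff.1 hspan
  classical
  refine ⟨⟨⟨univ.image fun i : Fin c => Ideal.Quotient.mk _ (β i), by simpa using hspan'⟩⟩, ?_⟩
  have h1 := finrank_range_le_card (R := k) fun i : Fin c =>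
    (Ideal.Quotient.mk (mixedIdeal G (RingHom.id R) (RingHom.ker ψ)) (β i))
  rw [Set.finrank, hspan', finrank_top, Fintype.card_fin] at h1
  exact h1

end MixedIdeal

section LocalColength

variable {k R : Type*} [Field k] [CommRing R] [Algebra k R]

/-- An ideal which contains a power of the maximal ideal `P` has the same colength in `R` and
in the local ring at `P`. -/
lemma nonempty_quotient_linearEquiv (P : Ideal R) [P.IsMaximal] {K : Ideal R} {M : ℕ}
    (hK : P ^ M ≤ K) :
    Nonempty ((R ⧸ K) ≃ₗ[k] (Localization.AtPrime P ⧸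
      K.map (algebraMap R (Localization.AtPrime P)))) := by
  set A := Localization.AtPrime P
  set ψ : R →ₐ[k] A ⧸ K.map (algebraMap R A) :=
    (Ideal.Quotient.mkₐ k _).comp (IsScalarTower.toAlgHom k R A) with hψ
  have hval : ∀ r, ψ r = Ideal.Quotient.mk _ (algebraMap R A r) := fun r => rfl
  have hmM : maximalIdeal A ^ M ≤ K.map (algebraMap R A) := by
    rw [← Localization.AtPrime.map_eq_maximalIdeal, ← Ideal.map_pow]
    exact Ideal.map_mono hK
  have hker : RingHom.ker ψ = K := by
    ext f
    rw [RingHom.mem_ker, hval, Ideal.Quotient.eq_zero_iff_mem,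
      IsLocalization.algebraMap_mem_map_algebraMap_iff P.primeCompl]
    constructor
    · rintro ⟨t, ht, htf⟩
      have h1 : P ^ M ⊔ Ideal.span {t} = ⊤ := by
        have h2 : P ⊔ Ideal.span {t} = ⊤ := by
          by_contra hne
          have := (‹P.IsMaximal›.eq_of_le hne le_sup_left)
          exact ht (this ▸ Ideal.mem_sup_right (Ideal.mem_span_singleton_self t))
        exact Ideal.pow_sup_eq_top h2
      have h3 : (1 : R) ∈ P ^ M ⊔ Ideal.span {t} := h1 ▸ trivial
      obtain ⟨y, hy, z, hz, hyz⟩ := Submodule.mem_sup.1 h3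
      obtain ⟨w, rfl⟩ := Ideal.mem_span_singleton'.1 hz
      have h4 : f = y * f + w * (t * f) := by
        rw [← mul_assoc, ← add_mul, hyz, one_mul]
      rw [h4]
      exact Ideal.add_mem _ (Ideal.mul_mem_right _ _ (hK hy)) (Ideal.mul_mem_left _ _ htf)
    · intro hf
      exact ⟨1, P.primeCompl.one_mem, by simpa using hf⟩
  have hsurj : Function.Surjective ψ := by
    intro y
    obtain ⟨a, rfl⟩ := Ideal.Quotient.mk_surjective y
    obtain ⟨r', hr⟩ := (IsLocalization.AtPrime.equivQuotMaximalIdealPow P A M).surjective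
      (Ideal.Quotient.mk _ a)
    obtain ⟨r, rfl⟩ := Ideal.Quotient.mk_surjective r'
    rw [IsLocalization.AtPrime.equivQuotMaximalIdealPow_apply_mk] at hr
    exact ⟨r, Ideal.Quotient.eq.2 (hmM (Ideal.Quotient.eq.1 hr))⟩
  exact ⟨(Ideal.quotientEquivAlgOfEq k hker.symm).toLinearEquiv.trans
    (Ideal.quotientKerAlgEquivOfSurjective hsurj).toLinearEquiv⟩

/-- The levels of the enlarged filtrations at all points come from one finite set of pairs: only
the powers `𝔪 ^ j` with `j ≤ ⌈ν a⌉` matter, and the levels of `I` are finitely generated. -/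
lemma exists_enlarge_eq_mixedIdeal [IsNoetherianRing R] (I : IdealisticFiltration R) {ν : ℝ}
    (hν : 0 < ν) (a : ℝ) :
    ∃ (G : Finset (R × ℕ)) (M : ℕ), (1, M) ∈ G ∧ ∀ (P : Ideal R) [P.IsPrime],
      ((I.localize P).enlarge ν).level a =
        mixedIdeal G (algebraMap R (Localization.AtPrime P)) (maximalIdeal _) := by
  classical
  choose gens hgens using fun j : ℕ => (isNoetherianRing_iff_ideal_fg R).1 inferInstance
    (I.level (a - j / ν))
  set M := ⌈ν * a⌉₊ with hM
  have hMa : a ≤ M / ν := by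
    rw [le_div_iff₀ hν, mul_comm]; exact Nat.le_ceil _
  refine ⟨insert (1, M) ((range M).biUnion fun j => (gens j).image fun f => (f, j)), M,
    mem_insert_self _ _, fun P _ => le_antisymm ?_ ?_⟩
  · refine Ideal.span_le.2 ?_
    rintro _ ⟨b, j, f, hf, y, hy, hle, rfl⟩
    rcases Nat.lt_or_ge j M with hj | hj
    · have h1 := (I.localize P).mem_level_of_le (b := a - j / ν) (by linarith) hf
      have h2 : f * y ∈ Ideal.span (algebraMap R (Localization.AtPrime P) '' gens j) *
          maximalIdeal _ ^ j := by
        refine Ideal.mul_mem_mul ?_ hy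
        rw [← Ideal.map_span, hgens]
        exact h1
      refine Ideal.mul_le.2 (fun f' hf' y' hy' => ?_) h2
      refine Submodule.span_induction (p := fun f' _ => f' * y' ∈ _) ?_ (by simp)
        (fun _ _ _ _ h h' => by rw [add_mul]; exact Ideal.add_mem _ h h')
        (fun c _ _ h => by rw [smul_mul_assoc]; exact Ideal.mul_mem_left _ _ h) hf'
      rintro _ ⟨f, hf, rfl⟩
      refine (le_iSup₂_of_le (f, j) ?_ le_rfl : Ideal.span _ * _ ≤ mixedIdeal _ _ _)
        (Ideal.mul_mem_mul (Ideal.mem_span_singleton_self _) hy')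
      exact mem_insert_of_mem (mem_biUnion.2 ⟨j, mem_range.2 hj, mem_image.2 ⟨f, hf, rfl⟩⟩)
    · have hy' := pow_le_mixedIdeal (S := Localization.AtPrime P)
        (mem_insert_self (1, M) ((range M).biUnion fun j => (gens j).image fun f => (f, j)))
        (algebraMap R _) (maximalIdeal _) (Ideal.pow_le_pow_right hj hy)
      exact Ideal.mul_mem_left _ _ hy'
  · refine iSup₂_le fun x hx => ?_
    rcases mem_insert.1 hx with rfl | hx
    · refine Ideal.mul_le.2 fun f _ y hy => Ideal.mul_mem_left _ _ (pow_le_enlarge hMa hy)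
    · obtain ⟨j, -, hx⟩ := mem_biUnion.1 hx
      obtain ⟨f, hf, rfl⟩ := mem_image.1 hx
      refine Ideal.mul_le.2 fun f' hf' y hy => ?_
      obtain ⟨c, rfl⟩ := Ideal.mem_span_singleton'.1 hf'
      rw [mul_assoc]
      refine Ideal.mul_mem_left _ _ (mul_mem_enlarge (b := a - j / ν) ?_ hy (by linarith))
      exact Ideal.mem_map_of_mem (algebraMap R _) ((hgens j).le (Submodule.subset_span hf))

/-- The ideals `(I_P)_a + 𝔪 ^ M` at all points come from one finite set of pairs. -/
lemma exists_level_sup_eq_mixedIdeal [IsNoetherianRing R] (I : IdealisticFiltration R) (a : ℝ)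
    (M : ℕ) :
    ∃ G : Finset (R × ℕ), (1, M) ∈ G ∧ ∀ (P : Ideal R) [P.IsPrime],
      (I.localize P).level a ⊔ maximalIdeal _ ^ M =
        mixedIdeal G (algebraMap R (Localization.AtPrime P)) (maximalIdeal _) := by
  classical
  obtain ⟨gens, hgens⟩ := (isNoetherianRing_iff_ideal_fg R).1 inferInstance (I.level a)
  refine ⟨insert (1, M) (gens.image fun f => (f, 0)), mem_insert_self _ _, fun P _ =>
    le_antisymm (sup_le ?_ (pow_le_mixedIdeal (mem_insert_self _ _) _ _)) (iSup₂_le fun x hx => ?_)⟩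
  · change (I.level a).map _ ≤ _
    rw [← hgens, Ideal.map_span, Ideal.span_le]
    rintro _ ⟨f, hf, rfl⟩
    refine (le_iSup₂_of_le (f, 0) (mem_insert_of_mem (mem_image.2 ⟨f, hf, rfl⟩)) le_rfl :
      Ideal.span _ * _ ≤ mixedIdeal _ _ _) ?_
    simp
  · rcases mem_insert.1 hx with rfl | hx
    · simp
    · obtain ⟨f, hf, rfl⟩ := mem_image.1 hx
      refine le_sup_of_le_left ?_
      simp only [pow_zero, Ideal.one_eq_top, Ideal.mul_top, Ideal.span_singleton_le_iff_mem]
      exact Ideal.mem_map_of_mem _ (hgens.le (Submodule.subset_span hf))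

/-- Semicontinuity of colengths in the local rings at closed points. -/
lemma exists_finrank_quotient_le [IsAlgClosed k] [Algebra.FiniteType k R] {G : Finset (R × ℕ)}
    {M : ℕ} (hM : (1, M) ∈ G)
    (K : ∀ (P : Ideal R) [P.IsPrime], Ideal (Localization.AtPrime P))
    (hK : ∀ (P : Ideal R) [P.IsPrime], K P =
      mixedIdeal G (algebraMap R (Localization.AtPrime P)) (maximalIdeal _))
    (P : Ideal R) [P.IsMaximal] (hfin : Module.Finite k (Localization.AtPrime P ⧸ K P)) :
    ∃ g ∉ P, ∀ (Q : Ideal R) [Q.IsMaximal], g ∉ Q →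
      Module.Finite k (Localization.AtPrime Q ⧸ K Q) ∧
      Module.finrank k (Localization.AtPrime Q ⧸ K Q) ≤
        Module.finrank k (Localization.AtPrime P ⧸ K P) := by
  have key : ∀ (Q : Ideal R) [Q.IsMaximal], Nonempty
      ((R ⧸ mixedIdeal G (RingHom.id R) Q) ≃ₗ[k] (Localization.AtPrime Q ⧸ K Q)) := by
    intro Q _
    obtain ⟨φ⟩ := nonempty_quotient_linearEquiv (k := k) Q (pow_le_mixedIdeal hM (RingHom.id R) Q)
    rw [map_mixedIdeal, Localization.AtPrime.map_eq_maximalIdeal, RingHom.comp_id, ← hK Q] at φ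
    exact ⟨φ⟩
  obtain ⟨φ⟩ := key P
  obtain ⟨g, hg, hgQ⟩ := exists_finrank_quotient_mixedIdeal_le (k := k) hM P
    (Module.Finite.equiv φ.symm)
  refine ⟨g, hg, fun Q _ hQ => ?_⟩
  obtain ⟨ψ⟩ := key Q
  obtain ⟨h1, h2⟩ := hgQ Q hQ
  exact ⟨Module.Finite.equiv ψ, by rw [← ψ.finrank_eq, ← φ.finrank_eq]; exact h2⟩

end LocalColength


/-! ### Construction of Taylor homomorphisms -/

section Taylor

lemma isAdicComplete_pow {B : Type*} [CommRing B] (𝔞 : Ideal B) [IsAdicComplete 𝔞 B] {m : ℕ}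
    (hm : m ≠ 0) : IsAdicComplete (𝔞 ^ m) B := by
  have hle : ∀ n, (𝔞 ^ m) ^ n ≤ 𝔞 ^ n := fun n => by
    rw [← pow_mul]
    exact Ideal.pow_le_pow_right (Nat.le_mul_of_pos_left n (Nat.pos_of_ne_zero hm))
  have hiff : ∀ (𝔠 : Ideal B) (n : ℕ) (x y : B),
      x ≡ y [SMOD (𝔠 ^ n • ⊤ : Submodule B B)] ↔ x - y ∈ 𝔠 ^ n := fun 𝔠 n x y => by
    rw [SModEq.sub_mem, smul_eq_mul, Ideal.mul_top]
  refine { haus' := fun x hx => ?_, prec' := fun f hf => ?_ }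
  · refine IsHausdorff.haus' (I := 𝔞) x fun n => ?_
    exact (hiff _ _ _ _).2 (hle n ((hiff _ _ _ _).1 (hx n)))
  · obtain ⟨L, hL⟩ := IsPrecomplete.prec' (I := 𝔞) f fun {a b} hab =>
      (hiff _ _ _ _).2 (hle a ((hiff _ _ _ _).1 (hf hab)))
    refine ⟨L, fun n => (hiff _ _ _ _).2 ?_⟩
    have h1 := (hiff _ _ _ _).1 (hf (Nat.le_mul_of_pos_left n (Nat.pos_of_ne_zero hm)))
    have h2 := (hiff _ _ _ _).1 (hL (m * n))
    rw [pow_mul] at h2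
    simpa using Ideal.add_mem _ h1 h2

variable {k R ι : Type*} [Field k] [CommRing R] [Algebra k R]

/-- The elements of `(T) ^ m` have no terms of degree less than `m`. -/
lemma coeff_eq_zero_of_mem_span_X_pow {m : ℕ} {f : MvPowerSeries ι R}
    (hf : f ∈ Ideal.span (Set.range (MvPowerSeries.X (σ := ι) (R := R))) ^ m) {J : ι →₀ ℕ}
    (hJ : J.degree < m) : MvPowerSeries.coeff J f = 0 := by
  set Φ := adic (⊥ : Ideal R) 1 zero_le_one
  have h1 : Ideal.span (Set.range (MvPowerSeries.X (σ := ι) (R := R))) ≤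
      (Φ.powerSeries ι).level 1 := by
    refine Ideal.span_le.2 ?_
    rintro _ ⟨i, rfl⟩ J
    by_cases hJ : J = 0
    · subst hJ; simp
    · rw [level_of_nonpos]
      · trivial
      · have : 1 ≤ J.degree := Nat.one_le_iff_ne_zero.2 (mt (Finsupp.degree_eq_zero_iff J).1 hJ)
        have : (1 : ℝ) ≤ J.degree := by exact_mod_cast this
        linarith
  have h2 := level_pow_le _ _ _ (Ideal.pow_right_mono h1 m hf) J
  have h3 : ⌈(1 : ℝ) * (m * 1 - J.degree)⌉₊ ≠ 0 := by
    rw [Ne, Nat.ceil_eq_zero, not_le]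
    have : (J.degree : ℝ) < m := by exact_mod_cast hJ
    linarith
  rw [adic_level] at h2
  simpa using Ideal.pow_le_self h3 h2

/-- Prescribed derivations are the first coefficients of a Taylor homomorphism: infinitesimal
lifting extends the homomorphism `f ↦ f + ∑ D_i(f) T_i` modulo `T ^ 2` to power series. -/
theorem exists_taylor [Algebra.FormallySmooth k R] [Fintype ι] (D : ι → Derivation k R R) :
    ∃ τ : R →ₐ[k] MvPowerSeries ι R, (∀ f, MvPowerSeries.coeff 0 (τ f) = f) ∧
      ∀ i f, MvPowerSeries.coeff (Finsupp.single i 1) (τ f) = D i f := by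
  classical
  set 𝔞 := Ideal.span (Set.range (MvPowerSeries.X (σ := ι) (R := R))) with h𝔞
  have : IsAdicComplete (𝔞 ^ 2) (MvPowerSeries ι R) := isAdicComplete_pow 𝔞 two_ne_zero
  have hX : ∀ i, MvPowerSeries.X i ∈ 𝔞 := fun i => Ideal.subset_span ⟨i, rfl⟩
  set g : R →ₗ[k] MvPowerSeries ι R :=
    { toFun := fun f => MvPowerSeries.C f + ∑ i, MvPowerSeries.X i * MvPowerSeries.C (D i f)
      map_add' := fun f f' => by simp only [map_add, mul_add, sum_add_distrib]; ring
      map_smul' := fun c f => by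
        have hC : ∀ r : R, MvPowerSeries.C (σ := ι) (c • r) =
            algebraMap k (MvPowerSeries ι R) c * MvPowerSeries.C r := fun r => by
          rw [Algebra.smul_def, map_mul, MvPowerSeries.algebraMap_apply]
        simp only [Derivation.map_smul, hC, RingHom.id_apply, Algebra.smul_def (A :=
          MvPowerSeries ι R), mul_add, mul_sum]
        congr 1
        exact sum_congr rfl fun i _ => by ring } with hg
  have hgval : ∀ f, g f = MvPowerSeries.C f + ∑ i, MvPowerSeries.X i * MvPowerSeries.C (D i f) :=
    fun f => rfl
  have hsum : ∀ f, ∑ i, MvPowerSeries.X i * MvPowerSeries.C (D i f) ∈ 𝔞 := fun f =>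
    Ideal.sum_mem _ fun i _ => Ideal.mul_mem_right _ _ (hX i)
  set φ : R →ₐ[k] MvPowerSeries ι R ⧸ 𝔞 ^ 2 := AlgHom.ofLinearMap
    ((Ideal.Quotient.mkₐ k (𝔞 ^ 2)).toLinearMap ∘ₗ g)
    (by
      change Ideal.Quotient.mk _ (g 1) = 1
      rw [hgval]; simp)
    (fun f f' => by
      change Ideal.Quotient.mk _ (g (f * f')) =
        Ideal.Quotient.mk _ (g f) * Ideal.Quotient.mk _ (g f')
      rw [← map_mul, eq_comm, Ideal.Quotient.eq]
      have h1 : g f * g f' - g (f * f') =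
          (∑ i, MvPowerSeries.X i * MvPowerSeries.C (D i f)) *
            ∑ i, MvPowerSeries.X i * MvPowerSeries.C (D i f') := by
        have h2 : ∑ i, MvPowerSeries.X i * MvPowerSeries.C (D i (f * f')) =
            MvPowerSeries.C f * ∑ i, MvPowerSeries.X i * MvPowerSeries.C (D i f') +
            MvPowerSeries.C f' * ∑ i, MvPowerSeries.X i * MvPowerSeries.C (D i f) := by
          rw [mul_sum, mul_sum, ← sum_add_distrib]
          refine sum_congr rfl fun i _ => ?_
          rw [Derivation.leibniz, smul_eq_mul, smul_eq_mul, map_add, map_mul, map_mul]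
          ring
        simp only [hgval, h2, map_mul]
        ring
      rw [h1, pow_two]
      exact Ideal.mul_mem_mul (hsum f) (hsum f')) with hφ
  obtain ⟨τ, hτ⟩ := Algebra.FormallySmooth.exists_mkₐ_comp_eq_of_isAdicComplete φ
  have hmem : ∀ f, τ f - g f ∈ 𝔞 ^ 2 := fun f => Ideal.Quotient.eq.1 (congr($hτ f))
  refine ⟨τ, fun f => ?_, fun i f => ?_⟩
  · have h1 := coeff_eq_zero_of_mem_span_X_pow (hmem f) (J := 0) (by simp)
    rw [map_sub, sub_eq_zero] at h1
    rw [h1, hgval]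
    simp
  · have h1 := coeff_eq_zero_of_mem_span_X_pow (hmem f) (J := Finsupp.single i 1) (by simp)
    rw [map_sub, sub_eq_zero] at h1
    rw [h1, hgval, map_add, MvPowerSeries.coeff_C_of_ne_zero (by simp), zero_add, map_sum,
      Finset.sum_eq_single i]
    · rw [MvPowerSeries.coeff_mul_C, MvPowerSeries.coeff_index_single_X]
      simp
    · intro j _ hj
      rw [MvPowerSeries.coeff_mul_C, MvPowerSeries.coeff_index_single_X]
      simp [hj.symm]
    · simp

end Taylor

section DiffOp

variable {k R ι : Type*} [Field k] [CommRing R] [Algebra k R]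

lemma _root_.IsDiffOp.zero (n : ℕ) : IsDiffOp k n (0 : R →ₗ[k] R) := by
  induction n with
  | zero => intro r f; simp
  | succ n ih => intro r; simpa using ih

lemma _root_.IsDiffOp.add {n : ℕ} {D D' : R →ₗ[k] R} (h : IsDiffOp k n D) (h' : IsDiffOp k n D') :
    IsDiffOp k n (D + D') := by
  induction n generalizing D D' with
  | zero => intro r f; simp [h r f, h' r f, mul_add]
  | succ n ih =>
    intro r
    convert ih (h r) (h' r) using 1
    ext f; simp; ring

lemma _root_.IsDiffOp.mul_left {n : ℕ} {D : R →ₗ[k] R} (h : IsDiffOp k n D) (s : R) :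
    IsDiffOp k n (LinearMap.mulLeft k s ∘ₗ D) := by
  induction n generalizing D with
  | zero => intro r f; simp [h r f]; ring
  | succ n ih =>
    intro r
    convert ih (h r) using 1
    ext f; simp; ring

lemma _root_.IsDiffOp.sum {κ : Type*} {n : ℕ} (t : Finset κ) {D : κ → R →ₗ[k] R}
    (h : ∀ i ∈ t, IsDiffOp k n (D i)) : IsDiffOp k n (∑ i ∈ t, D i) :=
  sum_induction _ (IsDiffOp k n) (fun _ _ => IsDiffOp.add) (IsDiffOp.zero n) h

lemma _root_.IsDiffOp.succ {n : ℕ} {D : R →ₗ[k] R} (h : IsDiffOp k n D) : IsDiffOp k (n + 1) D := by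
  induction n generalizing D with
  | zero =>
    intro r
    have : D ∘ₗ LinearMap.mulLeft k r - LinearMap.mulLeft k r ∘ₗ D = 0 := by
      ext f; simp [h r f]
    rw [this]
    exact IsDiffOp.zero 0
  | succ n ih => intro r; exact ih (h r)

lemma _root_.IsDiffOp.mono {n m : ℕ} (hnm : n ≤ m) {D : R →ₗ[k] R} (h : IsDiffOp k n D) :
    IsDiffOp k m D := by
  induction m, hnm using Nat.le_induction with
  | base => exact h
  | succ m _ ih => exact ih.succ

/-- The coefficients of a Taylor homomorphism are differential operators. -/
lemma isDiffOp_coeff {τ : R →ₐ[k] MvPowerSeries ι R}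
    (h0 : ∀ f, MvPowerSeries.coeff 0 (τ f) = f) (J : ι →₀ ℕ) :
    IsDiffOp k J.degree ((MvPowerSeries.coeff J).restrictScalars k ∘ₗ τ.toLinearMap) := by
  classical
  induction hn : J.degree using Nat.strong_induction_on generalizing J with
  | _ n ih =>
  rcases Nat.eq_zero_or_pos n with rfl | hpos
  · obtain rfl := (Finsupp.degree_eq_zero_iff J).1 hn
    intro r f
    change MvPowerSeries.coeff 0 (τ (r * f)) = r * MvPowerSeries.coeff 0 (τ f)
    rw [h0, h0]
  obtain ⟨n, rfl⟩ : ∃ m, n = m + 1 := ⟨n - 1, by omega⟩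
  intro r
  -- By the Leibniz rule the commutator with `r` only involves operators of lower index.
  have h1 : ((MvPowerSeries.coeff J).restrictScalars k ∘ₗ τ.toLinearMap) ∘ₗ LinearMap.mulLeft k r -
      LinearMap.mulLeft k r ∘ₗ ((MvPowerSeries.coeff J).restrictScalars k ∘ₗ τ.toLinearMap) =
      ∑ y ∈ (antidiagonal J).erase (0, J), LinearMap.mulLeft k (MvPowerSeries.coeff y.1 (τ r)) ∘ₗ
        ((MvPowerSeries.coeff y.2).restrictScalars k ∘ₗ τ.toLinearMap) := by
    ext f
    have h2 : MvPowerSeries.coeff J (τ (r * f)) = r * MvPowerSeries.coeff J (τ f) +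
        ∑ y ∈ (antidiagonal J).erase (0, J),
          MvPowerSeries.coeff y.1 (τ r) * MvPowerSeries.coeff y.2 (τ f) := by
      rw [map_mul, MvPowerSeries.coeff_mul, ← add_sum_erase _ _ (a := ((0 : ι →₀ ℕ), J)) (by simp)]
      simp [h0]
    rw [LinearMap.sum_apply]
    exact sub_eq_of_eq_add' h2
  rw [h1]
  refine IsDiffOp.sum _ fun y hy => IsDiffOp.mul_left ?_ _
  obtain ⟨hy1, hy2⟩ := mem_erase.1 hy
  have hsum := mem_antidiagonal.1 hy2
  have hy0 : y.1 ≠ 0 := by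
    intro h
    rw [h, zero_add] at hsum
    exact hy1 (Prod.ext h hsum)
  have hdeg : y.1.degree + y.2.degree = n + 1 := by rw [← map_add, hsum, hn]
  have hy0' : 0 < y.1.degree := Nat.pos_of_ne_zero (mt (Finsupp.degree_eq_zero_iff _).1 hy0)
  exact (ih y.2.degree (by omega) y.2 rfl).mono (by omega)

/-- The coefficient of `T ^ J` is a differential operator of degree at most `|J|`. -/
lemma IsDSaturated.isStable {I : IdealisticFiltration R} (hI : I.IsDSaturated k)
    {τ : R →ₐ[k] MvPowerSeries ι R} (h0 : ∀ f, MvPowerSeries.coeff 0 (τ f) = f) :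
    I.IsStable τ := fun a f hf J => hI _ _ (isDiffOp_coeff h0 J) a f hf

end DiffOp

section Localize

variable {k R ι : Type*} [Field k] [CommRing R] [Algebra k R]

/-- A Taylor homomorphism extends to the local rings. -/
lemma exists_taylor_localization {τ : R →ₐ[k] MvPowerSeries ι R}
    (h0 : ∀ f, MvPowerSeries.coeff 0 (τ f) = f) (P : Ideal R) [P.IsPrime] :
    ∃ τ' : Localization.AtPrime P →ₐ[k] MvPowerSeries ι (Localization.AtPrime P),
      (∀ f J, MvPowerSeries.coeff J (τ' (algebraMap R _ f)) =
        algebraMap R _ (MvPowerSeries.coeff J (τ f))) ∧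
      (∀ f, MvPowerSeries.coeff 0 (τ' f) = f) ∧
      ∀ I : IdealisticFiltration R, I.IsStable τ → (I.localize P).IsStable τ' := by
  set A := Localization.AtPrime P
  set ψ : R →ₐ[k] MvPowerSeries ι A :=
    (MvPowerSeries.mapAlgHom (IsScalarTower.toAlgHom k R A)).comp τ with hψ
  have hψc : ∀ f J, MvPowerSeries.coeff J (ψ f) = algebraMap R A (MvPowerSeries.coeff J (τ f)) :=
    fun f J => rfl
  have hu : ∀ y : P.primeCompl, IsUnit (ψ y) := fun y => by
    rw [MvPowerSeries.isUnit_iff_constantCoeff]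
    rw [← MvPowerSeries.coeff_zero_eq_constantCoeff_apply, hψc, h0]
    exact IsLocalization.map_units A y
  set τ' : A →ₐ[k] MvPowerSeries ι A := IsLocalization.liftAlgHom (M := P.primeCompl) hu with hτ'
  have hval : ∀ f, τ' (algebraMap R A f) = ψ f := fun f => by
    rw [hτ', IsLocalization.liftAlgHom_apply]; exact IsLocalization.lift_eq hu f
  have hc : ∀ f J, MvPowerSeries.coeff J (τ' (algebraMap R A f)) =
      algebraMap R A (MvPowerSeries.coeff J (τ f)) := fun f J => by rw [hval, hψc]
  refine ⟨τ', hc, fun f => ?_, fun I hI a => ?_⟩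
  · have h1 : (MvPowerSeries.constantCoeff (σ := ι) (R := A)).comp τ'.toRingHom = RingHom.id A := by
      refine IsLocalization.ringHom_ext P.primeCompl (RingHom.ext fun r => ?_)
      have := hc r 0
      rw [h0, MvPowerSeries.coeff_zero_eq_constantCoeff_apply] at this
      simpa using this
    rw [MvPowerSeries.coeff_zero_eq_constantCoeff_apply]
    exact congr($h1 f)
  · have h1 : (I.level a).map (algebraMap R A) ≤
        (((I.localize P).powerSeries ι).level a).comap τ'.toRingHom := by
      refine Ideal.map_le_iff_le_comap.2 fun r hr J => ?_
      have h2 := Ideal.mem_map_of_mem (algebraMap R A) (hI a r hr J)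
      rw [← hc] at h2
      exact h2
    exact fun f hf => h1 hf

end Localize


/-! ### Local coordinates of a smooth algebra -/

section Coordinates

open KaehlerDifferential

variable {k R : Type*} [Field k] [CommRing R] [IsDomain R] [Algebra k R] [Algebra.Smooth k R]

/-- A smooth algebra has coordinates and dual derivations near every point. -/
lemma exists_coordinates (P : Ideal R) [P.IsPrime] :
    ∃ (s : Fin (Module.finrank R (Ω[R⁄k])) → R)
      (D' : Fin (Module.finrank R (Ω[R⁄k])) → Derivation k R R) (g : R), g ∉ P ∧
      (∀ i j, D' i (s j) = if i = j then g else 0) ∧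
      ∀ r, g • D k R r = ∑ i, D' i r • D k R (s i) := by
  classical
  set A := Localization.AtPrime P
  -- The differentials `da` generate the free module of differentials of the local ring; some of
  -- them form a basis, and `t ∉ P` clears the denominators of the dual basis.
  obtain ⟨κ, a, b, hb⟩ := Module.exists_basis_of_span_of_flat _
    (span_range_map_derivation_of_isLocalization k R A P.primeCompl)
  have : Module.Projective R (Ω[R⁄k]) := Algebra.FormallySmooth.projective_kaehlerDifferential
  have : Module.FinitePresentation R (Ω[R⁄k]) := Module.finitePresentation_of_projective R (Ω[R⁄k])
  have : Finite κ := Module.Finite.finite_basis b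
  let _ := Fintype.ofFinite κ
  let l₁ : (κ →₀ R) →ₗ[R] (κ →₀ A) := Finsupp.mapRange.linearMap (Algebra.linearMap R A)
  let l₂ : Ω[R⁄k] →ₗ[R] Ω[A⁄k] := map k k R A
  have hb' : ∀ i, b i = l₂ (D k R (a i)) := fun i => by simp [l₂, hb]
  have hle : P.primeCompl ≤ nonZeroDivisors R := P.primeCompl_le_nonZeroDivisors
  have hcard : Fintype.card κ = Module.finrank R (Ω[R⁄k]) := by
    rw [← Module.finrank_eq_card_basis b, IsLocalization.finrank_eq A P.primeCompl hle,
      IsLocalizedModule.finrank_eq P.primeCompl l₂ hle]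
  obtain ⟨h, t, ht⟩ := Module.FinitePresentation.exists_lift_of_isLocalizedModule P.primeCompl l₁
    (b.repr.toLinearMap.restrictScalars R ∘ₗ l₂)
  have hinj : Function.Injective (algebraMap R A) := IsLocalization.injective A hle
  have hval : ∀ ω i, algebraMap R A (h ω i) = algebraMap R A t * b.repr (l₂ ω) i := fun ω i => by
    have := congr($ht ω i)
    simpa [l₁, Submonoid.smul_def, Algebra.smul_def] using this
  have hl₂ : Function.Injective l₂ := by
    intro x y hxy
    obtain ⟨c, hc⟩ := (IsLocalizedModule.eq_iff_exists P.primeCompl l₂).1 hxy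
    exact smul_right_injective _ (nonZeroDivisors.ne_zero (hle c.2)) hc
  let φ : Fin (Module.finrank R (Ω[R⁄k])) ≃ κ := (Fintype.equivFinOfCardEq hcard).symm
  have hcomp : ∀ i r, (((Finsupp.lapply (φ i)).comp h).compDer (D k R)) r = h (D k R r) (φ i) :=
    fun i r => rfl
  refine ⟨fun i => a (φ i), fun i => ((Finsupp.lapply (φ i)).comp h).compDer (D k R), t, t.2,
    fun i j => hinj ?_, fun r => hl₂ ?_⟩
  · rw [hcomp, hval, ← hb', b.repr_self, Finsupp.single_apply]
    split_ifs with h1 h2 h2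
    · simp
    · exact absurd (φ.injective h1).symm h2
    · exact absurd (congrArg φ h2).symm h1
    · simp
  · rw [map_smul, map_sum]
    have hterm : ∀ i, l₂ ((((Finsupp.lapply (φ i)).comp h).compDer (D k R)) r • D k R (a (φ i))) =
        (t : R) • (b.repr (l₂ (D k R r)) (φ i) • b (φ i)) := fun i => by
      rw [map_smul, hcomp, ← hb', ← algebraMap_smul A (h (D k R r) (φ i)), hval, mul_smul,
        algebraMap_smul]
    rw [sum_congr rfl fun i _ => hterm i, ← smul_sum,
      φ.sum_comp (fun i => b.repr (l₂ (D k R r)) i • b i), b.sum_repr]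

omit [IsDomain R] [Algebra.Smooth k R] in
/-- The relation between differentials at a closed point. -/
lemma mul_sub_sum_mem_sq {ι : Type*} [Fintype ι] {s : ι → R} {D' : ι → Derivation k R R} {g : R}
    (h : ∀ r, g • D k R r = ∑ i, D' i r • D k R (s i)) (χ : R →ₐ[k] k) {u : R}
    (hu : u ∈ RingHom.ker χ) :
    g * u - ∑ i, D' i u * (s i - algebraMap k R (χ (s i))) ∈ RingHom.ker χ ^ 2 := by
  set P := RingHom.ker χ with hP
  have hmem : ∀ r, r - algebraMap k R (χ r) ∈ P := fun r => by simp [hP, RingHom.mem_ker]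
  let δ : R →ₗ[k] R ⧸ P ^ 2 := (Ideal.Quotient.mkₐ k (P ^ 2)).toLinearMap ∘ₗ
    (LinearMap.id - (Algebra.ofId k R).toLinearMap ∘ₗ χ.toLinearMap)
  have hδ : ∀ r, δ r = Ideal.Quotient.mk (P ^ 2) (r - algebraMap k R (χ r)) := fun r => rfl
  let δ' : Derivation k R (R ⧸ P ^ 2) := Derivation.mk' δ fun r r' => by
    have h1 : ∀ a b : R, a • Ideal.Quotient.mk (P ^ 2) b = Ideal.Quotient.mk (P ^ 2) (a * b) :=
      fun a b => rfl
    rw [hδ, hδ, hδ, h1, h1, ← map_add, Ideal.Quotient.eq]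
    have h2 := neg_mem (Ideal.mul_mem_mul (hmem r) (hmem r'))
    rw [← pow_two] at h2
    convert h2 using 1
    simp only [map_mul]
    ring
  have h3 := congrArg δ'.liftKaehlerDifferential (h u)
  simp only [map_smul, map_sum, Derivation.liftKaehlerDifferential_comp_D] at h3
  have h4 : ∀ (a r : R), a • δ' r = Ideal.Quotient.mk (P ^ 2) (a * (r - algebraMap k R (χ r))) :=
    fun a r => rfl
  simp_rw [h4] at h3
  rw [← map_sum, Ideal.Quotient.eq, show χ u = 0 from hu, map_zero, sub_zero] at h3
  exact h3

/-- The local rings at closed points have frames: translates of the coordinates generate `𝔪` by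
Nakayama's lemma, and the dual derivations, with `g` replaced by its value at the point, integrate
to Taylor homomorphisms. -/
theorem exists_hasFrames [IsAlgClosed k] {I : IdealisticFiltration R} (hI : I.IsDSaturated k)
    (P : Ideal R) [P.IsMaximal] :
    ∃ s : Fin (Module.finrank R (Ω[R⁄k])) → Localization.AtPrime P,
      HasFrames k (I.localize P) s := by
  set A := Localization.AtPrime P
  have : Algebra.FiniteType k R := inferInstance
  have : IsNoetherianRing R := Algebra.FiniteType.isNoetherianRing k R
  have : IsNoetherianRing A := IsLocalization.isNoetherianRing P.primeCompl A inferInstance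
  obtain ⟨χ, hχ⟩ := exists_algHom_ker_eq (k := k) P
  have hco := exists_coordinates (k := k) P
  generalize Module.finrank R (Ω[R⁄k]) = n at hco ⊢
  obtain ⟨s, D', g, hg, hD, hd⟩ := hco
  set s₀ : Fin n → R := fun i => s i - algebraMap k R (χ (s i)) with hs₀
  have hmapP : P.map (algebraMap R A) = maximalIdeal A := Localization.AtPrime.map_eq_maximalIdeal
  have hmemP : ∀ r, r - algebraMap k R (χ r) ∈ P := fun r => by
    rw [← hχ]; simp [RingHom.mem_ker]
  have hmem : ∀ r, r ∈ P → algebraMap R A r ∈ maximalIdeal A := fun r hr =>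
    hmapP ▸ Ideal.mem_map_of_mem _ hr
  have htower : ∀ c : k, algebraMap R A (algebraMap k R c) = algebraMap k A c := fun c =>
    (IsScalarTower.algebraMap_apply k R A c).symm
  have hres : ∀ f : A, ∃ c : k, f - algebraMap k A c ∈ maximalIdeal A := fun f => by
    obtain ⟨r', hr⟩ := (IsLocalization.AtPrime.equivQuotMaximalIdealPow P A 1).surjective
      (Ideal.Quotient.mk _ f)
    obtain ⟨r, rfl⟩ := Ideal.Quotient.mk_surjective r'
    rw [IsLocalization.AtPrime.equivQuotMaximalIdealPow_apply_mk, Ideal.Quotient.eq, pow_one] at hr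
    refine ⟨χ r, ?_⟩
    have h1 := hmem _ (hmemP r)
    rw [map_sub, htower] at h1
    have h2 := Ideal.sub_mem _ h1 hr
    convert h2 using 1; ring
  have hspan : Ideal.span (Set.range fun i => algebraMap R A (s₀ i)) = maximalIdeal A := by
    refine le_antisymm (Ideal.span_le.2 ?_) ?_
    · rintro _ ⟨i, rfl⟩
      exact hmem _ (hmemP _)
    · refine Submodule.le_of_le_smul_of_le_jacobson_bot (I := maximalIdeal A)
        (IsNoetherian.noetherian _) (IsLocalRing.maximalIdeal_le_jacobson _) ?_
      rw [← hmapP, Ideal.map_le_iff_le_comap]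
      intro u hu
      have h1 := Ideal.mem_map_of_mem (algebraMap R A)
        (mul_sub_sum_mem_sq hd χ (u := u) (hχ ▸ hu))
      rw [hχ, Ideal.map_pow, hmapP, pow_two] at h1
      have hunit : IsUnit (algebraMap R A g) := IsLocalization.map_units A (⟨g, hg⟩ : P.primeCompl)
      rw [Ideal.mem_comap, hmapP, ← Ideal.unit_mul_mem_iff_mem _ hunit, ← map_mul,
        ← sub_add_cancel (g * u) (∑ i, D' i u * s₀ i), map_add]
      refine Ideal.add_mem _ (Ideal.mem_sup_right h1) (Ideal.mem_sup_left ?_)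
      rw [map_sum]
      refine Ideal.sum_mem _ fun i _ => ?_
      rw [map_mul]
      exact Ideal.mul_mem_left _ _ (Ideal.subset_span ⟨i, rfl⟩)
  refine ⟨fun i => algebraMap R A (s₀ i), ⟨fun b => ?_⟩⟩
  have hχg : χ g ≠ 0 := fun h => hg (hχ ▸ h)
  -- The dual basis gives the derivations dual to the new coordinates.
  set E : Fin n → Derivation k R R := fun j =>
    ∑ l, ((χ g)⁻¹ * b.coord j (Pi.single l 1)) • D' l with hE
  have hElin : ∀ j v, E j (Fintype.linearCombination k s₀ v) =
      ((χ g)⁻¹ * b.coord j v) • g := by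
    intro j v
    have h1 : ∀ l i, D' l (s₀ i) = if l = i then g else 0 := fun l i => by
      rw [hs₀]; simp [hD]
    have h2 : v = ∑ l, v l • Pi.single l (1 : k) := by
      ext i; simp [Finset.sum_apply, Pi.single_apply]
    have hEsum : ∀ r, E j r = ∑ l, ((χ g)⁻¹ * b.coord j (Pi.single l 1)) • D' l r := fun r => by
      rw [hE]
      exact (congrFun (map_sum (Derivation.coeFnAddMonoidHom (R := k) (A := R) (M := R)) _ _)
        r).trans (Finset.sum_apply _ _ _)
    rw [Fintype.linearCombination_apply, hEsum]
    simp only [map_sum, Derivation.map_smul, h1, smul_ite,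
      smul_zero, sum_ite_eq, mem_univ, if_true]
    conv_rhs => rw [h2, map_sum, mul_sum, sum_smul]
    refine sum_congr rfl fun l _ => ?_
    rw [map_smul, smul_eq_mul, smul_smul]
    congr 1; ring
  obtain ⟨τ, hτ0, hτ1⟩ := exists_taylor E
  obtain ⟨τ', hc, h0, hst⟩ := exists_taylor_localization hτ0 P
  have hlin : ∀ v, Fintype.linearCombination k (fun i => algebraMap R A (s₀ i)) v =
      algebraMap R A (Fintype.linearCombination k s₀ v) := fun v => by
    simp only [Fintype.linearCombination_apply, map_sum, Algebra.smul_def, map_mul, htower]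
  refine ⟨τ', ⟨hres, ?_, h0, fun i j => ?_⟩, hst I (hI.isStable hτ0)⟩
  · rw [← hspan]
    refine le_antisymm (Ideal.span_le.2 ?_) (Ideal.span_le.2 ?_)
    · rintro _ ⟨i, rfl⟩
      change Fintype.linearCombination k _ _ ∈ _
      rw [Fintype.linearCombination_apply]
      exact Ideal.sum_mem _ fun l _ => Submodule.smul_of_tower_mem _ _ (Ideal.subset_span ⟨l, rfl⟩)
    · rintro _ ⟨l, rfl⟩
      have h2 : algebraMap R A (s₀ l) =
          Fintype.linearCombination k (fun i => algebraMap R A (s₀ i)) (Pi.single l (1 : k)) := by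
        simp
      change algebraMap R A (s₀ l) ∈ _
      rw [h2, ← b.sum_repr (Pi.single l (1 : k)), map_sum]
      refine Ideal.sum_mem _ fun i _ => ?_
      rw [map_smul]
      exact Submodule.smul_of_tower_mem _ _ (Ideal.subset_span ⟨i, rfl⟩)
  · rw [hlin, hc, hτ1, hElin, Algebra.smul_def, map_mul, htower, b.coord_apply, b.repr_self,
      Finsupp.single_apply]
    split_ifs with hij
    · have h1 := Ideal.mul_mem_left _ (algebraMap k A (χ g)⁻¹) (hmem _ (hmemP g))
      rw [map_sub, htower, mul_sub, ← map_mul (algebraMap k A), inv_mul_cancel₀ hχg, map_one] at h1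
      simpa using h1
    · simp

end Coordinates


/-! ### Dimension -/

section Dimension

open KaehlerDifferential

/-- Chains of primes lift along an integral extension by lying over and going up. -/
lemma ringKrullDim_le_of_isIntegral {R S : Type*} [CommRing R] [CommRing S] [Algebra R S]
    [Algebra.IsIntegral R S] [FaithfulSMul R S] : ringKrullDim R ≤ ringKrullDim S := by
  refine iSup_le fun l => ?_
  obtain ⟨P, -, hP, hcomap⟩ := Ideal.exists_ideal_over_prime_of_isIntegral
    (S := S) (RelSeries.head l).asIdeal ⊥ (by
      rw [show Ideal.comap (algebraMap R S) ⊥ = ⊥ from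
        (RingHom.injective_iff_ker_eq_bot _).1 (FaithfulSMul.algebraMap_injective R S)]
      exact bot_le)
  have : P.LiesOver (RelSeries.head l).asIdeal := ⟨hcomap.symm⟩
  obtain ⟨L, hL, -⟩ := Ideal.exists_ltSeries_of_hasGoingUp l P
  rw [← hL]
  exact le_iSup (fun L : LTSeries (PrimeSpectrum S) => (L.length : WithBot ℕ∞)) L

universe u v

variable {k : Type u} {R : Type v} [Field k] [CommRing R] [IsDomain R] [Algebra k R]

/-- The transcendence degree of an affine domain is at most its Krull dimension. -/
lemma trdeg_le_ringKrullDim [Algebra.FiniteType k R] {d : ℕ} (hd : ringKrullDim R = d) :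
    Algebra.trdeg k R ≤ d := by
  obtain ⟨s, g, hg, hint⟩ := exists_integral_inj_algHom_of_fg k R
  let _ := g.toRingHom.toAlgebra
  have : IsScalarTower k (MvPolynomial (Fin s) k) R := IsScalarTower.of_algebraMap_eq fun c =>
    (g.commutes c).symm
  have hInt : Algebra.IsIntegral (MvPolynomial (Fin s) k) R := ⟨hint⟩
  have : FaithfulSMul (MvPolynomial (Fin s) k) R := (faithfulSMul_iff_algebraMap_injective _ _).2 hg
  have h1 : ringKrullDim (MvPolynomial (Fin s) k) = s := by
    rw [MvPolynomial.ringKrullDim_of_isNoetherianRing, ringKrullDim_eq_zero_of_field]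
    simp
  have h2 : ringKrullDim (MvPolynomial (Fin s) k) ≤ ringKrullDim R := ringKrullDim_le_of_isIntegral
  rw [h1, hd] at h2
  have h3 := lift_trdeg_add_eq k (MvPolynomial (Fin s) k) R
  rw [trdeg_eq_zero (R := MvPolynomial (Fin s) k), MvPolynomial.trdeg_of_isDomain] at h3
  simp only [Cardinal.mk_fin, Cardinal.lift_natCast, Cardinal.lift_zero, add_zero] at h3
  have h4 : Algebra.trdeg k R = s := Cardinal.lift_injective (by rw [← h3]; simp)
  rw [h4]
  exact_mod_cast h2

/-- The coordinates of a frame are algebraically independent. -/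
lemma IsFrame.algebraicIndependent {A ι : Type*} [CommRing A] [Algebra k A] [IsLocalRing A]
    [Fintype ι] [DecidableEq ι] {x : ι → A} {τ : A →ₐ[k] MvPowerSeries ι A} (F : IsFrame x τ) :
    AlgebraicIndependent k x := by
  refine algebraicIndependent_iff.2 fun f hf => ?_
  have htri : IsTriangular x (mon x) := fun D => by simp
  have h1 : MvPolynomial.aeval x f =
      Finsupp.linearCombination k (mon x) (AddMonoidAlgebra.coeff f) := by
    rw [MvPolynomial.aeval_def, MvPolynomial.eval₂_eq', Finsupp.linearCombination_apply]
    exact sum_congr rfl fun D _ => (Algebra.smul_def _ _).symm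
  refine MvPolynomial.ext _ _ fun D => ?_
  exact htri.eq_zero_of_linearCombination_mem F (r := D.degree + 1)
    (by rw [← h1, hf]; exact zero_mem _) D (Nat.lt_succ_self _)

/-- The number of coordinates is at most the dimension: coordinates are algebraically
independent. -/
lemma finrank_kaehlerDifferential_le [IsAlgClosed k] [Algebra.Smooth k R] {d : ℕ}
    (hd : ringKrullDim R = d) : Module.finrank R (Ω[R⁄k]) ≤ d := by
  obtain ⟨P, hP⟩ := Ideal.exists_maximal R
  let I : IdealisticFiltration R := ⟨fun _ => ⊤, rfl, by simp, fun _ _ _ => le_rfl⟩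
  obtain ⟨s, hs⟩ := exists_hasFrames (k := k) (I := I)
    (fun _ _ _ _ _ _ => Submodule.mem_top) P
  obtain ⟨τ, F, -⟩ := hs.exists_frame
  have h1 := F.algebraicIndependent.lift_cardinalMk_le_trdeg
  have : Algebra.IsAlgebraic R (Localization.AtPrime P) :=
    IsLocalization.isAlgebraic _ P.primeCompl
  have : FaithfulSMul R (Localization.AtPrime P) :=
    (faithfulSMul_iff_algebraMap_injective _ _).2
      (IsLocalization.injective _ P.primeCompl_le_nonZeroDivisors)
  rw [← trdeg_add_eq k R (A := Localization.AtPrime P),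
    trdeg_eq_zero (R := R), add_zero] at h1
  have h2 : ((Module.finrank R (Ω[R⁄k]) : ℕ) : Cardinal.{v}) ≤ d := by
    simpa using h1.trans (Cardinal.lift_le.2 (trdeg_le_ringKrullDim (k := k) hd))
  exact_mod_cast h2

end Dimension


/-! ### Semi-continuity on the closed points -/

section ClosedPoints

open Filter Topology KaehlerDifferential

lemma eventually_notMem {R : Type*} [CommRing R] {P : MaximalSpectrum R} {g : R}
    (hg : g ∉ P.asIdeal) : ∀ᶠ Q : MaximalSpectrum R in 𝓝 P, g ∉ Q.asIdeal :=
  ((PrimeSpectrum.isOpen_basicOpen (a := g)).preimage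
    MaximalSpectrum.toPrimeSpectrum_continuous).mem_nhds hg

/-- The locus where some positive level contains a unit is open. -/
lemma eventually_not_isProper {R : Type*} [CommRing R] {I : IdealisticFiltration R}
    {P : MaximalSpectrum R} (hP : ¬ (I.localize P.asIdeal).IsProper) :
    ∀ᶠ Q : MaximalSpectrum R in 𝓝 P, ¬ (I.localize Q.asIdeal).IsProper := by
  simp only [IsProper, not_forall] at hP
  obtain ⟨a, ha, h⟩ := hP
  have hex : ∃ f ∈ I.level a, f ∉ P.asIdeal := by
    by_contra! hcon
    refine h (Ideal.map_le_iff_le_comap.2 fun f hf => ?_)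
    exact (IsLocalization.AtPrime.to_map_mem_maximal_iff _ P.asIdeal f).2 (hcon f hf)
  obtain ⟨f, hf, hfP⟩ := hex
  filter_upwards [eventually_notMem hfP] with Q hQ hprop
  exact hQ ((IsLocalization.AtPrime.to_map_mem_maximal_iff _ Q.asIdeal f).1
    (hprop a ha (Ideal.mem_map_of_mem _ hf)))

variable {k R : Type*} [Field k] [IsAlgClosed k] (p : ℕ) [ExpChar k p] [CommRing R] [IsDomain R]
  [Algebra k R] [Algebra.Smooth k R] {d : ℕ} {I : IdealisticFiltration R}

omit [IsDomain R] [Algebra.Smooth k R] in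
lemma eventually_finrank_quotient_le [Algebra.FiniteType k R] {G : Finset (R × ℕ)}
    {M : ℕ} (hM : (1, M) ∈ G)
    {K : ∀ (P : Ideal R) [P.IsPrime], Ideal (Localization.AtPrime P)}
    (hK : ∀ (P : Ideal R) [P.IsPrime], K P =
      mixedIdeal G (algebraMap R (Localization.AtPrime P)) (maximalIdeal _))
    (P : MaximalSpectrum R)
    (hfin : Module.Finite k (Localization.AtPrime P.asIdeal ⧸ K P.asIdeal)) :
    ∀ᶠ Q : MaximalSpectrum R in 𝓝 P,
      Module.finrank k (Localization.AtPrime Q.asIdeal ⧸ K Q.asIdeal) ≤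
        Module.finrank k (Localization.AtPrime P.asIdeal ⧸ K P.asIdeal) := by
  obtain ⟨g, hg, h⟩ := exists_finrank_quotient_le hM K hK P.asIdeal hfin
  filter_upwards [eventually_notMem hg] with Q hQ
  exact (h Q.asIdeal hQ).2

lemma lPure_le (hI : I.IsDSaturated k) (P : MaximalSpectrum R) (e : ℕ) :
    lPure k p I P e ≤ Module.finrank R (Ω[R⁄k]) := by
  obtain ⟨s, HF⟩ := exists_hasFrames hI P.asIdeal
  exact HF.finrank_purePart_le p e

lemma lPure_mono (hI : I.IsDSaturated k) (P : MaximalSpectrum R) : Monotone (lPure k p I P) := by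
  obtain ⟨s, HF⟩ := exists_hasFrames hI P.asIdeal
  exact HF.finrank_purePart_mono p

lemma lPure_of_not_isProper (hI : I.IsDSaturated k) {P : MaximalSpectrum R}
    (hP : ¬ (I.localize P.asIdeal).IsProper) (e : ℕ) :
    lPure k p I P e = Module.finrank R (Ω[R⁄k]) := by
  obtain ⟨s, HF⟩ := exists_hasFrames hI P.asIdeal
  exact HF.finrank_purePart_of_not_isProper p hP e

lemma lPure_le_of_ringKrullDim (hd : ringKrullDim R = d) (hI : I.IsDSaturated k)
    (P : MaximalSpectrum R) (e : ℕ) : lPure k p I P e ≤ d :=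
  (lPure_le p hI P e).trans (finrank_kaehlerDifferential_le (k := k) hd)

/-- A leading generator system exists at every closed point. -/
theorem exists_isLGS_localize (hI : I.IsDSaturated k) (P : MaximalSpectrum R) :
    ∃ (N : ℕ) (h : Fin N → Localization.AtPrime P.asIdeal) (e : Fin N → ℕ),
      IsLGS k p (I.localize P.asIdeal) h e := by
  obtain ⟨s, HF⟩ := exists_hasFrames hI P.asIdeal
  exact HF.exists_isLGS p

/-- The invariant `μ̃` can be computed with any leading generator system. -/
theorem muTilde_eq_muMod (hI : I.IsDSaturated k) (P : MaximalSpectrum R) {N : ℕ}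
    {h : Fin N → Localization.AtPrime P.asIdeal} {e : Fin N → ℕ}
    (L : IsLGS k p (I.localize P.asIdeal) h e) :
    muTilde k p I P = muMod (I.localize P.asIdeal) h := by
  obtain ⟨s, HF⟩ := exists_hasFrames hI P.asIdeal
  have H : ∃ x : (N : ℕ) × (Fin N → Localization.AtPrime P.asIdeal) × (Fin N → ℕ),
      IsLGS k p (I.localize P.asIdeal) x.2.1 x.2.2 := ⟨⟨N, h, e⟩, L⟩
  rw [muTilde, dif_pos H]
  exact HF.muMod_eq H.choose_spec L

lemma muTilde_of_not_isProper (hI : I.IsDSaturated k) {P : MaximalSpectrum R}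
    (hP : ¬ (I.localize P.asIdeal).IsProper) : muTilde k p I P = 0 := by
  obtain ⟨N, h, e, L⟩ := exists_isLGS_localize p hI P
  rw [muTilde_eq_muMod p hI P L, L.muMod_eq_zero hP]

/-- Near `P` the leading algebra does not get smaller in degree `p ^ e`: its codimension is read off
from a colength, which is upper semi-continuous. -/
lemma eventually_ncard_goodExponents_le (hI : I.IsDSaturated k) {P : MaximalSpectrum R}
    (hP : (I.localize P.asIdeal).IsProper) (e : ℕ) :
    ∀ᶠ Q : MaximalSpectrum R in 𝓝 P, (I.localize Q.asIdeal).IsProper →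
      (goodExponents (fun i : Fin (Module.finrank R (Ω[R⁄k])) => expo p (lPure k p I P) i)
        (p ^ e)).ncard ≤
      (goodExponents (fun i : Fin (Module.finrank R (Ω[R⁄k])) => expo p (lPure k p I Q) i)
        (p ^ e)).ncard := by
  have : IsNoetherianRing R := Algebra.FiniteType.isNoetherianRing k R
  have key : ∀ Q : MaximalSpectrum R, (I.localize Q.asIdeal).IsProper →
      Module.Finite k (Localization.AtPrime Q.asIdeal ⧸
        ((I.localize Q.asIdeal).level (p ^ e : ℕ) ⊔ maximalIdeal _ ^ (p ^ e + 1))) ∧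
      Module.finrank k (Localization.AtPrime Q.asIdeal ⧸
        ((I.localize Q.asIdeal).level (p ^ e : ℕ) ⊔ maximalIdeal _ ^ (p ^ e + 1))) +
      (goodExponents (fun i : Fin (Module.finrank R (Ω[R⁄k])) => expo p (lPure k p I Q) i)
        (p ^ e)).ncard = {D : Fin (Module.finrank R (Ω[R⁄k])) →₀ ℕ | D.degree ≤ p ^ e}.ncard := by
    intro Q hQ
    obtain ⟨s, HF⟩ := exists_hasFrames hI Q.asIdeal
    obtain ⟨N, h, e', L⟩ := exists_isLGS_localize p hI Q
    obtain ⟨h1, h2⟩ := HF.finrank_quotient_level L hQ (p ^ e)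
    refine ⟨h1, ?_⟩
    rw [h2]
    exact Set.ncard_sdiff_add_ncard_of_subset (fun D hD => hD.1.le) (Finsupp.finite_of_degree_le _)
  obtain ⟨G, hG, hK⟩ := exists_level_sup_eq_mixedIdeal I ((p ^ e : ℕ) : ℝ) (p ^ e + 1)
  filter_upwards [eventually_finrank_quotient_le (k := k) hG hK P (key P hP).1] with Q hle hQ
  have h1 := (key P hP).2
  have h2 := (key Q hQ).2
  omega

/-- The invariant `σ` is upper semi-continuous on the closed points. -/
lemma eventually_sigma_le (hd : ringKrullDim R = d) (hI : I.IsDSaturated k)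
    (P : MaximalSpectrum R) :
    ∀ᶠ Q : MaximalSpectrum R in 𝓝 P, sigma k p d I Q ≤ sigma k p d I P := by
  have hle : ∀ {Q}, (∀ e, lPure k p I P e ≤ lPure k p I Q e) →
      sigma k p d I Q ≤ sigma k p d I P := fun h =>
    Pi.toLex_monotone fun e => Nat.sub_le_sub_left (h e) d
  have hnon : ∀ {Q : MaximalSpectrum R}, ¬ (I.localize Q.asIdeal).IsProper →
      sigma k p d I Q ≤ sigma k p d I P := fun hQ =>
    hle fun e => by rw [lPure_of_not_isProper p hI hQ]; exact lPure_le p hI P e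
  by_cases hP : (I.localize P.asIdeal).IsProper
  · -- The monotone bounded sequence of dimensions at `P` is constant from some index `E` on.
    obtain ⟨E, hE⟩ : ∃ E, ∀ e, E ≤ e → lPure k p I P e = lPure k p I P E := by
      obtain ⟨_, ⟨E, rfl⟩, hE⟩ := Set.exists_max_image (Set.range (lPure k p I P)) id
        ((Set.finite_Iic _).subset (Set.range_subset_iff.2 fun e => lPure_le p hI P e))
        (Set.range_nonempty _)
      exact ⟨E, fun e he => le_antisymm (hE _ ⟨e, rfl⟩) (lPure_mono p hI P he)⟩
    have hev : ∀ᶠ Q : MaximalSpectrum R in 𝓝 P, ∀ e ∈ Finset.range (E + 1),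
        (I.localize Q.asIdeal).IsProper →
        (goodExponents (fun i : Fin (Module.finrank R (Ω[R⁄k])) => expo p (lPure k p I P) i)
          (p ^ e)).ncard ≤
        (goodExponents (fun i : Fin (Module.finrank R (Ω[R⁄k])) => expo p (lPure k p I Q) i)
          (p ^ e)).ncard :=
      (Filter.eventually_all_finset _).2 fun e _ => eventually_ncard_goodExponents_le p hI hP e
    filter_upwards [hev] with Q hQ
    by_cases hQp : (I.localize Q.asIdeal).IsProper
    swap
    · exact hnon hQp
    refine le_of_not_gt fun ⟨j, hj, hlt⟩ => ?_
    have hj' : ∀ i < j, lPure k p I P i = lPure k p I Q i := fun i hi => by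
      have h1 : d - lPure k p I P i = d - lPure k p I Q i := hj i hi
      have h2 := lPure_le_of_ringKrullDim p hd hI P i
      have h3 := lPure_le_of_ringKrullDim p hd hI Q i
      omega
    have hlt' : lPure k p I Q j < lPure k p I P j := by
      have h1 : d - lPure k p I P j < d - lPure k p I Q j := hlt
      omega
    by_cases hjE : j ≤ E
    · refine absurd (hQ j (by simpa [Nat.lt_succ_iff] using hjE) hQp) (not_le.2 ?_)
      refine ncard_goodExponents_lt (expChar_pos k p) (lPure_mono p hI Q) (fun hp m => ?_)
        (lPure_le p hI P) hj' hlt'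
      obtain ⟨s, HF⟩ := exists_hasFrames hI Q.asIdeal
      exact HF.finrank_purePart_eq p hp m
    · have h1 := hE j (not_le.1 hjE).le
      have h2 := hj' E (not_le.1 hjE)
      have h3 := lPure_mono p hI Q (not_le.1 hjE).le
      omega
  · filter_upwards [eventually_not_isProper hP] with Q hQ using hnon hQ

/-- On the locus where `σ` is constant, `μ̃` is upper semi-continuous. -/
lemma eventually_muTilde_lt (hd : ringKrullDim R = d) (hI : I.IsDSaturated k)
    {P : MaximalSpectrum R} {b : ENNReal} (hb : muTilde k p I P < b) :
    ∀ᶠ Q : MaximalSpectrum R in 𝓝 P, sigma k p d I Q = sigma k p d I P →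
      muTilde k p I Q < b := by
  have : IsNoetherianRing R := Algebra.FiniteType.isNoetherianRing k R
  by_cases hP : (I.localize P.asIdeal).IsProper
  swap
  · filter_upwards [eventually_not_isProper hP] with Q hQ _
    rw [muTilde_of_not_isProper p hI hQ]
    exact bot_le.trans_lt hb
  obtain ⟨s, HF⟩ := exists_hasFrames hI P.asIdeal
  obtain ⟨N, h, e, L⟩ := exists_isLGS_localize p hI P
  obtain ⟨ν, hν0, hPν, hνb⟩ := ENNReal.lt_iff_exists_real_btwn.1 hb
  have hν : 1 < ν := by
    have h1 := (HF.one_le_muMod hP h).trans_lt (muTilde_eq_muMod p hI P L ▸ hPν)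
    simpa using h1
  have hnot : ¬ ENNReal.ofReal ν ≤ muMod (I.localize P.asIdeal) h :=
    not_le.2 (muTilde_eq_muMod p hI P L ▸ hPν)
  rw [HF.ofReal_le_muMod_iff L hν] at hnot
  push Not at hnot
  obtain ⟨a, ha⟩ := hnot
  obtain ⟨G, M, hG, hK⟩ := exists_enlarge_eq_mixedIdeal I (zero_lt_one.trans hν) a
  have hfin : Module.Finite k (Localization.AtPrime P.asIdeal ⧸
      ((I.localize P.asIdeal).enlarge ν).level a) := by
    obtain ⟨τ, F, -⟩ := HF.exists_frame
    have := (F.finrank_quotient_pow M).1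
    have hle : maximalIdeal (Localization.AtPrime P.asIdeal) ^ M ≤
        ((I.localize P.asIdeal).enlarge ν).level a := hK P.asIdeal ▸ pow_le_mixedIdeal hG _ _
    exact Module.Finite.of_surjective (Ideal.Quotient.factorₐ k hle).toLinearMap
      (Ideal.Quotient.factor_surjective hle)
  filter_upwards [eventually_finrank_quotient_le (k := k) hG
    (K := fun Q _ => ((I.localize Q).enlarge ν).level a) hK P hfin] with Q hQ hσ
  have hc : lPure k p I Q = lPure k p I P := by
    funext i
    have h1 : d - lPure k p I Q i = d - lPure k p I P i := congrFun hσ i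
    have h2 := lPure_le_of_ringKrullDim p hd hI P i
    have h3 := lPure_le_of_ringKrullDim p hd hI Q i
    omega
  obtain ⟨s', HF'⟩ := exists_hasFrames hI Q.asIdeal
  obtain ⟨N', h', e', L'⟩ := exists_isLGS_localize p hI Q
  rw [muTilde_eq_muMod p hI Q L']
  refine lt_of_not_ge fun hcon => ?_
  have h1 := (HF'.ofReal_le_muMod_iff L' hν).1 (hνb.le.trans hcon) a
  have h2 : (fun m => Module.finrank k (purePart k p (I.localize Q.asIdeal) m)) =
      fun m => Module.finrank k (purePart k p (I.localize P.asIdeal) m) := hc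
  rw [h2] at h1
  exact absurd (h1.trans hQ) (not_le.2 ha)

/-- The pair `(σ, μ̃)` is upper semi-continuous on the closed points. -/
theorem isClosed_le_sigmaMu (hd : ringKrullDim R = d) (hI : I.IsDSaturated k)
    (t : Lex (ℕ → ℕ) ×ₗ ENNReal) : IsClosed {P : MaximalSpectrum R | t ≤ sigmaMu k p d I P} := by
  rw [← isOpen_compl_iff, isOpen_iff_mem_nhds]
  intro P hP
  have hlt : sigmaMu k p d I P < t := not_le.1 hP
  rw [Prod.Lex.lt_iff] at hlt
  have key : ∀ᶠ Q : MaximalSpectrum R in 𝓝 P, sigmaMu k p d I Q < t := by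
    rcases hlt with hlt | ⟨heq, hlt⟩
    · filter_upwards [eventually_sigma_le p hd hI P] with Q hQ
      exact Prod.Lex.lt_iff.2 (Or.inl (lt_of_le_of_lt hQ hlt))
    · filter_upwards [eventually_sigma_le p hd hI P, eventually_muTilde_lt p hd hI hlt]
        with Q hQ hQ'
      rcases hQ.lt_or_eq with h | h
      · exact Prod.Lex.lt_iff.2 (Or.inl (lt_of_lt_of_eq h heq))
      · exact Prod.Lex.lt_iff.2 (Or.inr ⟨h.trans heq, hQ' h⟩)
  filter_upwards [key] with Q hQ using not_le.2 hQ

end ClosedPoints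


/-! ### Filtrations of r.f.g. type -/

section RFG

/-- The preimage of a filtration under a ring homomorphism. -/
def comap {R S : Type*} [CommRing R] [CommRing S] (J : IdealisticFiltration S) (u : R →+* S) :
    IdealisticFiltration R where
  level a := (J.level a).comap u
  level_zero := by rw [J.level_zero, Ideal.comap_top]
  mul_mem hf hg := by
    rw [Ideal.mem_comap, map_mul]
    exact J.mul_mem hf hg
  antitone _ _ hab := Ideal.comap_mono (J.antitone hab)

/-- If `I` is generated by a finite set, then `μ` is attained on the generators of positive
level. -/
lemma muMod_localize_eq_iInf {R : Type*} [CommRing R] {I : IdealisticFiltration R}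
    {T : Finset (R × ℚ)} (hT : ∀ x ∈ T, x.1 ∈ I.level (x.2 : ℝ))
    (hmin : ∀ J : IdealisticFiltration R, (∀ x ∈ T, x.1 ∈ J.level (x.2 : ℝ)) →
      ∀ a : ℝ, I.level a ≤ J.level a) (P : Ideal R) [P.IsPrime] {N : ℕ}
    (h : Fin N → Localization.AtPrime P) :
    muMod (I.localize P) h = (T.filter fun x => 0 < x.2).inf fun x =>
      (ordMod h (algebraMap R (Localization.AtPrime P) x.1) : ENNReal) /
        ENNReal.ofReal (x.2 : ℝ) := by
  refine le_antisymm (Finset.le_inf fun x hx => ?_) (le_of_not_gt fun hlt => ?_)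
  · rw [mem_filter] at hx
    exact iInf₂_le_of_le (x.2 : ℝ) (by exact_mod_cast hx.2)
      (iInf₂_le _ (Ideal.mem_map_of_mem _ (hT x hx.1)))
  · -- For `ν` in between, the elements of order at least `ν a` modulo `h`, in level `a`, form a
    -- filtration of `R` that contains the generators, and hence `I`.
    obtain ⟨ν, hν, h1, h2⟩ := ENNReal.lt_iff_exists_real_btwn.1 hlt
    refine absurd ((ofReal_le_muMod_iff _ h hν).2 fun a => ?_) (not_le.2 h1)
    refine Ideal.map_le_iff_le_comap.2 (hmin (((adic (maximalIdeal _) ν hν).supConst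
      (Ideal.span (Set.range h))).comap (algebraMap R _)) (fun x hx => ?_) a)
    change _ ∈ maximalIdeal _ ^ ⌈ν * (x.2 : ℝ)⌉₊ ⊔ Ideal.span (Set.range h)
    rcases le_or_gt x.2 0 with ha | ha
    · rw [Nat.ceil_eq_zero.2 (mul_nonpos_of_nonneg_of_nonpos hν (by exact_mod_cast ha))]
      simp
    · exact (ofReal_le_ordMod_div_iff h hν (by exact_mod_cast ha) _).1
        (h2.le.trans (Finset.inf_le (mem_filter.2 ⟨hx, ha⟩)))

/-- The quotient of an integer by `a = r / s` lies in `(1 / δ) ℤ` when `r ∣ δ`. -/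
lemma exists_natCast_div_eq {δ : ℕ} (hδ : 0 < δ) {a : ℚ} (ha : 0 < a) (hdvd : a.num.toNat ∣ δ)
    (m : ℕ) :
    ∃ m' : ℕ, (m : ENNReal) / ENNReal.ofReal (a : ℝ) = (m' : ENNReal) / (δ : ENNReal) := by
  obtain ⟨c, rfl⟩ := hdvd
  have hnum : 0 < a.num := Rat.num_pos.2 ha
  have hc : 0 < c := Nat.pos_of_mul_pos_left hδ
  have hn : 0 < a.num.toNat := by omega
  have ha' : (a : ℝ) = (a.num.toNat : ℝ) / (a.den : ℝ) := by
    have h1 : ((a.num.toNat : ℤ) : ℝ) = a.num := by rw [Int.toNat_of_nonneg hnum.le]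
    rw [Rat.cast_def, ← h1, Int.cast_natCast]
  refine ⟨m * a.den * c, ?_⟩
  have hden : (0 : ℝ) < a.den := by exact_mod_cast a.den_pos
  have hnR : (0 : ℝ) < a.num.toNat := by exact_mod_cast hn
  have hcR : (0 : ℝ) < c := by exact_mod_cast hc
  rw [← ENNReal.ofReal_natCast m, ← ENNReal.ofReal_natCast (m * a.den * c),
    ← ENNReal.ofReal_natCast (a.num.toNat * c), ← ENNReal.ofReal_div_of_pos (by exact_mod_cast ha),
    ← ENNReal.ofReal_div_of_pos (by positivity), ha']
  congr 1
  push_cast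
  field_simp

/-- For a filtration of r.f.g. type the values of `μ̃` have bounded denominators: a common
denominator is the product of the numerators of the positive levels of the generators. -/
theorem IsRFG.exists_muTilde_eq {k R : Type*} [Field k] [IsAlgClosed k] (p : ℕ) [ExpChar k p]
    [CommRing R] [IsDomain R] [Algebra k R] [Algebra.Smooth k R] {I : IdealisticFiltration R}
    (hI : I.IsDSaturated k) (hrfg : I.IsRFG) :
    ∃ δ : ℕ, 0 < δ ∧ ∀ P : MaximalSpectrum R, muTilde k p I P = ⊤ ∨
      ∃ m : ℕ, muTilde k p I P = (m : ENNReal) / (δ : ENNReal) := by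
  obtain ⟨T, hT, hmin⟩ := hrfg
  set T' := T.filter fun x => 0 < x.2
  have hpos : 0 < ∏ x ∈ T', x.2.num.toNat := prod_pos fun x hx => by
    have := Rat.num_pos.2 (mem_filter.1 hx).2
    omega
  refine ⟨∏ x ∈ T', x.2.num.toNat, hpos, fun P => ?_⟩
  obtain ⟨N, h, e, L⟩ := exists_isLGS_localize p hI P
  rw [muTilde_eq_muMod p hI P L, muMod_localize_eq_iInf hT hmin]
  rcases T'.eq_empty_or_nonempty with h0 | h0
  · left
    exact (congrArg (fun s => Finset.inf s _) h0).trans Finset.inf_empty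
  · obtain ⟨x, hx, hxe⟩ := Finset.exists_mem_eq_inf T' h0 fun x =>
      (ordMod h (algebraMap R (Localization.AtPrime P.asIdeal) x.1) : ENNReal) /
        ENNReal.ofReal (x.2 : ℝ)
    rw [hxe]
    induction ordMod h (algebraMap R (Localization.AtPrime P.asIdeal) x.1) using ENat.recTopCoe with
    | top => exact Or.inl (ENNReal.top_div_of_ne_top ENNReal.ofReal_ne_top)
    | coe m =>
      exact Or.inr (exists_natCast_div_eq hpos (mem_filter.1 hx).2 (dvd_prod_of_mem _ hx) m)

end RFG

/-! ### The well-ordered set of values -/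

section WellOrder

/-- The non-increasing sequences of natural numbers are well-ordered lexicographically. -/
lemma isWF_antitone : {c : Lex (ℕ → ℕ) | Antitone (ofLex c)}.IsWF := by
  refine Set.wellFoundedOn_iff.2 (WellFounded.wellFounded_iff_has_min.2 fun S hS => ?_)
  -- The order is the one restricted to the set, so an element outside of the set is minimal.
  by_cases hSA : S ⊆ {c : Lex (ℕ → ℕ) | Antitone (ofLex c)}
  swap
  · obtain ⟨c, hc, hcA⟩ := Set.not_subset.1 hSA
    exact ⟨c, hc, fun c' _ h => hcA h.2.2⟩
  -- `G n` consists of the elements of `S` whose first `n` entries are minimal.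
  let G : ℕ → Set (Lex (ℕ → ℕ)) := fun n => Nat.rec S
    (fun n X => {c | c ∈ X ∧ ∀ c' ∈ X, c n ≤ c' n}) n
  have hG : ∀ n, G (n + 1) = {c | c ∈ G n ∧ ∀ c' ∈ G n, c n ≤ c' n} := fun n => rfl
  have hGanti : Antitone G := antitone_nat_of_succ_le fun n c hc => hc.1
  have hne : ∀ n, (G n).Nonempty := fun n => by
    induction n with
    | zero => exact hS
    | succ n ih =>
      obtain ⟨c, hc, hmin⟩ := WellFounded.has_min (measure fun c : Lex (ℕ → ℕ) => c n).wf (G n) ih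
      exact ⟨c, hc, fun c' hc' => not_lt.1 (hmin c' hc')⟩
  choose g hg using hne
  have hval : ∀ m n, m < n → ∀ c ∈ G n, c m = g (m + 1) m := fun m n hmn c hc =>
    le_antisymm ((hGanti hmn hc).2 _ (hGanti m.le_succ (hg (m + 1))))
      ((hg (m + 1)).2 _ (hGanti hmn.le hc))
  -- The successive minimum of index `E` is the smallest one, so the non-increasing sequence
  -- `g (E + 1)` stays minimal at all later entries.
  obtain ⟨_, ⟨E, rfl⟩, hE⟩ := WellFounded.has_min (measure (id : ℕ → ℕ)).wf
    (Set.range fun n => g (n + 1) n) (Set.range_nonempty _)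
  have hmem : ∀ n, g (E + 1) ∈ G n := fun n => by
    induction n with
    | zero => exact hGanti (Nat.zero_le (E + 1)) (hg (E + 1))
    | succ n ih =>
      rcases Nat.lt_or_ge n (E + 1) with h | h
      · exact hGanti h (hg (E + 1))
      · refine ⟨ih, fun c' hc' => ?_⟩
        have h1 : g (E + 1) n ≤ g (E + 1) E := hSA (hGanti (Nat.zero_le _) ih) (by omega)
        have h2 : g (E + 1) E ≤ g (n + 1) n := not_lt.1 (hE _ ⟨n, rfl⟩)
        exact (h1.trans h2).trans ((hg (n + 1)).2 c' hc')
  refine ⟨g (E + 1), hmem 0, fun c' hc' h => ?_⟩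
  obtain ⟨j, hj, hlt⟩ := h.1
  have hc'j : ∀ i ≤ j, c' ∈ G i := fun i hi => by
    induction i with
    | zero => exact hc'
    | succ i ih =>
      refine ⟨ih (by omega), fun c'' hc'' => ?_⟩
      rw [show c' i = g (E + 1) i from hj i (by omega)]
      exact (hmem (i + 1)).2 c'' hc''
  exact absurd ((hmem (j + 1)).2 c' (hc'j j le_rfl)) (not_le.2 hlt)

/-- The set of values is well-ordered, as a subset of a lexicographic product of two well-ordered
sets. -/
theorem isWF_boundedDenominatorValues (δ : ℕ) : (boundedDenominatorValues δ).IsWF := by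
  refine (Set.PartiallyWellOrderedOn.subsetProdLex ?_ fun c => ?_).isWF
  · refine Set.IsPWO.mono isWF_antitone.isPWO ?_
    rintro _ ⟨x, hx, rfl⟩
    exact hx.1
  · have h1 : (Set.univ : Set ℕ).IsPWO := (Set.isWF_univ_iff.2 inferInstance).isPWO
    have h2 := h1.image_of_monotone (f := fun m : ℕ => (m : ENNReal) / (δ : ENNReal))
      fun a b hab => ENNReal.div_le_div_right (by exact_mod_cast hab) _
    refine Set.IsPWO.mono ((Set.isPWO_singleton ⊤).union h2) ?_
    rintro y ⟨-, hy | ⟨m, hm⟩⟩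
    · exact Or.inl hy
    · exact Or.inr ⟨m, trivial, hm.symm⟩

end WellOrder

end IdealisticFiltration

namespace IdealisticFiltration

open Finset

/-! ### Extension of semi-continuous functions from the closed points to the spectrum -/

section Spectrum

variable {R V : Type*} [CommRing R] [LinearOrder V]

lemma toPrimeSpectrum_mem_closure_iff {P : MaximalSpectrum R} {Q : PrimeSpectrum R} :
    P.toPrimeSpectrum ∈ closure {Q} ↔ Q.asIdeal ≤ P.asIdeal := by
  rw [← specializes_iff_mem_closure, ← PrimeSpectrum.le_iff_specializes]
  rfl

lemma exists_toPrimeSpectrum_eq {Q : PrimeSpectrum R} (hQ : Q ∈ closedPoints (PrimeSpectrum R)) :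
    ∃ P : MaximalSpectrum R, P.toPrimeSpectrum = Q :=
  ⟨⟨Q.asIdeal, (PrimeSpectrum.isClosed_singleton_iff_isMaximal Q).1 hQ⟩, rfl⟩

/-- `F Q` is the least value of `s` at the closed points of the closure of `Q`. -/
def IsMinExtension (s : MaximalSpectrum R → V) (F : PrimeSpectrum R → V) : Prop :=
  ∀ Q, IsLeast {v | ∃ P : MaximalSpectrum R, P.toPrimeSpectrum ∈ closure {Q} ∧ s P = v} (F Q)

lemma exists_isMinExtension {s : MaximalSpectrum R → V} (hs : (Set.range s).IsWF) :
    ∃ F, IsMinExtension s F := by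
  have h : ∀ Q : PrimeSpectrum R,
      ∃ v, IsLeast {v | ∃ P : MaximalSpectrum R, P.toPrimeSpectrum ∈ closure {Q} ∧ s P = v} v := by
    intro Q
    have hwf : {v | ∃ P : MaximalSpectrum R, P.toPrimeSpectrum ∈ closure {Q} ∧ s P = v}.IsWF :=
      hs.mono (by rintro _ ⟨P, -, rfl⟩; exact ⟨P, rfl⟩)
    have hne : {v | ∃ P : MaximalSpectrum R,
        P.toPrimeSpectrum ∈ closure {Q} ∧ s P = v}.Nonempty := by
      obtain ⟨𝔫, h𝔫, hle⟩ := Ideal.exists_le_maximal Q.asIdeal Q.2.ne_top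
      exact ⟨_, ⟨𝔫, h𝔫⟩, toPrimeSpectrum_mem_closure_iff.2 hle, rfl⟩
    exact ⟨hwf.min hne, hwf.min_mem hne, fun v hv => hwf.min_le hne hv⟩
  choose F hF using h
  exact ⟨F, hF⟩

variable {s : MaximalSpectrum R → V} {F : PrimeSpectrum R → V} (hF : IsMinExtension s F)
include hF

namespace IsMinExtension

lemma le_iff {t : V} {Q : PrimeSpectrum R} :
    t ≤ F Q ↔ ∀ P : MaximalSpectrum R, P.toPrimeSpectrum ∈ closure {Q} → t ≤ s P := by
  rw [le_isGLB_iff (hF Q).isGLB]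
  exact ⟨fun h P hP => h ⟨P, hP, rfl⟩, by rintro h _ ⟨P, hP, rfl⟩; exact h P hP⟩

lemma apply_toPrimeSpectrum (P : MaximalSpectrum R) : F P.toPrimeSpectrum = s P := by
  obtain ⟨P', hP', h⟩ := (hF P.toPrimeSpectrum).1
  have h1 : P = P' := MaximalSpectrum.ext
    (P.isMaximal.eq_of_le P'.isMaximal.ne_top (toPrimeSpectrum_mem_closure_iff.1 hP'))
  rw [← h, ← h1]

lemma range_subset : Set.range F ⊆ Set.range s := by
  rintro _ ⟨Q, rfl⟩
  obtain ⟨P, -, h⟩ := (hF Q).1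
  exact ⟨P, h⟩

/-- In the spectrum of a Jacobson ring the closed points are dense in every closed set, so a closed
set of closed points is the trace of the locus where `t ≤ F`. -/
lemma isClosed_le [IsJacobsonRing R] {t : V} (ht : IsClosed {P | t ≤ s P}) :
    IsClosed {Q | t ≤ F Q} := by
  obtain ⟨C, hC, hCs⟩ := isClosed_induced_iff.1 ht
  convert hC using 1
  ext Q
  have hmem : ∀ P : MaximalSpectrum R, P.toPrimeSpectrum ∈ C ↔ t ≤ s P := fun P =>
    Set.ext_iff.1 hCs P
  rw [Set.mem_ofPred_eq, hF.le_iff]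
  constructor
  · intro h
    have h1 : closure (closure {Q} ∩ closedPoints (PrimeSpectrum R)) ⊆ C := by
      refine closure_minimal ?_ hC
      rintro Q' ⟨h1, h2⟩
      obtain ⟨P, rfl⟩ := exists_toPrimeSpectrum_eq h2
      exact (hmem P).2 (h P h1)
    rw [JacobsonSpace.closure_inter_closedPoints isClosed_closure] at h1
    exact h1 (subset_closure rfl)
  · exact fun h P hP => (hmem P).1 (closure_minimal (Set.singleton_subset_iff.2 h) hC hP)

variable [IsJacobsonRing R] (hs : (Set.range s).IsWF) (hcl : ∀ t, IsClosed {P | t ≤ s P})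
include hs hcl

/-- The condition `t < F` is the condition `t' ≤ F` for the next value `t'`. -/
lemma isClosed_lt (t : V) : IsClosed {Q | t < F Q} := by
  rcases (Set.range s ∩ Set.Ioi t).eq_empty_or_nonempty with h | h
  · convert isClosed_empty
    refine Set.eq_empty_of_forall_notMem fun Q hQ => ?_
    exact Set.eq_empty_iff_forall_notMem.1 h (F Q) ⟨hF.range_subset ⟨Q, rfl⟩, hQ⟩
  · have hwf : (Set.range s ∩ Set.Ioi t).IsWF := hs.mono Set.inter_subset_left
    convert hF.isClosed_le (hcl (hwf.min h)) using 1
    ext Q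
    exact ⟨fun hQ => hwf.min_le h ⟨hF.range_subset ⟨Q, rfl⟩, hQ⟩,
      fun hQ => lt_of_lt_of_le (hwf.min_mem h).2 hQ⟩

lemma isOpen_le (t : V) : IsOpen {Q | F Q ≤ t} := by
  convert (hF.isClosed_lt hs hcl t).isOpen_compl using 1
  ext Q
  simp

/-- The value of the extension at `Q` is the value at the general closed points of the closure
of `Q`. -/
lemma eq_iff (Q : PrimeSpectrum R) (v : V) :
    F Q = v ↔ ∃ U : Set (PrimeSpectrum R), IsOpen U ∧ (U ∩ closure {Q}).Nonempty ∧
      ∀ P : MaximalSpectrum R, P.toPrimeSpectrum ∈ U ∩ closure {Q} → s P = v := by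
  have key : ∀ P : MaximalSpectrum R, P.toPrimeSpectrum ∈ closure {Q} →
      F P.toPrimeSpectrum ≤ F Q → s P = F Q := fun P hP hle =>
    le_antisymm (hF.apply_toPrimeSpectrum P ▸ hle) ((hF Q).2 ⟨P, hP, rfl⟩)
  -- On the open set where `F` is at most `F Q`, the closed points of the closure of `Q` have the
  -- value `F Q`; any two nonempty open subsets of the closure share a closed point.
  constructor
  · rintro rfl
    exact ⟨{Q' | F Q' ≤ F Q}, hF.isOpen_le hs hcl _, ⟨Q, le_rfl, subset_closure rfl⟩,
      fun P hP => key P hP.2 hP.1⟩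
  · rintro ⟨U, hU, ⟨Q', hQ'U, hQ'⟩, h⟩
    have hQU : Q ∈ U := (specializes_iff_mem_closure.2 hQ').mem_open hU hQ'U
    obtain ⟨Q'', ⟨⟨h1, h2⟩, h3⟩, h4⟩ := nonempty_inter_closedPoints
      (Z := (U ∩ {Q' | F Q' ≤ F Q}) ∩ closure {Q}) ⟨Q, ⟨hQU, le_refl (F Q)⟩, subset_closure rfl⟩
      ((hU.inter (hF.isOpen_le hs hcl _)).isLocallyClosed.inter isClosed_closure.isLocallyClosed)
    obtain ⟨P, rfl⟩ := exists_toPrimeSpectrum_eq h4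
    rw [← key P h3 h2]
    exact h P ⟨h1, h3⟩

/-- The values are well-ordered, and an ascending sequence of values gives a descending sequence
of closed sets. -/
lemma finite_range [IsNoetherianRing R] : (Set.range F).Finite := by
  by_contra hinf
  have hwf := hs.mono hF.range_subset
  let f := Set.Infinite.natEmbedding _ hinf
  obtain ⟨g, hg | hg⟩ := exists_increasing_or_nonincreasing_subseq (· < ·) fun n => (f n : V)
  · let C : ℕ → TopologicalSpace.Closeds (PrimeSpectrum R) := fun n =>
      ⟨{Q | (f (g n) : V) ≤ F Q}, hF.isClosed_le (hcl _)⟩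
    refine not_strictAnti_of_wellFoundedLT C fun m n hmn => ?_
    refine lt_of_le_of_ne (fun Q hQ => (hg m n hmn).le.trans hQ) fun heq => ?_
    obtain ⟨Q, hQ⟩ := (f (g m)).2
    have h1 : Q ∈ C m := hQ.ge
    rw [← heq] at h1
    exact absurd (hg m n hmn) (not_lt.2 ((show (f (g n) : V) ≤ F Q from h1).trans hQ.le))
  · refine Set.isWF_iff_no_descending_seq.1 hwf (fun n => f (g n)) (fun m n hmn => ?_)
      fun n => (f (g n)).2
    refine lt_of_le_of_ne (not_lt.1 (hg m n hmn)) fun heq => ?_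
    exact hmn.ne' (g.injective (f.injective (Subtype.ext heq)))

end IsMinExtension

omit hF in
/-- A function with finitely many values gives rise to a stratification. -/
lemma exists_stratification {X : Type*} [Nonempty X] {F : X → V} (hfin : (Set.range F).Finite) :
    ∃ (n : ℕ) (t : Fin (n + 1) → V),
      StrictMono t ∧ Set.range F = Set.range t ∧
      {Q | t 0 ≤ F Q} = Set.univ ∧
      (∀ i : Fin n, {Q | t i.succ ≤ F Q} ⊂ {Q | t i.castSucc ≤ F Q}) ∧
      {Q | t (Fin.last n) ≤ F Q}.Nonempty ∧
      (∀ i : Fin n, {Q | F Q = t i.castSucc} =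
        {Q | t i.castSucc ≤ F Q} \ {Q | t i.succ ≤ F Q}) ∧
      {Q | F Q = t (Fin.last n)} = {Q | t (Fin.last n) ≤ F Q} := by
  obtain ⟨n, hn⟩ : ∃ n, hfin.toFinset.card = n + 1 :=
    Nat.exists_eq_succ_of_ne_zero (by
      rw [Finset.card_ne_zero, Set.Finite.toFinset_nonempty]
      exact Set.range_nonempty F)
  set t := hfin.toFinset.orderEmbOfFin hn
  have hrange : Set.range F = Set.range t := by simp [t]
  have hex : ∀ Q, ∃ j, F Q = t j := fun Q => by
    obtain ⟨j, hj⟩ := hrange.subset ⟨Q, rfl⟩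
    exact ⟨j, hj.symm⟩
  have hex' : ∀ j, ∃ Q, F Q = t j := fun j => hrange.superset ⟨j, rfl⟩
  refine ⟨n, t, t.strictMono, hrange, Set.eq_univ_of_forall fun Q => ?_, fun i => ?_, ?_,
    fun i => ?_, ?_⟩
  · obtain ⟨j, hj⟩ := hex Q
    exact (t.monotone (Fin.zero_le j)).trans hj.ge
  · have hlt : t i.castSucc < t i.succ := t.strictMono Fin.castSucc_lt_succ
    obtain ⟨Q, hQ⟩ := hex' i.castSucc
    exact ⟨fun Q hQ => hlt.le.trans hQ, fun hsub => absurd (hsub hQ.ge) (not_le.2 (hQ ▸ hlt))⟩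
  · obtain ⟨Q, hQ⟩ := hex' (Fin.last n)
    exact ⟨Q, hQ.ge⟩
  · ext Q
    obtain ⟨j, hj⟩ := hex Q
    simp only [Set.mem_ofPred_eq, Set.mem_sdiff, hj, t.le_iff_le, t.injective.eq_iff, not_le]
    rw [Fin.le_def, Fin.lt_def, Fin.ext_iff, Fin.val_castSucc, Fin.val_succ]
    omega
  · ext Q
    obtain ⟨j, hj⟩ := hex Q
    simp only [Set.mem_ofPred_eq, hj, t.le_iff_le, t.injective.eq_iff]
    exact ⟨fun h => h.ge, fun h => le_antisymm (Fin.le_last j) h⟩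

end Spectrum

end IdealisticFiltration

namespace IdealisticFiltration

/-! ### The invariant on the spectrum -/

lemma antitone_sigma {k R : Type*} [Field k] [IsAlgClosed k] (p : ℕ) [ExpChar k p]
    [CommRing R] [IsDomain R] [Algebra k R] [Algebra.Smooth k R] (d : ℕ)
    {I : IdealisticFiltration R} (hI : I.IsDSaturated k) (P : MaximalSpectrum R) :
    Antitone (ofLex (sigma k p d I P)) :=
  fun _ _ h => Nat.sub_le_sub_left (lPure_mono p hI P h) d

end IdealisticFiltration

open IdealisticFiltration in
theorem proposition3p3p1p1 {k R : Type*} [Field k] [IsAlgClosed k] (p : ℕ) [ExpChar k p]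
    [CommRing R] [IsDomain R] [Algebra k R] [Algebra.Smooth k R]
    (d : ℕ) (hd : ringKrullDim R = d)
    (I : IdealisticFiltration R) (hI : I.IsDSaturated k) :
    -- the invariants are well defined
    (∀ (P : MaximalSpectrum R) (e : ℕ), lPure k p I P e ≤ d) ∧
    (∀ P : MaximalSpectrum R,
      (∃ (N : ℕ) (h : Fin N → Localization.AtPrime P.asIdeal) (e : Fin N → ℕ),
        IsLGS k p (I.localize P.asIdeal) h e) ∧
      ∀ (N : ℕ) (h : Fin N → Localization.AtPrime P.asIdeal) (e : Fin N → ℕ),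
        IsLGS k p (I.localize P.asIdeal) h e →
          muTilde k p I P = muMod (I.localize P.asIdeal) h) ∧
    -- upper semi-continuity on the closed points
    (∀ t : Lex (ℕ → ℕ) ×ₗ ENNReal,
      IsClosed {P : MaximalSpectrum R | t ≤ sigmaMu k p d I P}) ∧
    -- the case of r.f.g. type
    (I.IsRFG →
      ∃ δ : ℕ, 0 < δ ∧
        (∀ P : MaximalSpectrum R, muTilde k p I P = ⊤ ∨
          ∃ m : ℕ, muTilde k p I P = (m : ENNReal) / (δ : ENNReal)) ∧
        (boundedDenominatorValues δ).IsWF ∧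
        ∃ F : PrimeSpectrum R → Lex (ℕ → ℕ) ×ₗ ENNReal,
          -- `F` extends the pair to all of `Spec R`, by the minimum over the closed points of the
          -- closure, or equivalently by the value at a general closed point of the closure
          (∀ P : MaximalSpectrum R, F P.toPrimeSpectrum = sigmaMu k p d I P) ∧
          (∀ Q : PrimeSpectrum R, IsLeast
            {v | ∃ P : MaximalSpectrum R,
              P.toPrimeSpectrum ∈ closure {Q} ∧ sigmaMu k p d I P = v} (F Q)) ∧
          (∀ (Q : PrimeSpectrum R) (v : Lex (ℕ → ℕ) ×ₗ ENNReal), F Q = v ↔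
            ∃ U : Set (PrimeSpectrum R), IsOpen U ∧ (U ∩ closure {Q}).Nonempty ∧
              ∀ P : MaximalSpectrum R, P.toPrimeSpectrum ∈ U ∩ closure {Q} →
                sigmaMu k p d I P = v) ∧
          (∀ Q, F Q ∈ boundedDenominatorValues δ) ∧
          -- upper semi-continuity on `Spec R`, in its three forms
          (∀ t, IsClosed {Q | t ≤ F Q}) ∧
          (∀ Q, ∃ U : Set (PrimeSpectrum R), IsOpen U ∧ Q ∈ U ∧ ∀ Q' ∈ U, F Q' ≤ F Q) ∧
          (∀ t, IsClosed {Q | t < F Q}) ∧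
          -- finitely many values, and the stratification into level sets
          ∃ (n : ℕ) (t : Fin (n + 1) → Lex (ℕ → ℕ) ×ₗ ENNReal),
            StrictMono t ∧ Set.range F = Set.range t ∧
            {Q | t 0 ≤ F Q} = Set.univ ∧
            (∀ i : Fin n, {Q | t i.succ ≤ F Q} ⊂ {Q | t i.castSucc ≤ F Q}) ∧
            {Q | t (Fin.last n) ≤ F Q}.Nonempty ∧
            (∀ i : Fin n, {Q | F Q = t i.castSucc} =
              {Q | t i.castSucc ≤ F Q} \ {Q | t i.succ ≤ F Q}) ∧
            {Q | F Q = t (Fin.last n)} = {Q | t (Fin.last n) ≤ F Q}) := by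
  have : IsNoetherianRing R := Algebra.FiniteType.isNoetherianRing k R
  have : IsJacobsonRing R := isJacobsonRing_of_finiteType (A := k)
  have hcl := isClosed_le_sigmaMu p hd hI
  refine ⟨lPure_le_of_ringKrullDim p hd hI, fun P => ⟨exists_isLGS_localize p hI P,
    fun N h e L => muTilde_eq_muMod p hI P L⟩, hcl, fun hrfg => ?_⟩
  obtain ⟨δ, hδ, hμ⟩ := hrfg.exists_muTilde_eq p hI
  have hsub : Set.range (sigmaMu k p d I) ⊆ boundedDenominatorValues δ := by
    rintro _ ⟨P, rfl⟩
    exact ⟨antitone_sigma p d hI P, hμ P⟩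
  have hwf := isWF_boundedDenominatorValues δ
  have hs := hwf.mono hsub
  obtain ⟨F, hF⟩ := exists_isMinExtension hs
  exact ⟨δ, hδ, hμ, hwf, F, hF.apply_toPrimeSpectrum, hF, hF.eq_iff hs hcl,
    fun Q => hsub (hF.range_subset ⟨Q, rfl⟩), fun t => hF.isClosed_le (hcl t),
    fun Q => ⟨{Q' | F Q' ≤ F Q}, hF.isOpen_le hs hcl _, le_refl (F Q), fun _ h => h⟩,
    hF.isClosed_lt hs hcl, exists_stratification (hF.finite_range hs hcl)⟩
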